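/- Let $d\in\{1,2,3\}$, $\Omega=(-1,1)^d$, $\Theta=(-1,3)^d$ and $s\in[1,2]$. For an open set $U$ and real $t\ge 0$, $H^t(U)$ is the (real) Sobolev--Slobodeckij space: weak derivatives of order at most $\lfloor t\rfloor$ lie in $L^2(U)$ and, if $\sigma=t-\lfloor t\rfloor>0$, each derivative $v$ of order $\lfloor t\rfloor$ satisfies $\int_U\int_U |v(x)-v(y)|^2|x-y|^{-d-2\sigma}\,dx\,dy<\infty$. $H^1_0(\Omega)$ is the closure of $C_c^\infty(\Omega)$ in $H^1(\Omega)$. $H^t_{\mathrm{per}}(\Theta)$ is the space of all $u\in H^t_{\mathrm{loc}}(\mathbb R^d)$ such that $u(x+G)=u(x)$ for a.e. $x\in\mathbb R^d$, for every $G\in 4\mathbb Z^d$. Let $g\in H^s(\Omega)\cap H^1_0(\Omega)\cap C^0(\overline\Omega)$. Then there is a function $g_{\mathrm{per}}\in H^s_{\mathrm{per}}(\Theta)$ with $g_{\mathrm{per}}=g$ on $\Omega$ which is odd under each reflection $x_j\mapsto 2-x_j$, $j=1,\dots,d$ (that is, $g_{\mathrm{per}}(x_1,\dots,2-x_j,\dots,x_d)=-g_{\mathrm{per}}(x)$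 for a.e. $x\in\mathbb R^d$), such that the following hold. 1. There is exactly one $u\in H^1_0(\Omega)$ with $-\Delta u=g$ weakly, i.e. $\int_\Omega\nabla u\cdot\nabla v=\int_\Omega g\,v$ for all $v\in H^1_0(\Omega)$. 2. There is exactly one $u_{\mathrm{per}}\in H^1_{\mathrm{per}}(\Theta)$ with $\int_\Theta u_{\mathrm{per}}=0$ and $-\Delta u_{\mathrm{per}}=g_{\mathrm{per}}$ weakly, i.e. $\int_\Theta\nabla u_{\mathrm{per}}\cdot\nabla v=\int_\Theta g_{\mathrm{per}}\,v$ for all $v\in H^1_{\mathrm{per}}(\Theta)$. 3. $u=u_{\mathrm{per}}$ a.e. on $\Omega$. 4. $u_{\mathrm{per}}\in H^{2+s}_{\mathrm{per}}(\Theta)$, and hence $u\in H^{2+s}(\Omega)$. -/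

import Mathlib

open MeasureTheory Set
open scoped ENNReal ContDiff

namespace OddReflection

/-- The Euclidean space `ℝ^d`. -/
abbrev E (d : ℕ) : Type := EuclideanSpace ℝ (Fin d)

/-- The open cube `(-1, 1)^d`. -/
def Omega (d : ℕ) : Set (E d) := {x | ∀ i, x i ∈ Ioo (-1 : ℝ) 1}

/-- The open cube `(-1, 3)^d`, the unit cell of the lattice `4ℤ^d`. -/
def Theta (d : ℕ) : Set (E d) := {x | ∀ i, x i ∈ Ioo (-1 : ℝ) 3}

/-- `φ ∈ C_c^∞(U)`. -/
structure IsTest {d : ℕ} (U : Set (E d)) (φ : E d → ℝ) : Prop where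
  smooth : ContDiff ℝ ∞ φ
  compact : HasCompactSupport φ
  support : tsupport φ ⊆ U

/-- The classical partial derivative `∂_i φ`. -/
noncomputable def partialDeriv {d : ℕ} (i : Fin d) (φ : E d → ℝ) (x : E d) : ℝ :=
  fderiv ℝ φ x (EuclideanSpace.single i 1)

/-- `v` is the weak partial derivative `∂_i u` on the open set `U`. -/
structure HasWeakPartial {d : ℕ} (U : Set (E d)) (i : Fin d) (u v : E d → ℝ) : Prop where
  locInt : LocallyIntegrableOn u U
  locInt_deriv : LocallyIntegrableOn v U
  integral_eq : ∀ φ : E d → ℝ, IsTest U φ →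
    ∫ x in U, u x * partialDeriv i φ x = -∫ x in U, v x * φ x

/-- `G = (G_1, …, G_d)` is the weak gradient of `u` on the open set `U`. -/
def HasWeakGradient {d : ℕ} (U : Set (E d)) (u : E d → ℝ) (G : Fin d → E d → ℝ) : Prop :=
  ∀ i, HasWeakPartial U i u (G i)

/-- The square of the Gagliardo–Slobodeckij seminorm
`∫_U ∫_U |v(x) - v(y)|² / |x - y|^(d + 2σ) dy dx`. -/
noncomputable def gagliardoSq {d : ℕ} (U : Set (E d)) (σ : ℝ) (v : E d → ℝ) : ℝ≥0∞ :=
  ∫⁻ x in U, ∫⁻ y in U, ENNReal.ofReal ((v x - v y) ^ 2 / ‖x - y‖ ^ ((d : ℝ) + 2 * σ))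

/-- Membership in `H^(k + σ)(U)` for `k ∈ ℕ` and `σ ∈ [0, 1)`: the weak partial derivatives of
order at most `k` are in `L²(U)` and, if `σ > 0`, those of order exactly `k` have a finite
Gagliardo–Slobodeckij seminorm of order `σ`. -/
def MemHAux {d : ℕ} (U : Set (E d)) (σ : ℝ) : ℕ → (E d → ℝ) → Prop
  | 0, u => MemLp u 2 (volume.restrict U) ∧ (0 < σ → gagliardoSq U σ u < ⊤)
  | k + 1, u => MemLp u 2 (volume.restrict U) ∧
      ∀ i, ∃ v, HasWeakPartial U i u v ∧ MemHAux U σ k v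

/-- Membership in the Sobolev(–Slobodeckij) space `H^s(U)`, for real `s ≥ 0` and `U` open. -/
def MemH {d : ℕ} (s : ℝ) (U : Set (E d)) (u : E d → ℝ) : Prop :=
  MemHAux U (s - (⌊s⌋₊ : ℝ)) ⌊s⌋₊ u

/-- Membership in `H^1_0(U)`, the closure of `C_c^∞(U)` in `H^1(U)`. -/
def MemH10 {d : ℕ} (U : Set (E d)) (u : E d → ℝ) : Prop :=
  MemLp u 2 (volume.restrict U) ∧
  ∃ G : Fin d → E d → ℝ, HasWeakGradient U u G ∧
    (∀ i, MemLp (G i) 2 (volume.restrict U)) ∧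
    ∀ ε : ℝ, 0 < ε → ∃ φ, IsTest U φ ∧
      eLpNorm (fun x => u x - φ x) 2 (volume.restrict U) ≤ ENNReal.ofReal ε ∧
      ∀ i, eLpNorm (fun x => G i x - partialDeriv i φ x) 2 (volume.restrict U) ≤
        ENNReal.ofReal ε

/-- Membership in `H^s_loc(ℝ^d)`. -/
def MemHLoc {d : ℕ} (s : ℝ) (u : E d → ℝ) : Prop :=
  ∀ W : Set (E d), IsOpen W → Bornology.IsBounded W → MemH s W u

/-- `u` is `4ℤ^d`-periodic: `u(x + 4k) = u(x)` for a.e. `x`, for every `k ∈ ℤ^d`. -/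
def IsPeriodic {d : ℕ} (u : E d → ℝ) : Prop :=
  ∀ k : Fin d → ℤ, ∀ᵐ x : E d, u (x + WithLp.toLp 2 (fun i => 4 * (k i : ℝ))) = u x

/-- Membership in `H^s_per(Θ)`, `Θ = (-1, 3)^d`: the `4ℤ^d`-periodic elements of
`H^s_loc(ℝ^d)`. -/
def MemHPer {d : ℕ} (s : ℝ) (u : E d → ℝ) : Prop :=
  MemHLoc s u ∧ IsPeriodic u

/-- The reflection `x_j ↦ 2 - x_j` across the hyperplane `{x_j = 1}`. -/
noncomputable def reflect {d : ℕ} (j : Fin d) (x : E d) : E d :=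
  WithLp.toLp 2 (Function.update (fun i => x i) j (2 - x j))

/-- `u ∈ H^1_0(Ω)` is a weak solution of `-Δu = g` on `Ω = (-1, 1)^d`. -/
def IsDirichletSolution {d : ℕ} (g u : E d → ℝ) : Prop :=
  MemH10 (Omega d) u ∧
  ∃ Gu, HasWeakGradient (Omega d) u Gu ∧
    ∀ v Gv, MemH10 (Omega d) v → HasWeakGradient (Omega d) v Gv →
      ∫ x in Omega d, ∑ i, Gu i x * Gv i x = ∫ x in Omega d, g x * v x

/-- `u ∈ H^1_per(Θ)` is a weak solution of `-Δu = g` on the torus `ℝ^d / 4ℤ^d`, normalised to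
have mean zero (otherwise a solution is determined only up to an additive constant). -/
def IsPeriodicSolution {d : ℕ} (g u : E d → ℝ) : Prop :=
  MemHPer 1 u ∧ ∫ x in Theta d, u x = 0 ∧
  ∃ Gu, HasWeakGradient univ u Gu ∧
    ∀ v Gv, MemHPer 1 v → HasWeakGradient univ v Gv →
      ∫ x in Theta d, ∑ i, Gu i x * Gv i x = ∫ x in Theta d, g x * v x

end OddReflection

open Filter Topology

namespace OddReflection

/-! ### Convergence in `L²` -/

/-! The products of the functions sin((n+1)π(t+1)/2) are eigenfunctions of the Dirichlet Laplacian
on Ω, with eigenvalue `eigen k`, and they are complete in L²(Ω) (`seriesLim_coef`). As functions on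
ℝ^d they are 4-periodic and odd about every hyperplane x_j = 1. Odd reflection `rext 0` therefore
leaves each partial sum of a sine series unchanged (`psum_eq_rext`), and g_per = `rext 0 g` is the
sine series of g read on the whole space. A derivative of multi-index p is odd in the directions
where p_i is even and even in the others; `rext p` has exactly this symmetry, and
`SeriesLim.hasWeakPartial` shows that termwise differentiation is compatible with reflection, with
no jump at the walls between cells.

If g has sine coefficients c_k, both solutions have coefficients c_k / eigen k. Testing with sines
forces this in the Dirichlet problem. In the periodic problem the reflected series is a solution by
passage to the limit, and it is the only one because the difference of two solutions has zero
gradient and zero mean. Hence u_per is the reflection of u.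

Derivatives of integer order are controlled by weighted square summability of the coefficients,
obtained from Bessel's inequality. If 1 < s < 2 and σ = s - 1, two further facts are needed.

(a) The reflected first derivatives of g have finite Gagliardo seminorm on bounded sets. The
reflection of ∂_j g changes sign across the faces x_i = ±1 with i ≠ j, and pairs of points of
opposite sign cost ∫ |∂_j g|² (1-|x_i|)^(-2σ). For σ ≥ 1/2 this may diverge for a general function
of H^σ, but ∂_j is tangential to these faces and g vanishes there. `MemH10.hardy` uses this through
the identity ∫ ∂_j g ∂_i Φ = ∫ ∂_i g ∂_j Φ, without any trace theory.

(b) Over a whole number of periods, the increments of sine series under a translation stay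
orthogonal. A series with smaller coefficients thus has smaller L² increments, and it inherits
finiteness of the seminorm (`SeriesLim.gagliardoSq_rext_lt_top`). The third derivatives of u have
smaller coefficients than a first derivative of g. -/

/-- Convergence of real functions in `L²(μ)`. -/
def TendstoL2 {ι α : Type*} {m : MeasurableSpace α} (l : Filter ι) (μ : Measure α)
    (f : ι → α → ℝ) (g : α → ℝ) : Prop :=
  Tendsto (fun n => eLpNorm (fun x => f n x - g x) 2 μ) l (𝓝 0)

lemma integral_mul_le_eLpNorm {α : Type*} {m : MeasurableSpace α} {μ : Measure α} {f h : α → ℝ}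
    (hf : AEStronglyMeasurable f μ) (hh : AEStronglyMeasurable h μ) :
    ‖∫ x, f x * h x ∂μ‖ₑ ≤ eLpNorm f 2 μ * eLpNorm h 2 μ := by
  refine (enorm_integral_le_lintegral_enorm _).trans ?_
  have := eLpNorm_smul_le_mul_eLpNorm (p := 2) (q := 2) (r := 1) hh hf
  rwa [eLpNorm_one_eq_lintegral_enorm] at this

lemma TendstoL2.integral_mul {ι α : Type*} {m : MeasurableSpace α} {l : Filter ι}
    {μ : Measure α} {f : ι → α → ℝ} {g h : α → ℝ} (hl : TendstoL2 l μ f g)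
    (hf : ∀ n, MemLp (f n) 2 μ) (hg : MemLp g 2 μ) (hh : MemLp h 2 μ) :
    Tendsto (fun n => ∫ x, f n x * h x ∂μ) l (𝓝 (∫ x, g x * h x ∂μ)) := by
  rw [tendsto_iff_edist_tendsto_0]
  have h0 : Tendsto (fun n => eLpNorm (fun x => f n x - g x) 2 μ * eLpNorm h 2 μ) l (𝓝 0) := by
    have := ENNReal.Tendsto.mul_const (b := eLpNorm h 2 μ) hl (Or.inr hh.eLpNorm_ne_top)
    simpa using this
  refine tendsto_of_tendsto_of_tendsto_of_le_of_le tendsto_const_nhds h0 (fun _ => zero_le)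
    (fun n => ?_)
  have e : ∫ x, f n x * h x ∂μ - ∫ x, g x * h x ∂μ = ∫ x, (f n x - g x) * h x ∂μ := by
    have h1 : Integrable (fun x => f n x * h x) μ := (hf n).integrable_mul hh
    have h2 : Integrable (fun x => g x * h x) μ := hg.integrable_mul hh
    rw [← integral_sub h1 h2]
    simp only [sub_mul]
  show edist _ _ ≤ _
  rw [edist_eq_enorm_sub, e]
  exact integral_mul_le_eLpNorm ((hf n).sub hg).1 hh.1

lemma TendstoL2.unique {ι α : Type*} {m : MeasurableSpace α} {l : Filter ι} [l.NeBot]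
    {μ : Measure α} {f : ι → α → ℝ} {g h : α → ℝ} (hg : TendstoL2 l μ f g)
    (hh : TendstoL2 l μ f h) (hf : ∀ n, AEStronglyMeasurable (f n) μ)
    (hgm : AEStronglyMeasurable g μ) (hhm : AEStronglyMeasurable h μ) : g =ᵐ[μ] h := by
  have h0 : eLpNorm (fun x => g x - h x) 2 μ ≤ 0 := by
    have : Tendsto (fun n => eLpNorm (fun x => f n x - h x) 2 μ +
        eLpNorm (fun x => f n x - g x) 2 μ) l (𝓝 (0 + 0)) := Tendsto.add hh hg
    rw [add_zero] at this
    refine ge_of_tendsto' this (fun n => ?_)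
    have := eLpNorm_sub_le (p := 2) ((hf n).sub hhm) ((hf n).sub hgm) (by norm_num)
    refine le_trans (le_of_eq ?_) this
    congr 1; ext x; simp
  have h1 := (eLpNorm_eq_zero_iff (hgm.sub hhm) (by norm_num)).1 (le_antisymm h0 (zero_le))
  filter_upwards [h1] with x hx
  simpa [sub_eq_zero] using hx

lemma TendstoL2.congr_limit {ι α : Type*} {m : MeasurableSpace α} {l : Filter ι}
    {μ : Measure α} {f : ι → α → ℝ} {g h : α → ℝ} (hg : TendstoL2 l μ f g)
    (hgh : g =ᵐ[μ] h) : TendstoL2 l μ f h := by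
  refine Tendsto.congr (fun n => ?_) hg
  refine eLpNorm_congr_ae ?_
  filter_upwards [hgh] with x hx
  rw [hx]

/-! ### Bounded sets -/

variable {d : ℕ}

lemma isOpen_box (a b : ℝ) : IsOpen {x : E d | ∀ i, x i ∈ Ioo a b} := by
  simp only [Set.ofPred_forall]
  exact isOpen_iInter_of_finite fun i => isOpen_Ioo.preimage (by fun_prop)

lemma isBounded_box (a b : ℝ) : Bornology.IsBounded {x : E d | ∀ i, x i ∈ Ioo a b} := by
  rw [isBounded_iff_forall_norm_le]
  refine ⟨√(∑ _i : Fin d, (max |a| |b|) ^ 2), fun x hx => ?_⟩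
  rw [EuclideanSpace.norm_eq]
  gcongr with i _
  rw [Real.norm_eq_abs]
  exact abs_le_max_abs_abs (hx i).1.le (hx i).2.le

lemma isOpen_Omega : IsOpen (Omega d) := isOpen_box _ _
lemma isBounded_Omega : Bornology.IsBounded (Omega d) := isBounded_box _ _
lemma isOpen_Theta : IsOpen (Theta d) := isOpen_box _ _
lemma isBounded_Theta : Bornology.IsBounded (Theta d) := isBounded_box _ _
lemma measurableSet_Omega : MeasurableSet (Omega d) := isOpen_Omega.measurableSet
lemma measurableSet_Theta : MeasurableSet (Theta d) := isOpen_Theta.measurableSet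

lemma isFiniteMeasure_restrict {W : Set (E d)} (hW : Bornology.IsBounded W) :
    IsFiniteMeasure (volume.restrict W) :=
  ⟨by simpa using hW.measure_lt_top⟩

lemma memLp_of_continuous {W : Set (E d)} (hW : Bornology.IsBounded W) {f : E d → ℝ}
    (hf : Continuous f) (p : ℝ≥0∞) : MemLp f p (volume.restrict W) := by
  have := isFiniteMeasure_restrict hW
  obtain ⟨C, hC⟩ := (hW.isCompact_closure.image hf.norm).bddAbove
  refine MemLp.mono_measure (Measure.restrict_mono subset_closure le_rfl) ?_
  have := isFiniteMeasure_restrict hW.closure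
  refine MemLp.of_bound hf.aestronglyMeasurable C ?_
  filter_upwards [ae_restrict_mem isClosed_closure.measurableSet] with x hx
  exact hC (mem_image_of_mem _ hx)

/-- `u` is square integrable on bounded sets. -/
def MemL2Loc (u : E d → ℝ) : Prop :=
  ∀ W : Set (E d), Bornology.IsBounded W → MemLp u 2 (volume.restrict W)

lemma MemL2Loc.locallyIntegrable {u : E d → ℝ} (hu : MemL2Loc u) : LocallyIntegrable u := by
  intro x
  refine ⟨Metric.ball x 1, Metric.ball_mem_nhds _ one_pos, ?_⟩
  have := isFiniteMeasure_restrict (Metric.isBounded_ball (x := x) (r := 1))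
  exact (hu _ Metric.isBounded_ball).integrable (by norm_num)

lemma memL2Loc_of_continuous {f : E d → ℝ} (hf : Continuous f) : MemL2Loc f :=
  fun _ hW => memLp_of_continuous hW hf 2

/-! ### Partial derivatives -/

lemma contDiff_partialDeriv {f : E d → ℝ} (hf : ContDiff ℝ ∞ f) (i : Fin d) :
    ContDiff ℝ ∞ (partialDeriv i f) :=
  (hf.fderiv_right (m := ∞) (by simp)).clm_apply contDiff_const

lemma partialDeriv_mul {f g : E d → ℝ} (hf : ContDiff ℝ ∞ f) (hg : ContDiff ℝ ∞ g) (i : Fin d)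
    (x : E d) : partialDeriv i (fun x => f x * g x) x =
      partialDeriv i f x * g x + f x * partialDeriv i g x := by
  have h1 := (hf.differentiable (by simp)) x
  have h2 := (hg.differentiable (by simp)) x
  unfold partialDeriv
  rw [fderiv_fun_mul h1 h2]
  simp; ring

lemma tsupport_partialDeriv_subset (f : E d → ℝ) (i : Fin d) :
    tsupport (partialDeriv i f) ⊆ tsupport f :=
  (tsupport_fderiv_apply_subset ℝ (f := f) (EuclideanSpace.single i (1 : ℝ)))

lemma IsTest.partialDeriv {U : Set (E d)} {φ : E d → ℝ} (h : IsTest U φ) (i : Fin d) :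
    IsTest U (partialDeriv i φ) where
  smooth := contDiff_partialDeriv h.smooth i
  compact := h.compact.mono' ((subset_tsupport _).trans (tsupport_partialDeriv_subset _ _))
  support := (tsupport_partialDeriv_subset _ _).trans h.support

lemma IsTest.mul_smooth {U : Set (E d)} {φ ψ : E d → ℝ} (h : IsTest U φ)
    (hψ : ContDiff ℝ ∞ ψ) : IsTest U (fun x => ψ x * φ x) where
  smooth := hψ.mul h.smooth
  compact := h.compact.mul_left
  support := (tsupport_mul_subset_right (f := ψ) (g := φ)).trans h.support

lemma IsTest.mono {U V : Set (E d)} {φ : E d → ℝ} (h : IsTest U φ) (hUV : U ⊆ V) : IsTest V φ :=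
  ⟨h.smooth, h.compact, h.support.trans hUV⟩

lemma IsTest.zero_of_notMem {U : Set (E d)} {φ : E d → ℝ} (h : IsTest U φ) {x : E d}
    (hx : x ∉ U) : φ x = 0 :=
  image_eq_zero_of_notMem_tsupport fun h' => hx (h.support h')

lemma IsTest.setIntegral_mul {U : Set (E d)} {φ : E d → ℝ} (h : IsTest U φ) (u : E d → ℝ) :
    ∫ x in U, u x * φ x = ∫ x, u x * φ x :=
  setIntegral_eq_integral_of_forall_compl_eq_zero fun x hx => by simp [h.zero_of_notMem hx]

lemma integral_partialDeriv_eq_neg {f φ : E d → ℝ} (hf : ContDiff ℝ ∞ f) {U : Set (E d)}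
    (hφ : IsTest U φ) (i : Fin d) :
    ∫ x, f x * partialDeriv i φ x = -∫ x, partialDeriv i f x * φ x := by
  have hc : ∀ g ψ : E d → ℝ, Continuous g → IsTest U ψ → Integrable (fun x => g x * ψ x) :=
    fun g ψ hg hψ => (hg.mul hψ.smooth.continuous).integrable_of_hasCompactSupport
      hψ.compact.mul_left
  exact integral_mul_fderiv_eq_neg_fderiv_mul_of_integrable
    (hc _ _ (contDiff_partialDeriv hf i).continuous hφ)
    (hc _ _ hf.continuous (hφ.partialDeriv i)) (hc _ _ hf.continuous hφ)
    (fun x _ => (hf.differentiable (by simp)) x)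
    (fun x _ => (hφ.smooth.differentiable (by simp)) x)

/-! ### Weak derivatives -/

lemma IsTest.integrable_mul {U : Set (E d)} {f φ : E d → ℝ} (hφ : IsTest U φ)
    (hf : LocallyIntegrableOn f U) : Integrable (fun x => f x * φ x) := by
  have := (hf.integrableOn_compact_subset hφ.support hφ.compact).mul_continuousOn
    (hφ.smooth.continuous.continuousOn) hφ.compact
  refine (integrableOn_iff_integrable_of_support_subset fun x hx => ?_).1 this
  exact subset_tsupport _ (right_ne_zero_of_mul (Function.mem_support.1 hx))

lemma HasWeakPartial.unique {U : Set (E d)} (hU : IsOpen U) {i : Fin d} {u v w : E d → ℝ}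
    (hv : HasWeakPartial U i u v) (hw : HasWeakPartial U i u w) :
    v =ᵐ[volume.restrict U] w := by
  have key : ∀ᵐ x : E d, x ∈ U → v x - w x = 0 := by
    refine hU.ae_eq_zero_of_integral_contDiff_smul_eq_zero
      (hv.locInt_deriv.sub hw.locInt_deriv) (fun φ h1 h2 h3 => ?_)
    have ht : IsTest U φ := ⟨h1, h2, h3⟩
    have e := (hv.integral_eq φ ht).symm.trans (hw.integral_eq φ ht)
    rw [neg_inj, ht.setIntegral_mul, ht.setIntegral_mul] at e
    have e1 : ∀ x, φ x • (v x - w x) = v x * φ x - w x * φ x := fun x => by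
      rw [smul_eq_mul]; ring
    simp only [e1]
    rw [integral_sub (ht.integrable_mul hv.locInt_deriv) (ht.integrable_mul hw.locInt_deriv), e,
      sub_self]
  rw [Filter.EventuallyEq, ae_restrict_iff' hU.measurableSet]
  filter_upwards [key] with x hx hxU
  exact sub_eq_zero.1 (hx hxU)

lemma HasWeakPartial.mono {U V : Set (E d)} {i : Fin d} {u v : E d → ℝ}
    (h : HasWeakPartial V i u v) (hUV : U ⊆ V) : HasWeakPartial U i u v where
  locInt := h.locInt.mono_set hUV
  locInt_deriv := h.locInt_deriv.mono_set hUV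
  integral_eq φ hφ := by
    have := h.integral_eq φ (hφ.mono hUV)
    rw [((hφ.mono hUV).partialDeriv i).setIntegral_mul, (hφ.mono hUV).setIntegral_mul] at this
    rwa [(hφ.partialDeriv i).setIntegral_mul, hφ.setIntegral_mul]

lemma locallyIntegrableOn_congr {U : Set (E d)} (hU : IsOpen U) {u v : E d → ℝ}
    (h : LocallyIntegrableOn u U) (huv : u =ᵐ[volume.restrict U] v) : LocallyIntegrableOn v U := by
  rw [locallyIntegrableOn_iff hU.isLocallyClosed] at h ⊢
  intro k hk hkc
  exact (h k hk hkc).congr (ae_restrict_of_ae_restrict_of_subset hk huv)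

lemma HasWeakPartial.congr {U : Set (E d)} (hU : IsOpen U) {i : Fin d} {u v u' v' : E d → ℝ}
    (h : HasWeakPartial U i u v) (hu : u =ᵐ[volume.restrict U] u')
    (hv : v =ᵐ[volume.restrict U] v') : HasWeakPartial U i u' v' where
  locInt := locallyIntegrableOn_congr hU h.locInt hu
  locInt_deriv := locallyIntegrableOn_congr hU h.locInt_deriv hv
  integral_eq φ hφ := by
    have e1 : ∫ x in U, u x * partialDeriv i φ x = ∫ x in U, u' x * partialDeriv i φ x := by
      refine integral_congr_ae ?_
      filter_upwards [hu] with x hx; rw [hx]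
    have e2 : ∫ x in U, v x * φ x = ∫ x in U, v' x * φ x := by
      refine integral_congr_ae ?_
      filter_upwards [hv] with x hx; rw [hx]
    rw [← e1, ← e2, h.integral_eq φ hφ]

lemma HasWeakPartial.sub {U : Set (E d)} {i : Fin d} {u v u' v' : E d → ℝ}
    (h : HasWeakPartial U i u v) (h' : HasWeakPartial U i u' v') :
    HasWeakPartial U i (fun x => u x - u' x) (fun x => v x - v' x) where
  locInt := h.locInt.sub h'.locInt
  locInt_deriv := h.locInt_deriv.sub h'.locInt_deriv
  integral_eq φ hφ := by
    simp only [sub_mul]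
    rw [integral_sub ((hφ.partialDeriv i).integrable_mul h.locInt).integrableOn
        ((hφ.partialDeriv i).integrable_mul h'.locInt).integrableOn,
      integral_sub (hφ.integrable_mul h.locInt_deriv).integrableOn
        (hφ.integrable_mul h'.locInt_deriv).integrableOn, h.integral_eq φ hφ,
      h'.integral_eq φ hφ]
    ring

/-- Weak derivatives pass to the limit in `L²` of bounded sets. -/
lemma hasWeakPartial_of_tendstoL2 {ι : Type*} {l : Filter ι} [l.NeBot] {i : Fin d}
    {f : ι → E d → ℝ} {u v : E d → ℝ} (hf : ∀ n, ContDiff ℝ ∞ (f n)) (hu : MemL2Loc u)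
    (hv : MemL2Loc v)
    (hfu : ∀ W : Set (E d), Bornology.IsBounded W → TendstoL2 l (volume.restrict W) f u)
    (hfv : ∀ W : Set (E d), Bornology.IsBounded W →
      TendstoL2 l (volume.restrict W) (fun n => partialDeriv i (f n)) v) :
    HasWeakPartial univ i u v where
  locInt := locallyIntegrableOn_univ.2 hu.locallyIntegrable
  locInt_deriv := locallyIntegrableOn_univ.2 hv.locallyIntegrable
  integral_eq φ hφ := by
    have hb := hφ.compact.isCompact.isBounded
    have e : ∀ (w ψ : E d → ℝ), tsupport ψ ⊆ tsupport φ →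
        ∫ x in tsupport φ, w x * ψ x = ∫ x, w x * ψ x := fun w ψ hψ =>
      setIntegral_eq_integral_of_forall_compl_eq_zero fun x hx => by
        simp [image_eq_zero_of_notMem_tsupport fun h' => hx (hψ h')]
    have hs := tsupport_partialDeriv_subset φ i
    have h1 := (hfu _ hb).integral_mul (fun n => memLp_of_continuous hb (hf n).continuous 2)
      (hu _ hb) (memLp_of_continuous hb (hφ.partialDeriv i).smooth.continuous 2)
    have h2 := (hfv _ hb).integral_mul
      (fun n => memLp_of_continuous hb (contDiff_partialDeriv (hf n) i).continuous 2)
      (hv _ hb) (memLp_of_continuous hb hφ.smooth.continuous 2)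
    simp only [e _ _ hs, e _ _ subset_rfl] at h1 h2
    simp only [setIntegral_univ]
    refine tendsto_nhds_unique h1 (h2.neg.congr fun n => ?_)
    rw [integral_partialDeriv_eq_neg (hf n) hφ i]

/-! ### Functions on the cube `Ω` in product form -/

/-- The product function `x ↦ ∏ f_i(x_i)`. -/
def tprod (f : Fin d → ℝ → ℝ) (x : E d) : ℝ := ∏ i, f i (x i)

lemma contDiff_tprod {f : Fin d → ℝ → ℝ} (hf : ∀ i, ContDiff ℝ ∞ (f i)) :
    ContDiff ℝ ∞ (tprod f) := by
  unfold tprod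
  refine contDiff_prod fun i _ => (hf i).comp ?_
  fun_prop

/-- On the line through `x` in direction `j` only the factor of index `j` varies. -/
lemma partialDeriv_tprod {f : Fin d → ℝ → ℝ} {j : Fin d} {f' : ℝ → ℝ} {x : E d}
    (hf : ∀ i, Differentiable ℝ (f i)) (hj : HasDerivAt (f j) (f' (x j)) (x j)) :
    partialDeriv j (tprod f) x = tprod (Function.update f j f') x := by
  unfold partialDeriv
  have h1 : HasDerivAt (fun t : ℝ => tprod f (x + t • EuclideanSpace.single j 1))
      (fderiv ℝ (tprod f) x (EuclideanSpace.single j 1)) 0 := by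
    have hd : DifferentiableAt ℝ (tprod f) x := by
      unfold tprod
      have h3 : ∀ i, DifferentiableAt ℝ (fun y : E d => f i (y i)) x := fun i =>
        DifferentiableAt.comp (g := f i) x ((hf i) (x i))
          (by fun_prop : DifferentiableAt ℝ (fun y : E d => y i) x)
      have h4 := (HasFDerivAt.finsetProd (u := Finset.univ)
        fun i _ => (h3 i).hasFDerivAt).differentiableAt
      exact h4
    exact (hd.hasFDerivAt.hasLineDerivAt (EuclideanSpace.single j 1))
  have h2 : HasDerivAt (fun t : ℝ => tprod f (x + t • EuclideanSpace.single j 1))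
      (tprod (Function.update f j f') x) 0 := by
    have e : (fun t : ℝ => tprod f (x + t • EuclideanSpace.single j 1)) =
        fun t => f j (x j + t) * ∏ i ∈ Finset.univ.erase j, f i (x i) := by
      ext t
      unfold tprod
      rw [← Finset.mul_prod_erase _ _ (Finset.mem_univ j)]
      congr 1
      · simp
      · refine Finset.prod_congr rfl fun i hi => ?_
        simp [(Finset.ne_of_mem_erase hi)]
    have e2 : tprod (Function.update f j f') x =
        f' (x j) * ∏ i ∈ Finset.univ.erase j, f i (x i) := by
      unfold tprod
      rw [← Finset.mul_prod_erase _ _ (Finset.mem_univ j)]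
      congr 1
      · simp
      · refine Finset.prod_congr rfl fun i hi => ?_
        simp [(Finset.ne_of_mem_erase hi)]
    rw [e, e2]
    refine HasDerivAt.mul_const ?_ _
    have : HasDerivAt (f j) (f' (x j)) (x j + 0) := by simpa using hj
    simpa using this.comp_const_add (x j) 0
  exact h1.unique h2

lemma measurePreserving_ofLp : MeasurePreserving (fun (x : E d) (i : Fin d) => x i)
    volume volume := PiLp.volume_preserving_ofLp (Fin d)

lemma setIntegral_box_tprod (f : Fin d → ℝ → ℝ) (a b : ℝ) :
    ∫ x in {x : E d | ∀ i, x i ∈ Ioo a b}, tprod f x = ∏ i, ∫ t in Ioo a b, f i t := by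
  have h := (measurePreserving_ofLp (d := d)).setIntegral_preimage_emb
    (MeasurableEquiv.toLp 2 (Fin d → ℝ)).symm.measurableEmbedding
    (fun y => ∏ i, f i (y i)) (univ.pi fun _ => Ioo a b)
  have e : (fun (x : E d) (i : Fin d) => x i) ⁻¹' (univ.pi fun _ => Ioo a b) =
      {x : E d | ∀ i, x i ∈ Ioo a b} := by ext x; simp
  rw [e] at h
  refine Eq.trans h ?_
  rw [volume_pi, Measure.restrict_pi_pi, integral_fintype_prod_eq_prod]

/-! ### Products of sines -/

/-- The frequency `(n + 1) π / 2`. -/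
noncomputable def freq (n : ℕ) : ℝ := (n + 1) * (Real.pi / 2)

lemma one_le_freq (n : ℕ) : 1 ≤ freq n := by
  have := Real.pi_gt_three
  unfold freq
  have : (0 : ℝ) ≤ n := n.cast_nonneg
  nlinarith

lemma freq_pos (n : ℕ) : 0 < freq n := one_pos.trans_le (one_le_freq n)

/-- The `p`-th derivative of `t ↦ sin ((n + 1) π (t + 1) / 2)`. -/
noncomputable def trig (n p : ℕ) (t : ℝ) : ℝ :=
  freq n ^ p * Real.sin (freq n * (t + 1) + p * (Real.pi / 2))

lemma contDiff_trig (n p : ℕ) : ContDiff ℝ ∞ (trig n p) := by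
  unfold trig; fun_prop

lemma hasDerivAt_trig (n p : ℕ) (t : ℝ) : HasDerivAt (trig n p) (trig n (p + 1) t) t := by
  have h1 : HasDerivAt (fun t : ℝ => freq n * (t + 1) + p * (Real.pi / 2)) (freq n) t := by
    simpa using (((hasDerivAt_id t).add_const 1).const_mul (freq n)).add_const (p * (Real.pi / 2))
  have h2 := (h1.sin).const_mul (freq n ^ p)
  refine h2.congr_deriv ?_
  unfold trig
  have : freq n * (t + 1) + ((p + 1 : ℕ) : ℝ) * (Real.pi / 2) =
      freq n * (t + 1) + p * (Real.pi / 2) + Real.pi / 2 := by push_cast; ring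
  rw [this, Real.sin_add_pi_div_two]
  ring

lemma trig_add_two (n p : ℕ) (t : ℝ) : trig n (p + 2) t = -(freq n ^ 2) * trig n p t := by
  unfold trig
  have : freq n * (t + 1) + ((p + 2 : ℕ) : ℝ) * (Real.pi / 2) =
      freq n * (t + 1) + p * (Real.pi / 2) + Real.pi := by push_cast; ring
  rw [this, Real.sin_add_pi]
  ring

/-- `integral of cos (m π (t + 1) / 2 + θ)` over a period vanishes. -/
lemma integral_cos_eq_zero {a b : ℝ} {m : ℝ} (hm : m ≠ 0) (θ : ℝ)
    (h : Real.sin (m * (Real.pi / 2) * (b + 1) + θ) = Real.sin (m * (Real.pi / 2) * (a + 1) + θ)) :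
    ∫ t in a..b, Real.cos (m * (Real.pi / 2) * (t + 1) + θ) = 0 := by
  have hc : m * (Real.pi / 2) ≠ 0 := mul_ne_zero hm (by positivity)
  have hd : ∀ t ∈ uIcc a b, HasDerivAt
      (fun t => Real.sin (m * (Real.pi / 2) * (t + 1) + θ) / (m * (Real.pi / 2)))
      (Real.cos (m * (Real.pi / 2) * (t + 1) + θ)) t := by
    intro t _
    have h1 : HasDerivAt (fun t : ℝ => m * (Real.pi / 2) * (t + 1) + θ) (m * (Real.pi / 2)) t := by
      simpa using (((hasDerivAt_id t).add_const 1).const_mul (m * (Real.pi / 2))).add_const θ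
    have h2 := h1.sin.div_const (m * (Real.pi / 2))
    rwa [mul_div_assoc, div_self hc, mul_one] at h2
  rw [intervalIntegral.integral_eq_sub_of_hasDerivAt hd (by apply Continuous.intervalIntegrable; fun_prop), h,
    sub_self]

/-- Product-to-sum formula. The vanishing of the two cosine integrals is assumed because it has
different causes in the two applications: matching phases on the half period (-1, 1), and
periodicity for arbitrary phases on longer intervals. -/
lemma integral_sin_mul_sin {a b : ℝ} (k l : ℕ) (φ ψ : ℝ)
    (h1 : ∫ t in a..b, Real.cos (((k : ℝ) + l + 2) * (Real.pi / 2) * (t + 1) + (φ + ψ)) = 0)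
    (h2 : k ≠ l →
      ∫ t in a..b, Real.cos (((k : ℝ) - l) * (Real.pi / 2) * (t + 1) + (φ - ψ)) = 0) :
    ∫ t in a..b, Real.sin (freq k * (t + 1) + φ) * Real.sin (freq l * (t + 1) + ψ) =
      if k = l then (b - a) / 2 * Real.cos (φ - ψ) else 0 := by
  have e : ∀ t, Real.sin (freq k * (t + 1) + φ) * Real.sin (freq l * (t + 1) + ψ) =
      (1 / 2) * Real.cos (((k : ℝ) - l) * (Real.pi / 2) * (t + 1) + (φ - ψ)) -
      (1 / 2) * Real.cos (((k : ℝ) + l + 2) * (Real.pi / 2) * (t + 1) + (φ + ψ)) := by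
    intro t
    have e1 : ((k : ℝ) - l) * (Real.pi / 2) * (t + 1) + (φ - ψ) =
      (freq k * (t + 1) + φ) - (freq l * (t + 1) + ψ) := by unfold freq; ring
    have e2 : ((k : ℝ) + l + 2) * (Real.pi / 2) * (t + 1) + (φ + ψ) =
      (freq k * (t + 1) + φ) + (freq l * (t + 1) + ψ) := by unfold freq; ring
    rw [e1, e2, Real.cos_sub, Real.cos_add (freq k * (t + 1) + φ)]
    ring
  simp only [e]
  rw [intervalIntegral.integral_sub (by apply Continuous.intervalIntegrable; fun_prop) (by apply Continuous.intervalIntegrable; fun_prop),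
    intervalIntegral.integral_const_mul, intervalIntegral.integral_const_mul, h1]
  split_ifs with hkl
  · subst hkl
    simp
    ring
  · rw [h2 hkl]; simp

/-- The box `(-1 - 4n, 3 + 4n)^d`. -/
def bigBox (d n : ℕ) : Set (E d) := {x | ∀ i, x i ∈ Ioo (-1 - 4 * (n : ℝ)) (3 + 4 * n)}

lemma isBounded_bigBox (n : ℕ) : Bornology.IsBounded (bigBox d n) := isBounded_box _ _

lemma measurableSet_bigBox (n : ℕ) : MeasurableSet (bigBox d n) := (isOpen_box _ _).measurableSet

lemma exists_subset_bigBox {W : Set (E d)} (hW : Bornology.IsBounded W) :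
    ∃ n : ℕ, W ⊆ bigBox d n := by
  obtain ⟨C, hC⟩ := isBounded_iff_forall_norm_le.1 hW
  obtain ⟨n, hn⟩ := exists_nat_gt C
  refine ⟨n, fun x hx i => ?_⟩
  have h1 : |x i| ≤ ‖x‖ := by simpa using PiLp.norm_apply_le x i
  have h2 := abs_le.1 (h1.trans (hC x hx))
  have : (0 : ℝ) ≤ n := n.cast_nonneg
  constructor <;> linarith [h2.1, h2.2]

/-- (-1, 1) is only half a period. Orthogonality holds because both factors carry the same phase
pπ/2: the phases add to pπ and subtract to 0, so the antiderivatives vanish at both ends. -/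
lemma integral_trig_half (k l p : ℕ) :
    ∫ t in Ioo (-1 : ℝ) 1, trig k p t * trig l p t = if k = l then (freq k ^ p) ^ 2 else 0 := by
  rw [← integral_Ioc_eq_integral_Ioo, ← intervalIntegral.integral_of_le (by norm_num)]
  have h := integral_sin_mul_sin (a := -1) (b := 1) k l (p * (Real.pi / 2)) (p * (Real.pi / 2))
    (integral_cos_eq_zero (by positivity) _ (by
      have e1 : ((k : ℝ) + l + 2) * (Real.pi / 2) * (1 + 1) +
        (p * (Real.pi / 2) + p * (Real.pi / 2)) = ((k + l + 2 + p : ℕ) : ℝ) * Real.pi := by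
        push_cast; ring
      have e2 : ((k : ℝ) + l + 2) * (Real.pi / 2) * (-1 + 1) +
        (p * (Real.pi / 2) + p * (Real.pi / 2)) = (p : ℝ) * Real.pi := by ring
      rw [e1, e2, Real.sin_nat_mul_pi, Real.sin_nat_mul_pi]))
    (fun hkl => integral_cos_eq_zero (sub_ne_zero.2 (by exact_mod_cast hkl)) _ (by
      have e1 : ((k : ℝ) - l) * (Real.pi / 2) * (1 + 1) +
        (p * (Real.pi / 2) - p * (Real.pi / 2)) = ((k - l : ℤ) : ℝ) * Real.pi := by
        push_cast; ring
      rw [e1, Real.sin_int_mul_pi]; simp))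
  have e : ∀ t, trig k p t * trig l p t = (freq k ^ p * freq l ^ p) *
      (Real.sin (freq k * (t + 1) + p * (Real.pi / 2)) *
        Real.sin (freq l * (t + 1) + p * (Real.pi / 2))) := fun t => by unfold trig; ring
  simp only [e]
  rw [intervalIntegral.integral_const_mul, h]
  split_ifs with hkl
  · subst hkl; simp; ring
  · simp

/-- The interval consists of 2n+1 full periods, so shifts affect only the relative phase. The cosine
factor does not depend on `p`, which later makes increments of derivatives of different orders
comparable. -/
lemma integral_trig_shift (k l p n : ℕ) (h h' : ℝ) :
    ∫ t in Ioo (-1 - 4 * (n : ℝ)) (3 + 4 * n), trig k p (t + h) * trig l p (t + h') =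
      if k = l then (2 + 4 * n) * (freq k ^ p) ^ 2 * Real.cos (freq k * (h - h')) else 0 := by
  have hn : (0 : ℝ) ≤ n := n.cast_nonneg
  rw [← integral_Ioc_eq_integral_Ioo, ← intervalIntegral.integral_of_le (by linarith)]
  have key : ∀ (m : ℤ) (θ : ℝ),
      Real.sin ((m : ℝ) * (Real.pi / 2) * (3 + 4 * n + 1) + θ) =
      Real.sin ((m : ℝ) * (Real.pi / 2) * (-1 - 4 * n + 1) + θ) := by
    intro m θ
    have : (m : ℝ) * (Real.pi / 2) * (3 + 4 * n + 1) + θ =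
      (m : ℝ) * (Real.pi / 2) * (-1 - 4 * n + 1) + θ + ((m * (1 + 2 * n) : ℤ) : ℝ) *
        (2 * Real.pi) := by push_cast; ring
    rw [this, Real.sin_add_int_mul_two_pi]
  have hh := integral_sin_mul_sin (a := -1 - 4 * (n : ℝ)) (b := 3 + 4 * n) k l
    (freq k * h + p * (Real.pi / 2)) (freq l * h' + p * (Real.pi / 2))
    (integral_cos_eq_zero (by positivity) _ (by
      have := key (k + l + 2)
      push_cast at this
      exact this _))
    (fun hkl => integral_cos_eq_zero (sub_ne_zero.2 (by exact_mod_cast hkl)) _ (by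
      have := key (k - l)
      push_cast at this
      exact this _))
  have e : ∀ t, trig k p (t + h) * trig l p (t + h') = (freq k ^ p * freq l ^ p) *
      (Real.sin (freq k * (t + 1) + (freq k * h + p * (Real.pi / 2))) *
        Real.sin (freq l * (t + 1) + (freq l * h' + p * (Real.pi / 2)))) := fun t => by
    unfold trig
    rw [show freq k * (t + h + 1) + p * (Real.pi / 2) =
      freq k * (t + 1) + (freq k * h + p * (Real.pi / 2)) by ring,
      show freq l * (t + h' + 1) + p * (Real.pi / 2) =
      freq l * (t + 1) + (freq l * h' + p * (Real.pi / 2)) by ring]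
    ring
  simp only [e]
  rw [intervalIntegral.integral_const_mul, hh]
  split_ifs with hkl
  · subst hkl
    rw [show freq k * h + p * (Real.pi / 2) - (freq k * h' + p * (Real.pi / 2)) =
      freq k * (h - h') by ring]
    ring
  · simp

/-- The derivative of multi-index `p` of the product of sines of frequencies `freq (k i)`. -/
noncomputable def sine (k p : Fin d → ℕ) : E d → ℝ := tprod fun i => trig (k i) (p i)

/-- The monomial `∏ freq (k i) ^ (p i)`. -/
noncomputable def fpow (k p : Fin d → ℕ) : ℝ := ∏ i, freq (k i) ^ (p i)

/-- The eigenvalue `∑ freq (k i) ^ 2`. -/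
noncomputable def eigen (k : Fin d → ℕ) : ℝ := ∑ i, freq (k i) ^ 2

lemma fpow_pos (k p : Fin d → ℕ) : 0 < fpow k p :=
  Finset.prod_pos fun _ _ => pow_pos (freq_pos _) _

lemma contDiff_sine (k p : Fin d → ℕ) : ContDiff ℝ ∞ (sine k p) :=
  contDiff_tprod fun _ => contDiff_trig _ _

lemma partialDeriv_sine (k p : Fin d → ℕ) (j : Fin d) :
    partialDeriv j (sine k p) = sine k (p + Pi.single j 1) := by
  ext x
  unfold sine
  rw [partialDeriv_tprod (f' := trig (k j) (p j + 1))
    (fun _ => (contDiff_trig _ _).differentiable (by simp)) (hasDerivAt_trig _ _ _)]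
  congr 1
  ext i
  by_cases h : i = j
  · subst h; simp
  · simp [h]

lemma sine_add_two (k p : Fin d → ℕ) (j : Fin d) (x : E d) :
    sine k (p + Pi.single j 1 + Pi.single j 1) x = -(freq (k j) ^ 2) * sine k p x := by
  unfold sine tprod
  rw [← Finset.mul_prod_erase _ _ (Finset.mem_univ j),
    ← Finset.mul_prod_erase _ (fun i => trig (k i) (p i) (x i)) (Finset.mem_univ j), ← mul_assoc]
  congr 1
  · simp only [Pi.add_apply, Pi.single_eq_same]
    rw [add_assoc]
    exact trig_add_two _ _ _
  · refine Finset.prod_congr rfl fun i hi => ?_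
    simp [Finset.ne_of_mem_erase hi]

lemma fpow_add_single (k p : Fin d → ℕ) (j : Fin d) :
    fpow k (p + Pi.single j 1) = fpow k p * freq (k j) := by
  unfold fpow
  rw [← Finset.mul_prod_erase _ _ (Finset.mem_univ j),
    ← Finset.mul_prod_erase _ (fun i => freq (k i) ^ (p i)) (Finset.mem_univ j)]
  have : ∏ i ∈ Finset.univ.erase j, freq (k i) ^ (p + Pi.single j 1 : Fin d → ℕ) i =
      ∏ i ∈ Finset.univ.erase j, freq (k i) ^ (p i) := by
    refine Finset.prod_congr rfl fun i hi => ?_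
    simp [Finset.ne_of_mem_erase hi]
  rw [this]
  simp [pow_succ]
  ring

lemma freq_sq_le_eigen (k : Fin d → ℕ) (j : Fin d) : freq (k j) ^ 2 ≤ eigen k :=
  Finset.single_le_sum (f := fun i => freq (k i) ^ 2) (fun _ _ => sq_nonneg _) (Finset.mem_univ j)

lemma one_le_eigen (hd : 0 < d) (k : Fin d → ℕ) : 1 ≤ eigen k :=
  (one_le_pow₀ (one_le_freq _)).trans (freq_sq_le_eigen k ⟨0, hd⟩)

/-- Each squared frequency is at most `eigen k`, so decay measured in powers of `eigen k` controls
all derivatives of the corresponding order. -/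
lemma fpow_sq_le (k p : Fin d → ℕ) : fpow k p ^ 2 ≤ eigen k ^ (∑ i, p i) := by
  unfold fpow
  rw [← Finset.prod_pow, ← Finset.prod_pow_eq_pow_sum]
  refine Finset.prod_le_prod (fun _ _ => sq_nonneg _) fun i _ => ?_
  rw [← pow_mul, mul_comm, pow_mul]
  exact pow_le_pow_left₀ (sq_nonneg _) (freq_sq_le_eigen k i) _

lemma integral_sine_mul_sine (k l p : Fin d → ℕ) :
    ∫ x in Omega d, sine k p x * sine l p x = if k = l then fpow k p ^ 2 else 0 := by
  have e : ∀ x : E d, sine k p x * sine l p x =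
      tprod (fun i t => trig (k i) (p i) t * trig (l i) (p i) t) x := fun x => by
    unfold sine tprod; rw [Finset.prod_mul_distrib]
  simp only [e]
  have h := setIntegral_box_tprod (d := d)
    (fun i t => trig (k i) (p i) t * trig (l i) (p i) t) (-1) 1
  refine Eq.trans h ?_
  simp only [integral_trig_half]
  split_ifs with hkl
  · subst hkl; simp [fpow, Finset.prod_pow]
  · obtain ⟨i, hi⟩ := Function.ne_iff.1 hkl
    exact Finset.prod_eq_zero (Finset.mem_univ i) (by simp [hi])

lemma integral_sine_shift (k l p : Fin d → ℕ) (n : ℕ) (h h' : E d) :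
    ∫ x in bigBox d n, sine k p (x + h) * sine l p (x + h') =
      if k = l then (2 + 4 * (n : ℝ)) ^ d * fpow k p ^ 2 * ∏ i, Real.cos (freq (k i) * (h i - h' i))
      else 0 := by
  have e : ∀ x : E d, sine k p (x + h) * sine l p (x + h') =
      tprod (fun i t => trig (k i) (p i) (t + h i) * trig (l i) (p i) (t + h' i)) x := fun x => by
    unfold sine tprod; rw [Finset.prod_mul_distrib]; rfl
  simp only [e]
  refine (setIntegral_box_tprod (d := d) _ _ _).trans ?_
  simp only [integral_trig_shift]
  split_ifs with hkl
  · subst hkl; simp [fpow, Finset.prod_pow, Finset.prod_mul_distrib]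
  · obtain ⟨i, hi⟩ := Function.ne_iff.1 hkl
    exact Finset.prod_eq_zero (Finset.mem_univ i) (by simp [hi])

/-- Partial sums of sine series and of their termwise derivatives. -/
noncomputable def psum (a : (Fin d → ℕ) → ℝ) (p : Fin d → ℕ) (F : Finset (Fin d → ℕ))
    (x : E d) : ℝ := ∑ k ∈ F, a k * sine k p x

lemma contDiff_psum (a : (Fin d → ℕ) → ℝ) (p : Fin d → ℕ) (F : Finset (Fin d → ℕ)) :
    ContDiff ℝ ∞ (psum a p F) := by
  unfold psum
  exact ContDiff.sum fun k _ => contDiff_const.mul (contDiff_sine k p)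

lemma partialDeriv_psum (a : (Fin d → ℕ) → ℝ) (p : Fin d → ℕ) (F : Finset (Fin d → ℕ))
    (j : Fin d) : partialDeriv j (psum a p F) = psum a (p + Pi.single j 1) F := by
  ext x
  have h := HasFDerivAt.fun_sum (u := F) (x := x) fun k _ =>
    (((contDiff_sine k p).differentiable (by simp)) x).hasFDerivAt.const_mul (a k)
  have e : psum a p F = fun x => ∑ k ∈ F, a k * sine k p x := rfl
  simp only [← partialDeriv_sine, psum]
  unfold partialDeriv
  rw [e, h.fderiv]
  simp

lemma psum_add_two (a : (Fin d → ℕ) → ℝ) (p : Fin d → ℕ) (F : Finset (Fin d → ℕ))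
    (j : Fin d) (x : E d) : psum a (p + Pi.single j 1 + Pi.single j 1) F x =
      -∑ k ∈ F, a k * freq (k j) ^ 2 * sine k p x := by
  unfold psum
  rw [← Finset.sum_neg_distrib]
  refine Finset.sum_congr rfl fun k _ => ?_
  rw [sine_add_two]; ring

lemma sum_psum_add_two (a : (Fin d → ℕ) → ℝ) (p : Fin d → ℕ) (F : Finset (Fin d → ℕ))
    (x : E d) : ∑ j, psum a (p + Pi.single j 1 + Pi.single j 1) F x =
      -psum (fun k => a k * eigen k) p F x := by
  simp only [psum_add_two, Finset.sum_neg_distrib]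
  rw [Finset.sum_comm]
  unfold psum eigen
  simp only [Finset.mul_sum, Finset.sum_mul]

/-! ### Completeness of the sine products -/

lemma trig_zero (n : ℕ) (t : ℝ) : trig n 0 t = Real.sin (freq n * (t + 1)) := by
  simp [trig]

/-- 2 sin((k+1)θ) cos θ = sin((k+2)θ) + sin(kθ) with θ = π(x_i+1)/2. The span of the sine products
is thus a module over the algebra generated by these cosines. -/
lemma sine_mul_cos_mem_span (k : Fin d → ℕ) (i : Fin d) :
    (fun x : E d => sine k 0 x * Real.cos (Real.pi / 2 * (x i + 1))) ∈
      Submodule.span ℝ (range fun k : Fin d → ℕ => sine k 0) := by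
  have hup : ∀ l : Fin d → ℕ, (∀ j, j ≠ i → l j = k j) → ∀ x : E d,
      sine l 0 x = trig (l i) 0 (x i) * ∏ j ∈ Finset.univ.erase i, trig (k j) 0 (x j) := by
    intro l hl x
    unfold sine tprod
    rw [← Finset.mul_prod_erase _ _ (Finset.mem_univ i)]
    congr 1
    refine Finset.prod_congr rfl fun j hj => ?_
    show trig (l j) 0 (x j) = _
    rw [hl j (Finset.ne_of_mem_erase hj)]
  have hm : ∀ l : Fin d → ℕ, sine l 0 ∈ Submodule.span ℝ (range fun k : Fin d → ℕ => sine k 0) :=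
    fun l => Submodule.subset_span ⟨l, rfl⟩
  have hupd : ∀ n : ℕ, ∀ j, j ≠ i → Function.update k i n j = k j := fun n j hj => by simp [hj]
  have hk : ∀ t, trig (k i) 0 t * Real.cos (Real.pi / 2 * (t + 1)) = 1 / 2 * trig (k i + 1) 0 t +
      1 / 2 * Real.sin ((k i : ℝ) * (Real.pi / 2) * (t + 1)) := by
    intro t
    rw [trig_zero, trig_zero]
    unfold freq
    push_cast
    rw [show ((k i : ℝ) + 1 + 1) * (Real.pi / 2) * (t + 1) =
      ((k i : ℝ) + 1) * (Real.pi / 2) * (t + 1) + Real.pi / 2 * (t + 1) by ring,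
      show (k i : ℝ) * (Real.pi / 2) * (t + 1) =
      ((k i : ℝ) + 1) * (Real.pi / 2) * (t + 1) - Real.pi / 2 * (t + 1) by ring,
      Real.sin_add (((k i : ℝ) + 1) * (Real.pi / 2) * (t + 1)), Real.sin_sub]
    ring
  have e : (fun x : E d => sine k 0 x * Real.cos (Real.pi / 2 * (x i + 1))) =
      (1 / 2 : ℝ) • sine (Function.update k i (k i + 1)) 0 + (fun x : E d =>
        1 / 2 * Real.sin ((k i : ℝ) * (Real.pi / 2) * (x i + 1)) *
          ∏ j ∈ Finset.univ.erase i, trig (k j) 0 (x j)) := by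
    ext x
    simp only [Pi.add_apply, Pi.smul_apply, smul_eq_mul]
    rw [hup k (fun _ _ => rfl), hup _ (hupd _), mul_right_comm, hk]
    simp
    ring
  rw [e]
  refine Submodule.add_mem _ (Submodule.smul_mem _ _ (hm _)) ?_
  -- For `k i = 0` the second term is sin 0 = 0; otherwise it is the sine of index `k i - 1`.
  rcases Nat.eq_zero_or_pos (k i) with h0 | h0
  · simp only [h0]
    simp
    exact Submodule.zero_mem _
  · have e2 : (fun x : E d => 1 / 2 * Real.sin ((k i : ℝ) * (Real.pi / 2) * (x i + 1)) *
          ∏ j ∈ Finset.univ.erase i, trig (k j) 0 (x j)) =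
        (1 / 2 : ℝ) • sine (Function.update k i (k i - 1)) 0 := by
      ext x
      simp only [Pi.smul_apply, smul_eq_mul]
      rw [hup _ (hupd _), ← mul_assoc]
      congr 2
      unfold trig freq
      simp only [Function.update_self]
      rw [Nat.cast_sub h0]
      simp
    rw [e2]
    exact Submodule.smul_mem _ _ (hm _)

lemma sine_zero_pos {x : E d} (hx : x ∈ Omega d) : 0 < sine 0 0 x := by
  unfold sine tprod
  refine Finset.prod_pos fun i _ => ?_
  have hp := Real.pi_pos
  have := hx i
  unfold trig freq
  simp only [Pi.zero_apply, pow_zero, one_mul]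
  refine Real.sin_pos_of_pos_of_lt_pi ?_ ?_
  · have : 0 < x i + 1 := by linarith [this.1]
    push_cast
    positivity
  · have : x i + 1 < 2 := by linarith [this.2]
    push_cast
    nlinarith

lemma closure_Omega_subset : closure (Omega d) ⊆ {x : E d | ∀ i, x i ∈ Icc (-1 : ℝ) 1} := by
  refine closure_minimal (fun x hx i => Ioo_subset_Icc_self (hx i)) ?_
  simp only [Set.ofPred_forall]
  exact isClosed_iInter fun i => isClosed_Icc.preimage (by fun_prop)

/-- Stone–Weierstrass for the algebra generated by cos(π(x_i+1)/2), which separates points since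
cosine is injective on [0, π]. As the span of the sines is stable under this algebra, `f` times the
lowest sine product is orthogonal to the algebra, hence to all test functions, hence zero. The
lowest product is positive on Ω. -/
lemma ae_eq_zero_of_integral_sine_eq_zero {f : E d → ℝ}
    (hf : MemLp f 2 (volume.restrict (Omega d)))
    (h : ∀ k, ∫ x in Omega d, f x * sine k 0 x = 0) : f =ᵐ[volume.restrict (Omega d)] 0 := by
  set V := Submodule.span ℝ (range fun k : Fin d → ℕ => sine (d := d) k 0) with hV
  have hVc : ∀ v ∈ V, Continuous v ∧ ∫ x in Omega d, f x * v x = 0 := by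
    intro v hv
    induction hv using Submodule.span_induction with
    | mem v hv =>
      obtain ⟨k, rfl⟩ := hv
      exact ⟨(contDiff_sine k 0).continuous, h k⟩
    | zero => exact ⟨continuous_const, by simp⟩
    | add v w _ _ hv hw =>
      refine ⟨hv.1.add hw.1, ?_⟩
      have i1 : IntegrableOn (fun x => f x * v x) (Omega d) :=
        hf.integrable_mul (memLp_of_continuous isBounded_Omega hv.1 2)
      have i2 : IntegrableOn (fun x => f x * w x) (Omega d) :=
        hf.integrable_mul (memLp_of_continuous isBounded_Omega hw.1 2)
      simp only [Pi.add_apply, mul_add]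
      rw [integral_add i1 i2, hv.2, hw.2, add_zero]
    | smul c v _ hv =>
      refine ⟨hv.1.const_smul c, ?_⟩
      simp only [Pi.smul_apply, smul_eq_mul, mul_left_comm _ c]
      rw [integral_const_mul, hv.2, mul_zero]
  set K : Set (E d) := closure (Omega d)
  have hK : CompactSpace K := isCompact_iff_compactSpace.1 isBounded_Omega.isCompact_closure
  let c : Fin d → C(K, ℝ) := fun i => ⟨fun x => Real.cos (Real.pi / 2 * (x.1 i + 1)), by fun_prop⟩
  set A : Subalgebra ℝ C(K, ℝ) := Algebra.adjoin ℝ (range c)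
  -- The algebra lives on the compact closure of Ω, whereas the sines are functions on the whole
  -- space; `Q` is a global representative of `q`.
  have hA : ∀ q ∈ A, ∃ Q : E d → ℝ, (∀ x : K, Q x = q x) ∧ ∀ v ∈ V, (fun x => v x * Q x) ∈ V := by
    intro q hq
    induction hq using Algebra.adjoin_induction with
    | mem q hq =>
      obtain ⟨i, rfl⟩ := hq
      refine ⟨fun x => Real.cos (Real.pi / 2 * (x i + 1)), fun x => rfl, fun v hv => ?_⟩
      induction hv using Submodule.span_induction with
      | mem v hv =>
        obtain ⟨k, rfl⟩ := hv
        exact sine_mul_cos_mem_span k i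
      | zero =>
        simp only [Pi.zero_apply, zero_mul]
        exact Submodule.zero_mem V
      | add v w _ _ hv hw =>
        have := V.add_mem hv hw
        convert this using 1
        ext x; simp [add_mul]
      | smul a v _ hv =>
        have := V.smul_mem a hv
        convert this using 1
        ext x; simp [mul_assoc]
    | algebraMap r =>
      refine ⟨fun _ => r, fun x => rfl, fun v hv => ?_⟩
      have := V.smul_mem r hv
      convert this using 1
      ext x; simp [mul_comm]
    | add p q _ _ hp hq =>
      obtain ⟨P, hP1, hP2⟩ := hp
      obtain ⟨Q, hQ1, hQ2⟩ := hq
      refine ⟨fun x => P x + Q x, fun x => by simp [hP1, hQ1], fun v hv => ?_⟩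
      have := V.add_mem (hP2 v hv) (hQ2 v hv)
      convert this using 1
      ext x; simp [mul_add]
    | mul p q _ _ hp hq =>
      obtain ⟨P, hP1, hP2⟩ := hp
      obtain ⟨Q, hQ1, hQ2⟩ := hq
      refine ⟨fun x => P x * Q x, fun x => by simp [hP1, hQ1], fun v hv => ?_⟩
      have := hQ2 _ (hP2 v hv)
      convert this using 1
      ext x; simp [mul_assoc]
  have hsep : A.SeparatesPoints := by
    intro x y hxy
    obtain ⟨i, hi⟩ : ∃ i, x.1 i ≠ y.1 i := by
      by_contra! hc
      exact hxy (Subtype.ext (by ext i; exact hc i))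
    refine ⟨c i, ⟨c i, Algebra.subset_adjoin ⟨i, rfl⟩, rfl⟩, fun hc => hi ?_⟩
    have hx := closure_Omega_subset x.2 i
    have hy := closure_Omega_subset y.2 i
    have hp := Real.pi_pos
    have := Real.injOn_cos (x₁ := Real.pi / 2 * (x.1 i + 1)) (x₂ := Real.pi / 2 * (y.1 i + 1))
      ⟨by nlinarith [hx.1], by nlinarith [hx.2]⟩ ⟨by nlinarith [hy.1], by nlinarith [hy.2]⟩ hc
    have := mul_left_cancel₀ (by positivity) this
    linarith
  have hdense := ContinuousMap.subalgebra_topologicalClosure_eq_top_of_separatesPoints A hsep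
  set s : E d → ℝ := sine 0 0
  have hsV : s ∈ V := Submodule.subset_span ⟨0, rfl⟩
  have hsc : Continuous s := (contDiff_sine 0 0).continuous
  have hfs : IntegrableOn (fun x => f x * s x) (Omega d) :=
    hf.integrable_mul (memLp_of_continuous isBounded_Omega hsc 2)
  have key : ∀ φ : E d → ℝ, IsTest (Omega d) φ → ∫ x in Omega d, (f x * s x) * φ x = 0 := by
    intro φ hφ
    let φK : C(K, ℝ) := ⟨fun x => φ x, hφ.smooth.continuous.comp continuous_subtype_val⟩
    have hmem : φK ∈ closure (A : Set C(K, ℝ)) := by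
      have : φK ∈ A.topologicalClosure := by rw [hdense]; trivial
      exact this
    by_contra hne
    set M := ∫ x in Omega d, |f x * s x|
    have hM : 0 ≤ M := integral_nonneg fun _ => abs_nonneg _
    have hpos : 0 < |∫ x in Omega d, (f x * s x) * φ x| := abs_pos.2 hne
    -- With this tolerance ε the error is at most M ε, while the integral itself equals (M + 1) ε in
    -- absolute value; the extra 1 also covers M = 0.
    obtain ⟨q, hqA, hq⟩ := Metric.mem_closure_iff.1 hmem
      (|∫ x in Omega d, (f x * s x) * φ x| / (M + 1)) (by positivity)
    obtain ⟨Q, hQ1, hQ2⟩ := hA q hqA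
    have hsQ := hVc _ (hQ2 s hsV)
    set ε := |∫ x in Omega d, (f x * s x) * φ x| / (M + 1)
    have i1 : IntegrableOn (fun x => (f x * s x) * φ x) (Omega d) :=
      (hφ.integrable_mul (hfs.locallyIntegrableOn)).integrableOn
    have i2 : IntegrableOn (fun x => f x * (s x * Q x)) (Omega d) :=
      hf.integrable_mul (memLp_of_continuous isBounded_Omega hsQ.1 2)
    have e1 : ∫ x in Omega d, (f x * s x) * φ x =
        ∫ x in Omega d, ((f x * s x) * φ x - f x * (s x * Q x)) := by
      rw [integral_sub i1 i2, hsQ.2, sub_zero]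
    have e2 : |∫ x in Omega d, (f x * s x) * φ x| ≤ M * ε := by
      conv_lhs => rw [e1]
      rw [← Real.norm_eq_abs, ← integral_mul_const]
      refine norm_integral_le_of_norm_le (hfs.abs.mul_const ε) ?_
      filter_upwards [ae_restrict_mem measurableSet_Omega] with x hx
      have hd := (ContinuousMap.dist_apply_le_dist (f := φK) (g := q)
        (⟨x, subset_closure hx⟩ : K)).trans hq.le
      rw [← hQ1, Real.dist_eq] at hd
      rw [show f x * s x * φ x - f x * (s x * Q x) = (f x * s x) * (φ x - Q x) by ring, norm_mul,
        Real.norm_eq_abs, Real.norm_eq_abs]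
      exact mul_le_mul_of_nonneg_left hd (abs_nonneg _)
    have e3 : (M + 1) * ε = |∫ x in Omega d, (f x * s x) * φ x| := by
      simp only [ε]; field_simp
    have hε : 0 < ε := by simp only [ε]; positivity
    nlinarith
  have h0 : ∀ᵐ x : E d, x ∈ Omega d → f x * s x = 0 := by
    refine isOpen_Omega.ae_eq_zero_of_integral_contDiff_smul_eq_zero hfs.locallyIntegrableOn
      fun φ h1 h2 h3 => ?_
    have ht : IsTest (Omega d) φ := ⟨h1, h2, h3⟩
    have := key φ ht
    rw [ht.setIntegral_mul] at this
    simpa [mul_comm] using this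
  rw [Filter.EventuallyEq, ae_restrict_iff' measurableSet_Omega]
  filter_upwards [h0] with x hx hxO
  exact (mul_eq_zero.1 (hx hxO)).resolve_right (sine_zero_pos hxO).ne'

/-! ### Sine series -/

lemma memLp_sine (k p : Fin d → ℕ) : MemLp (sine k p) 2 (volume.restrict (Omega d)) :=
  memLp_of_continuous isBounded_Omega (contDiff_sine k p).continuous 2

lemma memLp_psum (a : (Fin d → ℕ) → ℝ) (p : Fin d → ℕ) (F : Finset (Fin d → ℕ)) :
    MemLp (psum a p F) 2 (volume.restrict (Omega d)) :=
  memLp_of_continuous isBounded_Omega (contDiff_psum a p F).continuous 2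

lemma inner_toLp {α : Type*} {m : MeasurableSpace α} {μ : Measure α} {f g : α → ℝ}
    (hf : MemLp f 2 μ) (hg : MemLp g 2 μ) :
    inner ℝ (hf.toLp f) (hg.toLp g) = ∫ x, g x * f x ∂μ := by
  rw [L2.inner_def]
  refine integral_congr_ae ?_
  filter_upwards [hf.coeFn_toLp, hg.coeFn_toLp] with x h1 h2
  simp [h1, h2]

/-- The normalised sine products in `L²(Ω)`. -/
noncomputable def sineLp (p k : Fin d → ℕ) : Lp ℝ 2 (volume.restrict (Omega d)) :=
  (fpow k p)⁻¹ • (memLp_sine k p).toLp _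

lemma orthonormal_sineLp (p : Fin d → ℕ) : Orthonormal ℝ (sineLp (d := d) p) := by
  classical
  rw [orthonormal_iff_ite]
  intro k l
  unfold sineLp
  rw [real_inner_smul_left, real_inner_smul_right, inner_toLp, integral_sine_mul_sine]
  by_cases h : k = l
  · subst h
    have := (fpow_pos k p).ne'
    simp
    field_simp
  · simp [h, Ne.symm h]

/-- `f` is the sum in `L²(Ω)` of the derivative of order `p` of the sine series with
coefficients `a`. -/
structure SeriesLim (p : Fin d → ℕ) (a : (Fin d → ℕ) → ℝ) (f : E d → ℝ) : Prop where
  memLp : MemLp f 2 (volume.restrict (Omega d))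
  tendsto : TendstoL2 atTop (volume.restrict (Omega d)) (psum a p) f

lemma seriesLim_of_hasSum {p : Fin d → ℕ} {a : (Fin d → ℕ) → ℝ}
    {g : Lp ℝ 2 (volume.restrict (Omega d))}
    (h : HasSum (fun k => (a k * fpow k p) • sineLp p k) g) : SeriesLim p a g := by
  refine ⟨Lp.memLp g, ?_⟩
  have h1 := (Lp.tendsto_Lp_iff_tendsto_eLpNorm' _ _).1 h
  refine h1.congr fun F => eLpNorm_congr_ae ?_
  have e : ∑ k ∈ F, (a k * fpow k p) • sineLp p k = (memLp_psum a p F).toLp _ := by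
    have : ∀ k, (a k * fpow k p) • sineLp p k =
        ((memLp_sine k p).const_mul (a k)).toLp (fun x => a k * sine k p x) := by
      intro k
      unfold sineLp
      rw [smul_smul, mul_assoc, mul_inv_cancel₀ (fpow_pos k p).ne', mul_one]
      rfl
    simp only [this]
    clear h1 h
    induction F using Finset.induction_on with
    | empty =>
      rw [Finset.sum_empty]
      symm
      exact MemLp.toLp_zero _
    | insert k F hk ih =>
      rw [Finset.sum_insert hk, ih, ← MemLp.toLp_add]
      congr 1
      ext x
      simp [psum, Finset.sum_insert hk]
  rw [e]
  filter_upwards [(memLp_psum a p F).coeFn_toLp] with x hx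
  rw [Pi.sub_apply, hx]

/-- An orthogonal series converges as soon as its coefficients are square summable against the norms
`fpow k p`. No completeness is needed, so every `p` is allowed. -/
lemma exists_seriesLim {p : Fin d → ℕ} {a : (Fin d → ℕ) → ℝ}
    (h : Summable fun k => (a k * fpow k p) ^ 2) : ∃ f, SeriesLim p a f := by
  have h1 := (orthonormal_sineLp (d := d) p).orthogonalFamily.summable_iff_norm_sq_summable
    (fun k => a k * fpow k p)
  obtain ⟨g, hg⟩ := h1.2 (by simpa only [Real.norm_eq_abs, sq_abs] using h)
  exact ⟨g, seriesLim_of_hasSum (by simpa using hg)⟩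

/-- The sine coefficients of `f`. -/
noncomputable def coef (f : E d → ℝ) (k : Fin d → ℕ) : ℝ := ∫ x in Omega d, f x * sine k 0 x

lemma summable_integral_mul_sine {f : E d → ℝ} (hf : MemLp f 2 (volume.restrict (Omega d)))
    (p : Fin d → ℕ) :
    Summable fun k => ((∫ x in Omega d, f x * sine k p x) / fpow k p) ^ 2 := by
  have h := (orthonormal_sineLp (d := d) p).inner_products_summable (hf.toLp f)
  refine h.congr fun k => ?_
  unfold sineLp
  rw [real_inner_smul_left, inner_toLp, Real.norm_eq_abs, sq_abs]
  congr 1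
  ring

/-- Completeness enters here, and only for p = 0. In directions where p is odd the family consists
of cosines without the constant one, so it is not complete. -/
lemma seriesLim_coef {f : E d → ℝ} (hf : MemLp f 2 (volume.restrict (Omega d))) :
    SeriesLim 0 (coef f) f := by
  have ho := orthonormal_sineLp (d := d) 0
  have hbot : (Submodule.span ℝ (range (sineLp (d := d) 0)))ᗮ = ⊥ := by
    rw [Submodule.eq_bot_iff]
    intro g hg
    have h0 : (g : E d → ℝ) =ᵐ[volume.restrict (Omega d)] 0 := by
      refine ae_eq_zero_of_integral_sine_eq_zero (Lp.memLp g) fun k => ?_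
      have h1 := (Submodule.mem_orthogonal _ _).1 hg (sineLp 0 k)
        (Submodule.subset_span ⟨k, rfl⟩)
      unfold sineLp at h1
      rw [real_inner_smul_left] at h1
      have h2 := (mul_eq_zero.1 h1).resolve_left (inv_ne_zero (fpow_pos k 0).ne')
      rw [← Lp.toLp_coeFn g (Lp.memLp g), inner_toLp] at h2
      exact h2
    exact (Lp.eq_zero_iff_ae_eq_zero).2 h0
  let b := HilbertBasis.mkOfOrthogonalEqBot ho hbot
  have h1 := b.hasSum_repr (hf.toLp f)
  have e : ∀ k, b k = sineLp 0 k := fun k => by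
    simp only [b, HilbertBasis.coe_mkOfOrthogonalEqBot]
  have h2 : SeriesLim 0 (coef f) (hf.toLp f) := by
    refine seriesLim_of_hasSum ?_
    convert h1 using 2 with k
    rw [e, HilbertBasis.repr_apply_apply, e]
    congr 1
    unfold sineLp coef
    rw [real_inner_smul_left, inner_toLp, ← div_eq_inv_mul]
    have : fpow k 0 = 1 := by simp [fpow]
    rw [this, mul_one, div_one]
  exact ⟨hf, h2.tendsto.congr_limit hf.coeFn_toLp⟩

lemma SeriesLim.unique {p : Fin d → ℕ} {a : (Fin d → ℕ) → ℝ} {f g : E d → ℝ}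
    (hf : SeriesLim p a f) (hg : SeriesLim p a g) : f =ᵐ[volume.restrict (Omega d)] g :=
  hf.tendsto.unique hg.tendsto (fun F => (memLp_psum a p F).1) hf.memLp.1 hg.memLp.1

lemma SeriesLim.congr {p : Fin d → ℕ} {a : (Fin d → ℕ) → ℝ} {f g : E d → ℝ}
    (hf : SeriesLim p a f) (hg : f =ᵐ[volume.restrict (Omega d)] g) : SeriesLim p a g :=
  ⟨hf.memLp.ae_eq hg, hf.tendsto.congr_limit hg⟩

/-! ### Folding the line and the space onto the reference cube -/

/-- The triangle wave of period `4` which is the identity on `[-1, 1]`. -/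
noncomputable def fold1 (t : ℝ) : ℝ := 1 - ‖((t - 1 : ℝ) : AddCircle (4 : ℝ))‖

/-- The sign `±1` on the intervals `2k + (-1, 1)`, with `+` for even `k`. -/
noncomputable def sg (t : ℝ) : ℝ := Real.sign (Real.cos (Real.pi / 2 * t))

lemma coe_add_four_mul (t : ℝ) (m : ℤ) : ((t + 4 * m : ℝ) : AddCircle (4 : ℝ)) = t := by
  rw [AddCircle.coe_add, mul_comm]
  have := AddCircle.coe_eq_zero_iff (4 : ℝ) (x := (m : ℝ) * 4)
  rw [this.2 ⟨m, by simp⟩, add_zero]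

lemma fold1_add_four_mul (t : ℝ) (m : ℤ) : fold1 (t + 4 * m) = fold1 t := by
  unfold fold1
  rw [show t + 4 * (m : ℝ) - 1 = t - 1 + 4 * m by ring, coe_add_four_mul]

lemma fold1_reflect (t : ℝ) : fold1 (2 - t) = fold1 t := by
  unfold fold1
  rw [show 2 - t - 1 = -(t - 1) by ring, AddCircle.coe_neg, norm_neg]

lemma fold1_eq_self {a : ℝ} (ha : a ∈ Icc (-1 : ℝ) 1) : fold1 a = a := by
  unfold fold1
  have h : |a - 1| = 1 - a := by rw [abs_sub_comm, abs_of_nonneg (by linarith [ha.2])]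
  rw [(AddCircle.norm_coe_eq_abs_iff (4 : ℝ) (by norm_num)).2, h]
  · ring
  · rw [h, abs_of_pos (by norm_num)]; linarith [ha.1]

lemma abs_fold1_sub_le (s t : ℝ) : |fold1 s - fold1 t| ≤ |s - t| := by
  unfold fold1
  rw [sub_sub_sub_cancel_left]
  refine (abs_norm_sub_norm_le _ _).trans ?_
  rw [← AddCircle.coe_sub, show t - 1 - (s - 1) = t - s by ring, abs_sub_comm s t]
  exact QuotientAddGroup.norm_mk_le_norm

lemma continuous_fold1 : Continuous fold1 := by
  refine LipschitzWith.continuous (K := 1) (LipschitzWith.of_dist_le_mul fun s t => ?_)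
  simpa [Real.dist_eq] using abs_fold1_sub_le s t

lemma exists_rep (t : ℝ) : ∃ m : ℤ, ∃ a ∈ Icc (-1 : ℝ) 1,
    t = a + 4 * m ∨ t = 2 - a + 4 * m := by
  have h1 := Int.floor_le ((t + 1) / 4)
  have h2 := Int.lt_floor_add_one ((t + 1) / 4)
  refine ⟨⌊(t + 1) / 4⌋, ?_⟩
  set m := ⌊(t + 1) / 4⌋
  rcases le_total (t - 4 * m) 1 with h | h
  · exact ⟨t - 4 * m, ⟨by linarith, h⟩, Or.inl (by ring)⟩
  · exact ⟨2 - (t - 4 * m), ⟨by linarith, by linarith⟩, Or.inr (by ring)⟩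

lemma sg_add_four_mul (t : ℝ) (m : ℤ) : sg (t + 4 * m) = sg t := by
  unfold sg
  rw [show Real.pi / 2 * (t + 4 * m) = Real.pi / 2 * t + m * (2 * Real.pi) by ring,
    Real.cos_add_int_mul_two_pi]

lemma sg_reflect (t : ℝ) : sg (2 - t) = -sg t := by
  unfold sg
  rw [show Real.pi / 2 * (2 - t) = Real.pi - Real.pi / 2 * t by ring, Real.cos_pi_sub,
    Real.sign_neg]

lemma sg_eq_one {a : ℝ} (ha : a ∈ Ioo (-1 : ℝ) 1) : sg a = 1 := by
  unfold sg
  have := Real.pi_pos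
  exact Real.sign_of_pos (Real.cos_pos_of_mem_Ioo ⟨by nlinarith [ha.1], by nlinarith [ha.2]⟩)

lemma sg_cases (t : ℝ) : sg t = -1 ∨ sg t = 0 ∨ sg t = 1 := Real.sign_apply_eq _

lemma abs_sg_le (t : ℝ) : |sg t| ≤ 1 := by
  rcases sg_cases t with h | h | h <;> simp [h]

lemma measurable_sg : Measurable sg := by
  unfold sg Real.sign
  refine Measurable.ite ?_ measurable_const (Measurable.ite ?_ measurable_const measurable_const)
  · exact measurableSet_lt (by fun_prop) measurable_const
  · exact measurableSet_lt measurable_const (by fun_prop)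

/-- 1 - |fold1 s| is the distance from `s` to the odd integers, the only places where `sg` changes.
-/
lemma le_abs_sub_of_sg_ne {s t : ℝ} (h : sg s ≠ sg t) : 1 - |fold1 s| ≤ |s - t| := by
  by_contra! hlt
  apply h
  obtain ⟨m, a, ha, hs | hs⟩ := exists_rep s
  · rw [hs, fold1_add_four_mul, fold1_eq_self ha] at hlt
    have h1 : |a| < 1 := by linarith [abs_nonneg (a + 4 * m - t)]
    have h2 : |t - 4 * m| < 1 := by
      have := abs_sub_abs_le_abs_sub (t - 4 * m) a
      rw [show t - 4 * m - a = -(a + 4 * m - t) by ring, abs_neg] at this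
      linarith
    rw [hs, sg_add_four_mul, sg_eq_one (abs_lt.1 h1), show t = t - 4 * m + 4 * m by ring,
      sg_add_four_mul, sg_eq_one (abs_lt.1 h2)]
  · rw [hs, fold1_add_four_mul, fold1_reflect, fold1_eq_self ha] at hlt
    have h1 : |a| < 1 := by linarith [abs_nonneg (2 - a + 4 * m - t)]
    have h2 : |2 - (t - 4 * m)| < 1 := by
      have := abs_sub_abs_le_abs_sub (2 - (t - 4 * m)) a
      rw [show 2 - (t - 4 * m) - a = 2 - a + 4 * m - t by ring] at this
      linarith
    rw [hs, sg_add_four_mul, sg_reflect, sg_eq_one (abs_lt.1 h1),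
      show t = 2 - (2 - (t - 4 * m)) + 4 * m by ring,
      sg_add_four_mul, sg_reflect, sg_eq_one (abs_lt.1 h2)]

lemma trig_add_four_mul (n p : ℕ) (t : ℝ) (m : ℤ) : trig n p (t + 4 * m) = trig n p t := by
  unfold trig freq
  rw [show ((n : ℝ) + 1) * (Real.pi / 2) * (t + 4 * m + 1) + p * (Real.pi / 2) =
    ((n : ℝ) + 1) * (Real.pi / 2) * (t + 1) + p * (Real.pi / 2) +
      (((n + 1) * m : ℤ) : ℝ) * (2 * Real.pi) by push_cast; ring, Real.sin_add_int_mul_two_pi]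

lemma trig_reflect (n p : ℕ) (t : ℝ) : trig n p (2 - t) = (-1) ^ (p + 1) * trig n p t := by
  unfold trig freq
  rw [show ((n : ℝ) + 1) * (Real.pi / 2) * (2 - t + 1) + p * (Real.pi / 2) =
    -(((n : ℝ) + 1) * (Real.pi / 2) * (t + 1) + p * (Real.pi / 2)) + (p : ℕ) * Real.pi +
      ((n + 1 : ℕ) : ℝ) * (2 * Real.pi) by push_cast; ring, Real.sin_add_nat_mul_two_pi,
    Real.sin_add_nat_mul_pi, Real.sin_neg]
  ring

lemma trig_eq_zero_of_even {n p : ℕ} (hp : Even p) {a : ℝ} (ha : a ∈ Icc (-1 : ℝ) 1)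
    (ha' : a ∉ Ioo (-1 : ℝ) 1) : trig n p a = 0 := by
  obtain ⟨q, rfl⟩ := hp
  have : a = -1 ∨ a = 1 := by
    by_contra! h
    exact ha' ⟨lt_of_le_of_ne ha.1 h.1.symm, lt_of_le_of_ne ha.2 h.2⟩
  unfold trig freq
  rcases this with rfl | rfl
  · rw [show ((n : ℝ) + 1) * (Real.pi / 2) * (-1 + 1) + ((q + q : ℕ) : ℝ) * (Real.pi / 2) =
      (q : ℕ) * Real.pi by push_cast; ring, Real.sin_nat_mul_pi, mul_zero]
  · rw [show ((n : ℝ) + 1) * (Real.pi / 2) * (1 + 1) + ((q + q : ℕ) : ℝ) * (Real.pi / 2) =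
      ((n + 1 + q : ℕ) : ℝ) * Real.pi by push_cast; ring, Real.sin_nat_mul_pi, mul_zero]

/-- Even derivatives are odd under t ↦ 2 - t and vanish at odd integers, which is exactly where `sg`
is 0; odd derivatives are even under it. The identity therefore holds at every point, not merely
almost everywhere. -/
lemma trig_eq_fold1 (n p : ℕ) (t : ℝ) :
    trig n p t = (if Even p then sg t else 1) * trig n p (fold1 t) := by
  have key : ∀ a ∈ Icc (-1 : ℝ) 1, trig n p a = (if Even p then sg a else 1) * trig n p a := by
    intro a ha
    split_ifs with hp
    · by_cases ha' : a ∈ Ioo (-1 : ℝ) 1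
      · rw [sg_eq_one ha', one_mul]
      · rw [trig_eq_zero_of_even hp ha ha', mul_zero]
    · rw [one_mul]
  obtain ⟨m, a, ha, rfl | rfl⟩ := exists_rep t
  · rw [trig_add_four_mul, fold1_add_four_mul, sg_add_four_mul, fold1_eq_self ha]
    exact key a ha
  · rw [trig_add_four_mul, fold1_add_four_mul, sg_add_four_mul, trig_reflect, fold1_reflect,
      sg_reflect, fold1_eq_self ha]
    conv_lhs => rw [key a ha]
    split_ifs with hp
    · rw [hp.add_one.neg_one_pow]; ring
    · rw [(Nat.not_even_iff_odd.1 hp).add_one.neg_one_pow, one_mul]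

/-- The folding map of `ℝ^d` onto the closure of `Ω`. -/
noncomputable def fold (x : E d) : E d := WithLp.toLp 2 fun i => fold1 (x i)

@[simp] lemma fold_apply (x : E d) (i : Fin d) : fold x i = fold1 (x i) := rfl

/-- The sign of the reflected extension that is odd in the directions in which `p` is even. -/
noncomputable def sgn (p : Fin d → ℕ) (x : E d) : ℝ := ∏ i, if Even (p i) then sg (x i) else 1

/-- The reflected extension of a function on `Ω`, odd in the directions in which `p` is even,
and even in the others. -/
noncomputable def rext (p : Fin d → ℕ) (f : E d → ℝ) (x : E d) : ℝ := sgn p x * f (fold x)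

lemma sine_eq_rext (k p : Fin d → ℕ) : sine k p = rext p (sine k p) := by
  ext x
  unfold rext sine tprod sgn
  rw [← Finset.prod_mul_distrib]
  exact Finset.prod_congr rfl fun i _ => trig_eq_fold1 _ _ _

/-- Since partial sums are their own reflections, every L² limit on Ω becomes a limit of the same
global smooth functions on all bounded sets. -/
lemma psum_eq_rext (a : (Fin d → ℕ) → ℝ) (p : Fin d → ℕ) (F : Finset (Fin d → ℕ)) :
    psum a p F = rext p (psum a p F) := by
  ext x
  simp only [psum, rext, Finset.mul_sum]
  refine Finset.sum_congr rfl fun k _ => ?_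
  conv_lhs => rw [sine_eq_rext]
  unfold rext; ring

lemma continuous_fold : Continuous (fold : E d → E d) := by
  refine (PiLp.continuous_toLp 2 _).comp (continuous_pi fun i => continuous_fold1.comp ?_)
  fun_prop

lemma measurable_sgn (p : Fin d → ℕ) : Measurable (sgn p) := by
  unfold sgn
  refine Finset.measurable_fun_prod _ fun i _ => ?_
  split_ifs
  · exact measurable_sg.comp (by fun_prop)
  · exact measurable_const

lemma abs_sgn_le (p : Fin d → ℕ) (x : E d) : |sgn p x| ≤ 1 := by
  unfold sgn
  rw [Finset.abs_prod]
  refine Finset.prod_le_one (fun _ _ => abs_nonneg _) fun i _ => ?_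
  split_ifs
  · exact abs_sg_le _
  · simp

lemma fold_eq_self {x : E d} (hx : x ∈ Omega d) : fold x = x := by
  ext i
  exact fold1_eq_self (Ioo_subset_Icc_self (hx i))

lemma sgn_eq_one {x : E d} (hx : x ∈ Omega d) (p : Fin d → ℕ) : sgn p x = 1 := by
  refine Finset.prod_eq_one fun i _ => ?_
  rw [sg_eq_one (hx i)]; simp

lemma rext_eq_self {x : E d} (hx : x ∈ Omega d) (p : Fin d → ℕ) (f : E d → ℝ) :
    rext p f x = f x := by
  unfold rext
  rw [sgn_eq_one hx, fold_eq_self hx, one_mul]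

lemma rext_periodic (p : Fin d → ℕ) (f : E d → ℝ) (x : E d) (k : Fin d → ℤ) :
    rext p f (x + WithLp.toLp 2 (fun i => 4 * (k i : ℝ))) = rext p f x := by
  unfold rext sgn
  have h1 : fold (x + WithLp.toLp 2 (fun i => 4 * (k i : ℝ))) = fold x := by
    ext i
    simp [fold1_add_four_mul]
  rw [h1]
  simp [sg_add_four_mul]

lemma rext_zero_reflect (f : E d → ℝ) (x : E d) (j : Fin d) :
    rext 0 f (reflect j x) = -rext 0 f x := by
  unfold rext sgn
  have h1 : fold (reflect j x) = fold x := by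
    ext i
    by_cases h : i = j
    · subst h; simp [reflect, fold1_reflect]
    · simp [reflect, h]
  rw [h1, ← neg_mul]
  congr 1
  simp only [Pi.zero_apply, Even.zero, if_true]
  rw [← Finset.mul_prod_erase _ _ (Finset.mem_univ j),
    ← Finset.mul_prod_erase _ (fun i => sg (x i)) (Finset.mem_univ j), ← neg_mul]
  congr 1
  · simp [reflect, sg_reflect]
  · refine Finset.prod_congr rfl fun i hi => ?_
    simp [reflect, Finset.ne_of_mem_erase hi]

lemma norm_fold_sub_le (x y : E d) : ‖fold x - fold y‖ ≤ ‖x - y‖ := by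
  rw [EuclideanSpace.norm_eq, EuclideanSpace.norm_eq]
  gcongr with i _
  simpa using abs_fold1_sub_le (x i) (y i)

lemma abs_sub_apply_le (x y : E d) (i : Fin d) : |x i - y i| ≤ ‖x - y‖ := by
  simpa using PiLp.norm_apply_le (x - y) i

lemma exists_of_sgn_ne {p : Fin d → ℕ} {x y : E d} (h : sgn p x ≠ sgn p y) :
    ∃ i, Even (p i) ∧ 1 - |fold x i| ≤ ‖x - y‖ := by
  by_contra! hc
  apply h
  unfold sgn
  refine Finset.prod_congr rfl fun i _ => ?_
  split_ifs with hp
  · by_contra hne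
    have h1 := le_abs_sub_of_sg_ne hne
    have h2 := hc i hp
    have h3 := abs_sub_apply_le x y i
    rw [fold_apply] at h2
    linarith
  · rfl

/-! ### Folding and measure -/

lemma ae_apply_ne (i : Fin d) (c : ℝ) : ∀ᵐ x : E d, x i ≠ c := by
  have h : ∀ᵐ y : Fin d → ℝ, y i ≠ c := Measure.ae_eval_ne (fun _ => (volume : Measure ℝ)) i c
  exact (measurePreserving_ofLp (d := d)).quasiMeasurePreserving.ae h

/-- The isometry of the cell `2k + (-1, 1)^d` onto `Ω` that coincides with the folding map. -/
noncomputable def unfoldMap (k : Fin d → ℤ) (x : E d) : E d :=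
  WithLp.toLp 2 fun i => if Even (k i) then x i - 2 * k i else 2 * k i - x i

lemma measurePreserving_unfoldMap (k : Fin d → ℤ) :
    MeasurePreserving (unfoldMap k) (volume : Measure (E d)) volume := by
  have h1 : MeasurePreserving (fun (y : Fin d → ℝ) i =>
      (if Even (k i) then y i - 2 * (k i : ℝ) else 2 * k i - y i)) volume volume := by
    refine volume_preserving_pi (f := fun i (t : ℝ) =>
      (if Even (k i) then t - 2 * (k i : ℝ) else 2 * k i - t)) fun i => ?_
    split_ifs
    · exact measurePreserving_sub_right volume _
    · exact Measure.measurePreserving_sub_left volume _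
  exact (PiLp.volume_preserving_toLp (Fin d)).comp (h1.comp measurePreserving_ofLp)

lemma fold_eq_unfoldMap {k : Fin d → ℤ} {x : E d} (hx : unfoldMap k x ∈ Omega d) :
    fold x = unfoldMap k x := by
  ext i
  have h := Ioo_subset_Icc_self (hx i)
  simp only [unfoldMap, fold_apply] at h ⊢
  split_ifs at h ⊢ with hk
  · obtain ⟨m, hm⟩ := hk
    rw [hm] at h ⊢
    rw [← fold1_add_four_mul _ (-m)]
    push_cast at h ⊢
    rw [show x i + 4 * -(m : ℝ) = x i - 2 * (m + m) by ring, fold1_eq_self h]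
  · obtain ⟨m, hm⟩ := Int.not_even_iff_odd.1 hk
    rw [hm] at h ⊢
    rw [← fold1_reflect, ← fold1_add_four_mul _ m]
    push_cast at h ⊢
    rw [show 2 - x i + 4 * (m : ℝ) = 2 * (2 * m + 1) - x i by ring, fold1_eq_self h]

/-- A bounded set meets finitely many cells 2k + (-1,1)^d, and on each of them folding is a
measure-preserving bijection onto Ω. `N` counts a finite family of cells that is certainly large
enough. -/
lemma map_fold_le {W : Set (E d)} (hW : Bornology.IsBounded W) :
    ∃ N : ℕ, Measure.map fold (volume.restrict W) ≤ (N : ℝ≥0∞) • volume.restrict (Omega d) := by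
  obtain ⟨n, hn⟩ := exists_subset_bigBox hW
  let K : Finset (Fin d → ℤ) :=
    Fintype.piFinset fun _ => Finset.Icc (-(2 * n + 2 : ℤ)) (2 * n + 2)
  refine ⟨K.card, Measure.le_iff.2 fun s hs => ?_⟩
  have hcover : ∀ᵐ x : E d, x ∈ W → ∃ k ∈ K, unfoldMap k x ∈ Omega d := by
    -- The walls x_i = 2m - 1 between cells form a null set.
    have h0 : ∀ᵐ x : E d, ∀ i, ∀ m : ℤ, x i ≠ 2 * m - 1 :=
      ae_all_iff.2 fun i => ae_all_iff.2 fun m => ae_apply_ne i _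
    filter_upwards [h0] with x hx hxW
    have hb := fun i => hn hxW i
    refine ⟨fun i => ⌊(x i + 1) / 2⌋, ?_, fun i => ?_⟩
    · refine Fintype.mem_piFinset.2 fun i => Finset.mem_Icc.2 ⟨?_, ?_⟩
      · rw [Int.le_floor]; push_cast; linarith [(hb i).1]
      · have : ⌊(x i + 1) / 2⌋ < 2 * n + 2 + 1 := by
          rw [Int.floor_lt]; push_cast; linarith [(hb i).2]
        omega
    · have h1 := Int.floor_le ((x i + 1) / 2)
      have h2 := Int.lt_floor_add_one ((x i + 1) / 2)
      have h3 := hx i ⌊(x i + 1) / 2⌋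
      have h4 : 2 * (⌊(x i + 1) / 2⌋ : ℝ) - 1 < x i :=
        lt_of_le_of_ne (by linarith) h3.symm
      simp only [unfoldMap]
      split_ifs <;> constructor <;> linarith
  rw [Measure.map_apply continuous_fold.measurable hs,
    Measure.restrict_apply (continuous_fold.measurable hs), Measure.smul_apply, smul_eq_mul,
    Measure.restrict_apply hs]
  calc volume (fold ⁻¹' s ∩ W) ≤ volume (⋃ k ∈ K, unfoldMap k ⁻¹' (s ∩ Omega d)) := by
        refine measure_mono_ae ?_
        filter_upwards [hcover] with x hx hxs
        obtain ⟨k, hk, hkx⟩ := hx hxs.2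
        refine mem_iUnion₂.2 ⟨k, hk, ?_, hkx⟩
        rw [← fold_eq_unfoldMap hkx]; exact hxs.1
    _ ≤ ∑ k ∈ K, volume (unfoldMap k ⁻¹' (s ∩ Omega d)) := measure_biUnion_finset_le _ _
    _ = (K.card : ℝ≥0∞) * volume (s ∩ Omega d) := by
        simp only [fun k => (measurePreserving_unfoldMap (d := d) k).measure_preimage
          (hs.inter measurableSet_Omega).nullMeasurableSet]
        simp

lemma lintegral_fold_le {W : Set (E d)} (hW : Bornology.IsBounded W) :
    ∃ N : ℕ, ∀ F : E d → ℝ≥0∞, AEMeasurable F (volume.restrict (Omega d)) →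
      ∫⁻ x in W, F (fold x) ≤ N * ∫⁻ x in Omega d, F x := by
  obtain ⟨N, hN⟩ := map_fold_le hW
  refine ⟨N, fun F hF => ?_⟩
  have hF' : AEMeasurable F (Measure.map fold (volume.restrict W)) :=
    (hF.smul_measure _).mono_measure hN
  rw [← lintegral_map' hF' continuous_fold.measurable.aemeasurable]
  refine (lintegral_mono' hN le_rfl).trans ?_
  rw [lintegral_smul_measure, smul_eq_mul]

lemma aestronglyMeasurable_rext {W : Set (E d)} (hW : Bornology.IsBounded W) {f : E d → ℝ}
    (hf : AEStronglyMeasurable f (volume.restrict (Omega d))) (p : Fin d → ℕ) :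
    AEStronglyMeasurable (rext p f) (volume.restrict W) := by
  obtain ⟨N, hN⟩ := map_fold_le hW
  have h1 : AEStronglyMeasurable f (Measure.map fold (volume.restrict W)) :=
    (hf.smul_measure _).mono_measure hN
  exact (measurable_sgn p).aestronglyMeasurable.mul
    (h1.comp_aemeasurable continuous_fold.measurable.aemeasurable)

/-- The constant is the square root of the covering multiplicity of the folding map; it serves all
`p` and `f` at once. -/
lemma eLpNorm_rext_le {W : Set (E d)} (hW : Bornology.IsBounded W) :
    ∃ C : ℝ≥0∞, C ≠ ⊤ ∧ ∀ (p : Fin d → ℕ) (f : E d → ℝ),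
      AEStronglyMeasurable f (volume.restrict (Omega d)) →
      eLpNorm (rext p f) 2 (volume.restrict W) ≤ C * eLpNorm f 2 (volume.restrict (Omega d)) := by
  obtain ⟨N, hN⟩ := map_fold_le hW
  refine ⟨(N : ℝ≥0∞) ^ (1 / (2 : ℝ≥0∞).toReal), by finiteness, fun p f hf => ?_⟩
  have h1 : AEStronglyMeasurable f (Measure.map fold (volume.restrict W)) :=
    (hf.smul_measure _).mono_measure hN
  calc eLpNorm (rext p f) 2 (volume.restrict W)
      ≤ eLpNorm (f ∘ fold) 2 (volume.restrict W) := by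
        refine eLpNorm_mono fun x => ?_
        simp only [rext, norm_mul, Function.comp_apply]
        exact mul_le_of_le_one_left (norm_nonneg _) (abs_sgn_le p x)
    _ = eLpNorm f 2 (Measure.map fold (volume.restrict W)) :=
        (eLpNorm_map_measure h1 continuous_fold.measurable.aemeasurable).symm
    _ ≤ eLpNorm f 2 ((N : ℝ≥0∞) • volume.restrict (Omega d)) := eLpNorm_mono_measure _ hN
    _ = _ := by
        rw [eLpNorm_smul_measure_of_ne_top (by norm_num), smul_eq_mul]
        simp

lemma MemLp.rext {f : E d → ℝ} (hf : MemLp f 2 (volume.restrict (Omega d))) (p : Fin d → ℕ) :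
    MemL2Loc (rext p f) := by
  intro W hW
  obtain ⟨C, hC, h⟩ := eLpNorm_rext_le hW
  exact ⟨aestronglyMeasurable_rext hW hf.1 p,
    (h p f hf.1).trans_lt (ENNReal.mul_lt_top hC.lt_top hf.2)⟩

lemma TendstoL2.rext {ι : Type*} {l : Filter ι} {f : ι → E d → ℝ} {g : E d → ℝ}
    (h : TendstoL2 l (volume.restrict (Omega d)) f g)
    (hf : ∀ n, MemLp (f n) 2 (volume.restrict (Omega d)))
    (hg : MemLp g 2 (volume.restrict (Omega d))) (p : Fin d → ℕ) {W : Set (E d)}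
    (hW : Bornology.IsBounded W) :
    TendstoL2 l (volume.restrict W) (fun n => rext p (f n)) (rext p g) := by
  obtain ⟨C, hC, hle⟩ := eLpNorm_rext_le hW
  have h0 : Tendsto (fun n => C * eLpNorm (fun x => f n x - g x) 2 (volume.restrict (Omega d)))
      l (𝓝 0) := by
    simpa using ENNReal.Tendsto.const_mul (a := C) h (Or.inr hC)
  refine tendsto_of_tendsto_of_tendsto_of_le_of_le tendsto_const_nhds h0 (fun _ => zero_le)
    fun n => ?_
  have := hle p (fun x => f n x - g x) ((hf n).sub hg).1
  refine le_trans (le_of_eq ?_) this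
  congr 1; ext x; simp only [OddReflection.rext]; ring

lemma SeriesLim.tendsto_rext {p : Fin d → ℕ} {a : (Fin d → ℕ) → ℝ} {f : E d → ℝ}
    (h : SeriesLim p a f) {W : Set (E d)} (hW : Bornology.IsBounded W) :
    TendstoL2 atTop (volume.restrict W) (psum a p) (rext p f) := by
  have := h.tendsto.rext (fun F => memLp_psum a p F) h.memLp p hW
  simpa only [← psum_eq_rext] using this

/-- The approximating partial sums are smooth on ℝ^d, so the limit has a weak derivative across the
walls and no boundary term has to be examined. -/
lemma SeriesLim.hasWeakPartial {p : Fin d → ℕ} {a : (Fin d → ℕ) → ℝ} {j : Fin d} {f f' : E d → ℝ}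
    (h : SeriesLim p a f) (h' : SeriesLim (p + Pi.single j 1) a f') :
    HasWeakPartial univ j (rext p f) (rext (p + Pi.single j 1) f') := by
  refine hasWeakPartial_of_tendstoL2 (l := atTop) (f := psum a p) (contDiff_psum a p)
    (MemLp.rext h.memLp p) (MemLp.rext h'.memLp _) (fun W hW => h.tendsto_rext hW) fun W hW => ?_
  simp only [partialDeriv_psum]
  exact h'.tendsto_rext hW

/-! ### Functions in `H^1_0(Ω)` -/

lemma integrable_mul_of_memLp_two {α : Type*} {m : MeasurableSpace α} {μ : Measure α}
    {f g : α → ℝ} (hf : MemLp f 2 μ) (hg : MemLp g 2 μ) : Integrable (fun x => f x * g x) μ :=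
  hf.integrable_mul hg

lemma tendstoL2_of_bounded {α : Type*} {m : MeasurableSpace α} {μ : Measure α} [IsFiniteMeasure μ]
    {f : ℕ → α → ℝ} {g : α → ℝ} (C : ℝ) (hf : ∀ n, AEStronglyMeasurable (f n) μ)
    (hg : AEStronglyMeasurable g μ) (hb : ∀ n, ∀ᵐ x ∂μ, |f n x - g x| ≤ C)
    (hl : ∀ᵐ x ∂μ, ∀ᶠ n in atTop, f n x = g x) : TendstoL2 atTop μ f g := by
  unfold TendstoL2
  have h0 : Tendsto (fun n => ∫⁻ x, ‖f n x - g x‖ₑ ^ (2 : ℝ) ∂μ) atTop (𝓝 (∫⁻ _, 0 ∂μ)) := by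
    refine tendsto_lintegral_of_dominated_convergence' (fun _ => ENNReal.ofReal C ^ (2 : ℝ))
      (fun n => ((hf n).sub hg).enorm.pow_const _) (fun n => ?_) (by
        rw [lintegral_const]; finiteness) ?_
    · filter_upwards [hb n] with x hx
      gcongr
      rw [Real.enorm_eq_ofReal_abs]
      exact ENNReal.ofReal_le_ofReal hx
    · filter_upwards [hl] with x hx
      refine tendsto_const_nhds.congr' ?_
      filter_upwards [hx] with n hn
      simp [hn]
  rw [lintegral_zero] at h0
  have h1 := h0.ennrpow_const (1 / 2 : ℝ)
  simp only [ENNReal.zero_rpow_of_pos (by norm_num : (0 : ℝ) < 1 / 2)] at h1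
  refine h1.congr fun n => ?_
  rw [eLpNorm_eq_lintegral_rpow_enorm_toReal (by norm_num) (by norm_num)]
  simp

lemma hasWeakPartial_of_contDiff {f : E d → ℝ} (hf : ContDiff ℝ ∞ f) (U : Set (E d)) (i : Fin d) :
    HasWeakPartial U i f (partialDeriv i f) where
  locInt := hf.continuous.locallyIntegrable.locallyIntegrableOn _
  locInt_deriv := (contDiff_partialDeriv hf i).continuous.locallyIntegrable.locallyIntegrableOn _
  integral_eq φ hφ := by
    rw [(hφ.partialDeriv i).setIntegral_mul, hφ.setIntegral_mul, integral_partialDeriv_eq_neg hf hφ]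

/-- `u`, with gradient `G`, can be approximated in `H^1` by test functions. -/
def H10Approx (U : Set (E d)) (u : E d → ℝ) (G : Fin d → E d → ℝ) : Prop :=
  ∀ ε : ℝ, 0 < ε → ∃ φ, IsTest U φ ∧
    eLpNorm (fun x => u x - φ x) 2 (volume.restrict U) ≤ ENNReal.ofReal ε ∧
    ∀ i, eLpNorm (fun x => G i x - partialDeriv i φ x) 2 (volume.restrict U) ≤ ENNReal.ofReal ε

lemma h10Approx_of_tendsto_test {ι : Type*} {l : Filter ι} [l.NeBot] {U : Set (E d)}
    {φ : ι → E d → ℝ} {u : E d → ℝ} {G : Fin d → E d → ℝ} (hφ : ∀ᶠ n in l, IsTest U (φ n))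
    (hu : TendstoL2 l (volume.restrict U) φ u)
    (hG : ∀ i, TendstoL2 l (volume.restrict U) (fun n => partialDeriv i (φ n)) (G i)) :
    H10Approx U u G := by
  intro ε hε
  have hε' : 0 < ENNReal.ofReal ε := ENNReal.ofReal_pos.2 hε
  have h1 := (hu.eventually_lt_const hε').and
    ((eventually_all.2 fun i => (hG i).eventually_lt_const hε').and hφ)
  obtain ⟨n, h2, h3, h4⟩ := h1.exists
  refine ⟨φ n, h4, ?_, fun i => ?_⟩
  · exact (eLpNorm_sub_comm u (φ n) 2 _).trans_le h2.le
  · exact (eLpNorm_sub_comm (G i) (partialDeriv i (φ n)) 2 _).trans_le (h3 i).le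

lemma H10Approx.exists_seq {U : Set (E d)} {u : E d → ℝ} {G : Fin d → E d → ℝ}
    (h : H10Approx U u G) : ∃ φ : ℕ → E d → ℝ, (∀ n, IsTest U (φ n)) ∧
      TendstoL2 atTop (volume.restrict U) φ u ∧
      ∀ i, TendstoL2 atTop (volume.restrict U) (fun n => partialDeriv i (φ n)) (G i) := by
  choose φ h1 h2 h3 using fun n : ℕ => h (1 / ((n : ℝ) + 1)) (by positivity)
  have h0 : Tendsto (fun n : ℕ => ENNReal.ofReal (1 / ((n : ℝ) + 1))) atTop (𝓝 0) := by
    have := ENNReal.tendsto_ofReal (tendsto_one_div_add_atTop_nhds_zero_nat (𝕜 := ℝ))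
    simpa using this
  refine ⟨φ, h1, ?_, fun i => ?_⟩
  · exact tendsto_of_tendsto_of_tendsto_of_le_of_le tendsto_const_nhds h0 (fun _ => zero_le)
      fun n => (eLpNorm_sub_comm (φ n) u 2 _).trans_le (h2 n)
  · exact tendsto_of_tendsto_of_tendsto_of_le_of_le tendsto_const_nhds h0 (fun _ => zero_le)
      fun n => (eLpNorm_sub_comm (partialDeriv i (φ n)) (G i) 2 _).trans_le (h3 n i)

lemma h10Approx_of_tendsto {ι : Type*} {l : Filter ι} [l.NeBot] {U : Set (E d)}
    {f : ι → E d → ℝ} {H : ι → Fin d → E d → ℝ} {u : E d → ℝ} {G : Fin d → E d → ℝ}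
    (hf : ∀ n, MemLp (f n) 2 (volume.restrict U)) (hH : ∀ n i, MemLp (H n i) 2 (volume.restrict U))
    (hu : MemLp u 2 (volume.restrict U)) (hG : ∀ i, MemLp (G i) 2 (volume.restrict U))
    (hfH : ∀ n, H10Approx U (f n) (H n))
    (hlu : TendstoL2 l (volume.restrict U) f u)
    (hlG : ∀ i, TendstoL2 l (volume.restrict U) (fun n => H n i) (G i)) : H10Approx U u G := by
  intro ε hε
  have hε' : 0 < ENNReal.ofReal (ε / 2) := ENNReal.ofReal_pos.2 (half_pos hε)
  obtain ⟨n, h2, h3⟩ := ((hlu.eventually_lt_const hε').and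
    (eventually_all.2 fun i => (hlG i).eventually_lt_const hε')).exists
  obtain ⟨φ, h4, h5, h6⟩ := hfH n (ε / 2) (half_pos hε)
  have hmφ : AEStronglyMeasurable φ (volume.restrict U) := h4.smooth.continuous.aestronglyMeasurable
  have hadd : ENNReal.ofReal ε = ENNReal.ofReal (ε / 2) + ENNReal.ofReal (ε / 2) := by
    rw [← ENNReal.ofReal_add (by positivity) (by positivity), add_halves]
  have key : ∀ a b c : E d → ℝ, AEStronglyMeasurable a (volume.restrict U) →
      AEStronglyMeasurable b (volume.restrict U) → AEStronglyMeasurable c (volume.restrict U) →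
      eLpNorm (fun x => b x - a x) 2 (volume.restrict U) ≤ ENNReal.ofReal (ε / 2) →
      eLpNorm (fun x => b x - c x) 2 (volume.restrict U) ≤ ENNReal.ofReal (ε / 2) →
      eLpNorm (fun x => a x - c x) 2 (volume.restrict U) ≤ ENNReal.ofReal ε := by
    intro a b c ha hb hc h1 h2
    have h3 := eLpNorm_sub_le (p := 2) (hb.sub hc) (hb.sub ha) (by norm_num)
    rw [hadd]
    refine le_trans (le_of_eq ?_) (h3.trans (add_le_add h2 h1))
    congr 1; ext x; simp
  refine ⟨φ, h4, key u (f n) φ hu.1 (hf n).1 hmφ h2.le h5, fun i => ?_⟩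
  exact key _ _ _ (hG i).1 (hH n i).1 (h4.partialDeriv i).smooth.continuous.aestronglyMeasurable
    (h3 i).le (h6 i)

lemma MemH10.gradient {U : Set (E d)} (hU : IsOpen U) {u : E d → ℝ} {G : Fin d → E d → ℝ}
    (hu : MemH10 U u) (hG : HasWeakGradient U u G) :
    (∀ i, MemLp (G i) 2 (volume.restrict U)) ∧ H10Approx U u G := by
  obtain ⟨_, G', h1, h2, h3⟩ := hu
  have he := fun i => (h1 i).unique hU (hG i)
  refine ⟨fun i => (h2 i).ae_eq (he i), fun ε hε => ?_⟩
  obtain ⟨φ, h4, h5, h6⟩ := h3 ε hε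
  refine ⟨φ, h4, h5, fun i => (le_of_eq (eLpNorm_congr_ae ?_)).trans (h6 i)⟩
  filter_upwards [he i] with x hx
  rw [hx]

/-- `ψ` need not vanish on the boundary: the boundary term is absent for the test functions
approximating `u`, and it stays absent in the limit. -/
lemma MemH10.integral_mul_smooth {u : E d → ℝ} {G : Fin d → E d → ℝ}
    (hu : MemH10 (Omega d) u) (hG : HasWeakGradient (Omega d) u G) {ψ : E d → ℝ}
    (hψ : ContDiff ℝ ∞ ψ) (j : Fin d) :
    ∫ x in Omega d, G j x * ψ x = -∫ x in Omega d, u x * partialDeriv j ψ x := by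
  obtain ⟨h1, h2⟩ := hu.gradient isOpen_Omega hG
  obtain ⟨φ, h3, h4, h5⟩ := h2.exists_seq
  have hc : ∀ f : E d → ℝ, ContDiff ℝ ∞ f → MemLp f 2 (volume.restrict (Omega d)) :=
    fun f hf => memLp_of_continuous isBounded_Omega hf.continuous 2
  have l1 := (h5 j).integral_mul (fun n => hc _ ((h3 n).partialDeriv j).smooth) (h1 j) (hc _ hψ)
  have l2 := h4.integral_mul (fun n => hc _ (h3 n).smooth) hu.1
    (hc _ (contDiff_partialDeriv hψ j))
  refine tendsto_nhds_unique l1 (l2.neg.congr fun n => ?_)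
  have e := integral_partialDeriv_eq_neg hψ (h3 n) j
  simp only [mul_comm _ (ψ _)]
  rw [((h3 n).partialDeriv j).setIntegral_mul, e, neg_inj]
  simp only [mul_comm _ (partialDeriv j ψ _)]
  rw [(h3 n).setIntegral_mul]

/-- Here the second function has only a weak derivative; the test functions approximating `w` are
fed into its definition. -/
lemma MemH10.integral_mul_weak {w : E d → ℝ} {G : Fin d → E d → ℝ}
    (hw : MemH10 (Omega d) w) (hG : HasWeakGradient (Omega d) w G) {v v' : E d → ℝ} {j : Fin d}
    (hv : HasWeakPartial (Omega d) j v v') (hv2 : MemLp v 2 (volume.restrict (Omega d)))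
    (hv2' : MemLp v' 2 (volume.restrict (Omega d))) :
    ∫ x in Omega d, G j x * v x = -∫ x in Omega d, w x * v' x := by
  obtain ⟨h1, h2⟩ := hw.gradient isOpen_Omega hG
  obtain ⟨φ, h3, h4, h5⟩ := h2.exists_seq
  have hc : ∀ f : E d → ℝ, ContDiff ℝ ∞ f → MemLp f 2 (volume.restrict (Omega d)) :=
    fun f hf => memLp_of_continuous isBounded_Omega hf.continuous 2
  have l1 := (h5 j).integral_mul (fun n => hc _ ((h3 n).partialDeriv j).smooth) (h1 j) hv2
  have l2 := h4.integral_mul (fun n => hc _ (h3 n).smooth) hw.1 hv2'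
  refine tendsto_nhds_unique l1 (l2.neg.congr fun n => ?_)
  have e := hv.integral_eq _ (h3 n)
  simp only [mul_comm _ (v _), mul_comm _ (v' _)]
  exact e.symm

/-! ### Smooth functions vanishing on the boundary -/

/-- A smooth cutoff that vanishes where `1 - |t| ≤ 1 / n` and is one where `1 - |t| ≥ 2 / n`. -/
noncomputable def cutoff (n : ℕ) (t : ℝ) : ℝ :=
  Real.smoothTransition (n * (1 - t) - 1) * Real.smoothTransition (n * (1 + t) - 1)

lemma contDiff_smoothTransition : ContDiff ℝ ∞ Real.smoothTransition :=
  Real.smoothTransition.contDiff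

lemma contDiff_cutoff (n : ℕ) : ContDiff ℝ ∞ (cutoff n) := by
  unfold cutoff
  exact (contDiff_smoothTransition.comp (by fun_prop)).mul
    (contDiff_smoothTransition.comp (by fun_prop))

lemma abs_cutoff_le (n : ℕ) (t : ℝ) : |cutoff n t| ≤ 1 := by
  unfold cutoff
  rw [abs_of_nonneg (mul_nonneg (Real.smoothTransition.nonneg _) (Real.smoothTransition.nonneg _))]
  exact mul_le_one₀ (Real.smoothTransition.le_one _) (Real.smoothTransition.nonneg _)
    (Real.smoothTransition.le_one _)

lemma cutoff_eq_zero {n : ℕ} {t : ℝ} (h : n * (1 - |t|) ≤ 1) : cutoff n t = 0 := by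
  unfold cutoff
  rcases abs_choice t with h1 | h1
  · rw [h1] at h
    rw [Real.smoothTransition.zero_of_nonpos (by linarith), zero_mul]
  · rw [h1] at h
    rw [Real.smoothTransition.zero_of_nonpos (x := n * (1 + t) - 1) (by linarith), mul_zero]

lemma cutoff_eq_one {n : ℕ} {t : ℝ} (h : 2 ≤ n * (1 - |t|)) : cutoff n t = 1 := by
  unfold cutoff
  have hn : (0 : ℝ) ≤ n := n.cast_nonneg
  have h1 := mul_le_mul_of_nonneg_left (sub_le_sub_left (le_abs_self t) 1) hn
  have h2 := mul_le_mul_of_nonneg_left (sub_le_sub_left (neg_le_abs t) 1) hn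
  rw [Real.smoothTransition.one_of_one_le (by linarith),
    Real.smoothTransition.one_of_one_le (by linarith), mul_one]

lemma exists_deriv_smoothTransition_bound :
    ∃ C : ℝ, 0 ≤ C ∧ ∀ t, |deriv Real.smoothTransition t| ≤ C := by
  have hc : Continuous (deriv Real.smoothTransition) :=
    contDiff_smoothTransition.continuous_deriv (by simp)
  obtain ⟨C, hC⟩ := (isCompact_Icc (a := (0 : ℝ)) (b := 1)).exists_bound_of_continuousOn
    hc.continuousOn
  refine ⟨max C 0, le_max_right _ _, fun t => ?_⟩
  by_cases ht : t ∈ Icc (0 : ℝ) 1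
  · exact (hC t ht).trans (le_max_left _ _)
  · have : deriv Real.smoothTransition t = 0 := by
      rcases lt_or_gt_of_ne (fun h : t = 0 => ht (by simp [h])) with h | h
      · have : Real.smoothTransition =ᶠ[𝓝 t] fun _ => 0 := by
          filter_upwards [gt_mem_nhds h] with s hs
          exact Real.smoothTransition.zero_of_nonpos hs.le
        rw [this.deriv_eq]; simp
      · have h1 : 1 < t := by
          by_contra! hle
          exact ht ⟨h.le, hle⟩
        have : Real.smoothTransition =ᶠ[𝓝 t] fun _ => 1 := by
          filter_upwards [lt_mem_nhds h1] with s hs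
          exact Real.smoothTransition.one_of_one_le hs.le
        rw [this.deriv_eq]; simp
    rw [this, abs_zero]
    exact le_max_right _ _

lemma exists_deriv_cutoff_bound : ∃ C : ℝ, 0 ≤ C ∧ ∀ (n : ℕ) (t : ℝ),
    |deriv (cutoff n) t| ≤ C * n := by
  obtain ⟨C, hC0, hC⟩ := exists_deriv_smoothTransition_bound
  refine ⟨2 * C, by positivity, fun n t => ?_⟩
  have hs : ∀ s, HasDerivAt Real.smoothTransition (deriv Real.smoothTransition s) s := fun s =>
    ((contDiff_smoothTransition.differentiable (by simp)) s).hasDerivAt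
  have h1 : HasDerivAt (fun t : ℝ => (n : ℝ) * (1 - t) - 1) (-n) t := by
    simpa using (((hasDerivAt_id t).const_sub 1).const_mul (n : ℝ)).sub_const 1
  have h2 : HasDerivAt (fun t : ℝ => (n : ℝ) * (1 + t) - 1) n t := by
    simpa using (((hasDerivAt_id t).const_add 1).const_mul (n : ℝ)).sub_const 1
  have h3 := ((hs _).comp t h1).mul ((hs _).comp t h2)
  have h4 : deriv (cutoff n) t = _ := h3.deriv
  rw [h4]
  simp only [Function.comp_apply]
  set a := deriv Real.smoothTransition (n * (1 - t) - 1)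
  set b := deriv Real.smoothTransition (n * (1 + t) - 1)
  have hn : (0 : ℝ) ≤ n := n.cast_nonneg
  have ha : |a * -n * Real.smoothTransition (n * (1 + t) - 1)| ≤ C * n := by
    rw [abs_mul, abs_mul, abs_neg, abs_of_nonneg hn,
      abs_of_nonneg (Real.smoothTransition.nonneg _)]
    exact (mul_le_of_le_one_right (by positivity) (Real.smoothTransition.le_one _)).trans
      (mul_le_mul_of_nonneg_right (hC _) hn)
  have hb : |Real.smoothTransition (n * (1 - t) - 1) * (b * n)| ≤ C * n := by
    rw [abs_mul, abs_mul, abs_of_nonneg hn,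
      abs_of_nonneg (Real.smoothTransition.nonneg _)]
    exact (mul_le_of_le_one_left (by positivity) (Real.smoothTransition.le_one _)).trans
      (mul_le_mul_of_nonneg_right (hC _) hn)
  calc _ ≤ _ := abs_add_le _ _
    _ ≤ 2 * C * n := by linarith

lemma deriv_cutoff_eq_zero {n : ℕ} {t : ℝ} (h : 2 < n * (1 - |t|)) :
    deriv (cutoff n) t = 0 := by
  have : cutoff n =ᶠ[𝓝 t] fun _ => 1 := by
    have hc : ContinuousAt (fun s : ℝ => (n : ℝ) * (1 - |s|)) t := by fun_prop
    filter_upwards [hc.eventually (lt_mem_nhds h)] with s hs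
    exact cutoff_eq_one hs.le
  rw [this.deriv_eq]; simp

lemma eventually_two_lt {t : ℝ} (ht : t ∈ Ioo (-1 : ℝ) 1) :
    ∀ᶠ n : ℕ in atTop, 2 < n * (1 - |t|) := by
  have h1 : 0 < 1 - |t| := sub_pos.2 (abs_lt.2 ht)
  exact (tendsto_natCast_atTop_atTop.atTop_mul_const h1).eventually_gt_atTop 2

/-- A smooth function that vanishes linearly at the faces of the cube is in `H^1_0`. -/
lemma h10Approx_of_vanishing {w : E d → ℝ} (hw : ContDiff ℝ ∞ w) {L : ℝ} (hL : 0 ≤ L)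
    (hb : ∀ x ∈ Omega d, ∀ i, |w x| ≤ L * (1 - |x i|)) :
    H10Approx (Omega d) w fun i => partialDeriv i w := by
  have hfin := isFiniteMeasure_restrict (isBounded_Omega (d := d))
  set χ : ℕ → E d → ℝ := fun n => tprod fun _ => cutoff n with hχ
  have hχs : ∀ n, ContDiff ℝ ∞ (χ n) := fun n => contDiff_tprod fun _ => contDiff_cutoff n
  have hχd : ∀ n j x, partialDeriv j (χ n) x =
      deriv (cutoff n) (x j) * ∏ i ∈ Finset.univ.erase j, cutoff n (x i) := by
    intro n j x
    rw [hχ, partialDeriv_tprod (f' := deriv (cutoff n))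
      (fun i => (contDiff_cutoff n).differentiable (by simp))
      ((contDiff_cutoff n).differentiable (by simp) _).hasDerivAt]
    unfold tprod
    rw [← Finset.mul_prod_erase _ _ (Finset.mem_univ j)]
    congr 1
    · simp
    · refine Finset.prod_congr rfl fun i hi => ?_
      simp [(Finset.ne_of_mem_erase hi)]
  have hprod : ∀ n (s : Finset (Fin d)) (x : E d), |∏ i ∈ s, cutoff n (x i)| ≤ 1 := by
    intro n s x
    rw [Finset.abs_prod]
    exact Finset.prod_le_one (fun _ _ => abs_nonneg _) fun i _ => abs_cutoff_le n _
  have hev : ∀ x ∈ Omega d, ∀ᶠ n : ℕ in atTop, ∀ i, 2 < n * (1 - |x i|) := fun x hx =>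
    eventually_all.2 fun i => eventually_two_lt (hx i)
  have hχ1 : ∀ x ∈ Omega d, ∀ᶠ n : ℕ in atTop, χ n x = 1 := by
    intro x hx
    filter_upwards [hev x hx] with n hn
    exact Finset.prod_eq_one fun i _ => cutoff_eq_one (hn i).le
  have htest : ∀ n, IsTest (Omega d) (fun x => w x * χ n x) := by
    intro n
    set Z : Set (E d) := {x | ∀ i, 1 ≤ n * (1 - |x i|)}
    have hZc : IsClosed Z := by
      simp only [Z, Set.ofPred_forall]
      exact isClosed_iInter fun i => isClosed_le continuous_const (by fun_prop)
    have hZO : Z ⊆ Omega d := by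
      intro x hx i
      have h1 := hx i
      have hn : (0 : ℝ) ≤ n := n.cast_nonneg
      have : 0 < 1 - |x i| := by
        by_contra! hle
        nlinarith
      exact abs_lt.1 (by linarith)
    have hsup : tsupport (fun x => w x * χ n x) ⊆ Z := by
      refine closure_minimal (fun x hx i => ?_) hZc
      by_contra! hlt
      apply hx
      have : χ n x = 0 := Finset.prod_eq_zero (Finset.mem_univ i) (cutoff_eq_zero hlt.le)
      simp [this]
    refine ⟨hw.mul (hχs n), ?_, hsup.trans hZO⟩
    exact Metric.isCompact_of_isClosed_isBounded (isClosed_tsupport _)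
      (isBounded_Omega.subset (hsup.trans hZO))
  obtain ⟨C, hC0, hC⟩ := exists_deriv_cutoff_bound
  refine h10Approx_of_tendsto_test (l := atTop) (Eventually.of_forall htest) ?_ fun j => ?_
  · obtain ⟨M, hM⟩ := (isBounded_Omega (d := d)).isCompact_closure.exists_bound_of_continuousOn
      hw.continuous.continuousOn
    refine tendstoL2_of_bounded (2 * M) (fun n => (htest n).smooth.continuous.aestronglyMeasurable)
      hw.continuous.aestronglyMeasurable (fun n => ?_) ?_
    · filter_upwards [ae_restrict_mem measurableSet_Omega] with x hx
      have h1 : |χ n x| ≤ 1 := hprod n _ x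
      have h2 : |w x| ≤ M := hM x (subset_closure hx)
      have h3 : |w x * χ n x| ≤ M := by
        rw [abs_mul]
        exact (mul_le_of_le_one_right (abs_nonneg _) h1).trans h2
      rw [abs_le] at *
      constructor <;> linarith
    · filter_upwards [ae_restrict_mem measurableSet_Omega] with x hx
      filter_upwards [hχ1 x hx] with n hn
      rw [hn, mul_one]
  · have hdw := (contDiff_partialDeriv hw j).continuous
    obtain ⟨M, hM⟩ := (isBounded_Omega (d := d)).isCompact_closure.exists_bound_of_continuousOn
      hdw.continuousOn
    refine tendstoL2_of_bounded (2 * M + 2 * L * C)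
      (fun n => ((htest n).partialDeriv j).smooth.continuous.aestronglyMeasurable)
      hdw.aestronglyMeasurable (fun n => ?_) ?_
    · filter_upwards [ae_restrict_mem measurableSet_Omega] with x hx
      rw [partialDeriv_mul hw (hχs n), hχd]
      have h1 : |χ n x| ≤ 1 := hprod n _ x
      have h2 : |partialDeriv j w x| ≤ M := hM x (subset_closure hx)
      have h3 := hprod n (Finset.univ.erase j) x
      set q := ∏ i ∈ Finset.univ.erase j, cutoff n (x i)
      -- The derivative of the cutoff is of size C n but lives where 1 - |x_j| ≤ 2/n, and there |w|
      -- ≤ 2L/n. The product is bounded uniformly in `n`, so dominated convergence applies.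
      have h4 : |w x * (deriv (cutoff n) (x j) * q)| ≤ 2 * L * C := by
        rw [abs_mul, abs_mul]
        by_cases h5 : 2 < n * (1 - |x j|)
        · rw [deriv_cutoff_eq_zero h5]; simp; positivity
        · have h6 := hb x hx j
          have h7 := hC n (x j)
          have hp : 0 ≤ 1 - |x j| := sub_nonneg.2 (abs_lt.2 (hx j)).le
          calc |w x| * (|deriv (cutoff n) (x j)| * |q|) ≤ (L * (1 - |x j|)) * (C * n * 1) := by
                gcongr
            _ = L * C * (n * (1 - |x j|)) := by ring
            _ ≤ L * C * 2 := by
                gcongr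
                exact not_lt.1 h5
            _ = 2 * L * C := by ring
      have h8 : |partialDeriv j w x * χ n x| ≤ M := by
        rw [abs_mul]
        exact (mul_le_of_le_one_right (abs_nonneg _) h1).trans h2
      rw [abs_le] at *
      constructor <;> linarith
    · filter_upwards [ae_restrict_mem measurableSet_Omega] with x hx
      filter_upwards [hχ1 x hx, hev x hx] with n hn hn2
      rw [partialDeriv_mul hw (hχs n), hχd, hn, deriv_cutoff_eq_zero (hn2 j)]
      simp

/-- The sine is 1-Lipschitz and this factor vanishes at both endpoints; compare with the nearer one.
-/
lemma abs_trig_zero_le (n : ℕ) {t : ℝ} (ht : t ∈ Ioo (-1 : ℝ) 1) :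
    |trig n 0 t| ≤ freq n * (1 - |t|) := by
  have hl : ∀ s : ℝ, trig n 0 s = 0 → |trig n 0 t| ≤ freq n * |t - s| := by
    intro s hs
    rw [← sub_zero (trig n 0 t), ← hs, trig_zero, trig_zero]
    refine (Real.abs_sin_sub_sin_le _ _).trans ?_
    rw [← mul_sub, abs_mul, abs_of_pos (freq_pos n)]
    simp
  have h1 := hl 1 (trig_eq_zero_of_even (by simp) (by norm_num) (by simp))
  have h2 := hl (-1) (trig_eq_zero_of_even (by simp) (by norm_num) (by simp))
  rcases abs_choice t with h | h
  · rw [h]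
    rwa [abs_sub_comm, abs_of_nonneg (a := 1 - t) (by linarith [ht.2])] at h1
  · rw [h]
    rw [abs_of_nonneg (a := t - -1) (by linarith [ht.1])] at h2
    refine h2.trans_eq ?_
    ring

lemma abs_sine_zero_le (k : Fin d → ℕ) {x : E d} (hx : x ∈ Omega d) (i : Fin d) :
    |sine k 0 x| ≤ freq (k i) * (1 - |x i|) := by
  unfold sine tprod
  rw [← Finset.mul_prod_erase _ _ (Finset.mem_univ i), abs_mul, Finset.abs_prod]
  refine (mul_le_of_le_one_right (abs_nonneg _) ?_).trans (abs_trig_zero_le _ (hx i))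
  refine Finset.prod_le_one (fun _ _ => abs_nonneg _) fun j _ => ?_
  show |trig (k j) 0 (x j)| ≤ 1
  rw [trig_zero]
  exact Real.abs_sin_le_one _

lemma h10Approx_psum (a : (Fin d → ℕ) → ℝ) (F : Finset (Fin d → ℕ)) :
    H10Approx (Omega d) (psum a 0 F) fun i => psum a (0 + Pi.single i 1) F := by
  have h := h10Approx_of_vanishing (contDiff_psum a 0 F)
    (L := ∑ k ∈ F, |a k| * ∑ i, freq (k i))
    (Finset.sum_nonneg fun k _ => mul_nonneg (abs_nonneg _)
      (Finset.sum_nonneg fun i _ => (freq_pos _).le)) fun x hx i => by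
    unfold psum
    rw [Finset.sum_mul]
    refine (Finset.abs_sum_le_sum_abs _ _).trans (Finset.sum_le_sum fun k _ => ?_)
    rw [abs_mul, mul_assoc]
    refine mul_le_mul_of_nonneg_left ((abs_sine_zero_le k hx i).trans ?_) (abs_nonneg _)
    refine mul_le_mul_of_nonneg_right ?_ (sub_nonneg.2 (abs_lt.2 (hx i)).le)
    exact Finset.single_le_sum (f := fun i => freq (k i)) (fun _ _ => (freq_pos _).le)
      (Finset.mem_univ i)
  simpa only [partialDeriv_psum] using h

/-! ### Sine series as elements of H^1_0(Ω) -/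

lemma SeriesLim.hasWeakPartial_Omega {p : Fin d → ℕ} {a : (Fin d → ℕ) → ℝ} {j : Fin d}
    {f f' : E d → ℝ} (h : SeriesLim p a f) (h' : SeriesLim (p + Pi.single j 1) a f') :
    HasWeakPartial (Omega d) j f f' := by
  refine ((h.hasWeakPartial h').mono (subset_univ _)).congr isOpen_Omega ?_ ?_ <;>
  · filter_upwards [ae_restrict_mem measurableSet_Omega] with x hx
    exact rext_eq_self hx _ _

/-- The partial sums vanish linearly on the faces, hence lie in H^1_0, and they converge together
with their gradients. -/
lemma SeriesLim.memH10 {a : (Fin d → ℕ) → ℝ} {f : E d → ℝ} {G : Fin d → E d → ℝ}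
    (h : SeriesLim 0 a f) (hG : ∀ i, SeriesLim (0 + Pi.single i 1) a (G i)) :
    MemH10 (Omega d) f ∧ HasWeakGradient (Omega d) f G := by
  have h1 : HasWeakGradient (Omega d) f G := fun i => h.hasWeakPartial_Omega (hG i)
  refine ⟨⟨h.memLp, G, h1, fun i => (hG i).memLp, ?_⟩, h1⟩
  exact h10Approx_of_tendsto (l := atTop) (fun F => memLp_psum a 0 F) (fun F i => memLp_psum a _ F)
    h.memLp (fun i => (hG i).memLp) (fun F => h10Approx_psum a F) h.tendsto fun i => (hG i).tendsto

lemma memH10_sine (k : Fin d → ℕ) : MemH10 (Omega d) (sine k 0) ∧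
    HasWeakGradient (Omega d) (sine k 0) fun i => sine k (0 + Pi.single i 1) := by
  have h1 : HasWeakGradient (Omega d) (sine k 0) fun i => sine k (0 + Pi.single i 1) := fun i => by
    have := hasWeakPartial_of_contDiff (contDiff_sine k 0) (Omega d) i
    rwa [partialDeriv_sine] at this
  refine ⟨⟨memLp_sine k 0, _, h1, fun i => memLp_sine _ _, ?_⟩, h1⟩
  have h2 := h10Approx_psum (d := d) (fun _ => 1) {k}
  have e : ∀ p : Fin d → ℕ, psum (fun _ => 1) p {k} = sine k p := fun p => by
    ext x; simp [psum]
  simp only [e] at h2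
  exact h2

/-! ### Sine coefficients of functions in `H^1_0(Ω)` -/

lemma MemH10.integral_gradient_mul_sine {g : E d → ℝ} {G : Fin d → E d → ℝ}
    (hg : MemH10 (Omega d) g) (hG : HasWeakGradient (Omega d) g G) (k : Fin d → ℕ) (j : Fin d) :
    ∫ x in Omega d, G j x * sine k (0 + Pi.single j 1) x = freq (k j) ^ 2 * coef g k := by
  rw [hg.integral_mul_smooth hG (contDiff_sine _ _), partialDeriv_sine]
  simp only [sine_add_two, mul_left_comm (g _)]
  rw [integral_const_mul, neg_mul, neg_neg]
  rfl

lemma fpow_single (k : Fin d → ℕ) (j : Fin d) : fpow k (0 + Pi.single j 1) = freq (k j) := by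
  rw [fpow_add_single]
  simp [fpow]

/-- Bessel's inequality for ∂_j g against the normalised derivatives ∂_j of the sines: integration
by parts gives freq² c_k, and the norm removes one factor freq. -/
lemma MemH10.summable {g : E d → ℝ} {G : Fin d → E d → ℝ}
    (hg : MemH10 (Omega d) g) (hG : HasWeakGradient (Omega d) g G) (j : Fin d) :
    Summable fun k => (coef g k * fpow k (0 + Pi.single j 1)) ^ 2 := by
  refine (summable_integral_mul_sine ((hg.gradient isOpen_Omega hG).1 j)
    (0 + Pi.single j 1)).congr fun k => ?_
  rw [hg.integral_gradient_mul_sine hG, fpow_single]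
  have := (freq_pos (k j)).ne'
  field_simp

/-- The termwise derivative converges by Bessel to some function, which is a weak derivative of g
and so equals `G j` by uniqueness. This replaces completeness of the differentiated family. -/
lemma MemH10.seriesLim_gradient {g : E d → ℝ} {G : Fin d → E d → ℝ}
    (hg : MemH10 (Omega d) g) (hG : HasWeakGradient (Omega d) g G) (j : Fin d) :
    SeriesLim (0 + Pi.single j 1) (coef g) (G j) := by
  obtain ⟨f, hf⟩ := exists_seriesLim (hg.summable hG j)
  exact hf.congr (((seriesLim_coef hg.1).hasWeakPartial_Omega hf).unique isOpen_Omega (hG j))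

/-- The sine coefficients of Δg are -c_k `eigen k`. Two integrations by parts are made without
boundary terms, the first because the sine lies in H^1_0 and the second because g does. Bessel's
inequality concludes. -/
lemma MemH10.summable_eigen {g : E d → ℝ} {G H : Fin d → E d → ℝ}
    (hg : MemH10 (Omega d) g) (hG : HasWeakGradient (Omega d) g G)
    (hH : ∀ j, HasWeakPartial (Omega d) j (G j) (H j))
    (hH2 : ∀ j, MemLp (H j) 2 (volume.restrict (Omega d))) :
    Summable fun k => (coef g k * eigen k) ^ 2 := by
  have hsum : MemLp (fun x => ∑ j, H j x) 2 (volume.restrict (Omega d)) :=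
    memLp_finsetSum _ fun j _ => hH2 j
  refine (summable_integral_mul_sine hsum 0).congr fun k => ?_
  have h1 : ∀ j, ∫ x in Omega d, H j x * sine k 0 x = -(freq (k j) ^ 2 * coef g k) := by
    intro j
    have h2 := (memH10_sine k).1.integral_mul_weak (memH10_sine k).2 (hH j)
      ((hg.gradient isOpen_Omega hG).1 j) (hH2 j)
    rw [← hg.integral_gradient_mul_sine hG]
    simp only [mul_comm (sine _ _ _)] at h2
    rw [h2, neg_neg]
  have h3 : ∫ x in Omega d, (∑ j, H j x) * sine k 0 x = -(coef g k * eigen k) := by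
    simp only [Finset.sum_mul]
    rw [integral_finsetSum _ fun j _ => integrable_mul_of_memLp_two (hH2 j) (memLp_sine k 0)]
    simp only [h1, eigen, Finset.mul_sum, Finset.sum_neg_distrib, mul_comm]
  rw [h3]
  have : fpow k (0 : Fin d → ℕ) = 1 := by simp [fpow]
  rw [this, div_one, neg_sq]

/-! ### The Dirichlet problem -/

lemma sum_integral_psum {v : E d → ℝ} {Gv : Fin d → E d → ℝ}
    (hv : MemH10 (Omega d) v) (hGv : HasWeakGradient (Omega d) v Gv) (a : (Fin d → ℕ) → ℝ)
    (F : Finset (Fin d → ℕ)) :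
    ∑ i, ∫ x in Omega d, psum a (0 + Pi.single i 1) F x * Gv i x =
      ∫ x in Omega d, psum (fun k => a k * eigen k) 0 F x * v x := by
  have h1 : ∀ i, ∫ x in Omega d, psum a (0 + Pi.single i 1) F x * Gv i x =
      -∫ x in Omega d, psum a (0 + Pi.single i 1 + Pi.single i 1) F x * v x := by
    intro i
    have := hv.integral_mul_smooth hGv (contDiff_psum a (0 + Pi.single i 1) F) i
    rw [partialDeriv_psum] at this
    simpa only [mul_comm] using this
  simp only [h1]
  have h2 : ∀ i, IntegrableOn (fun x => psum a (0 + Pi.single i 1 + Pi.single i 1) F x * v x)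
      (Omega d) := fun i => (memLp_psum a _ F).integrable_mul hv.1
  rw [Finset.sum_neg_distrib, ← integral_finsetSum _ fun i _ => h2 i, ← integral_neg]
  refine integral_congr_ae (Eventually.of_forall fun x => ?_)
  simp only
  rw [← Finset.sum_mul, sum_psum_add_two]
  ring

lemma eigen_mul_cancel (hd : 0 < d) (c : (Fin d → ℕ) → ℝ) :
    (fun k => c k / eigen k * eigen k) = c := by
  ext k
  exact div_mul_cancel₀ _ (one_pos.trans_le (one_le_eigen hd k)).ne'

/-- For partial sums the weak equation is an exact integration by parts against `v`; both sides then
converge in L². -/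
lemma isDirichletSolution_of_seriesLim (hd : 0 < d) {g u : E d → ℝ} {G : Fin d → E d → ℝ}
    (hg : MemLp g 2 (volume.restrict (Omega d)))
    (hu : SeriesLim 0 (fun k => coef g k / eigen k) u)
    (hG : ∀ i, SeriesLim (0 + Pi.single i 1) (fun k => coef g k / eigen k) (G i)) :
    IsDirichletSolution g u := by
  obtain ⟨h1, h2⟩ := hu.memH10 hG
  refine ⟨h1, G, h2, fun v Gv hv hGv => ?_⟩
  have hGv2 := (hv.gradient isOpen_Omega hGv).1
  have l1 := tendsto_finsetSum (Finset.univ : Finset (Fin d)) fun i _ =>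
    (hG i).tendsto.integral_mul (fun F => memLp_psum _ _ F) (hG i).memLp (hGv2 i)
  have l2 := (seriesLim_coef hg).tendsto.integral_mul (fun F => memLp_psum _ _ F) hg hv.1
  simp only [sum_integral_psum hv hGv, eigen_mul_cancel hd] at l1
  rw [integral_finsetSum _ fun i _ => integrable_mul_of_memLp_two (hG i).memLp (hGv2 i)]
  exact tendsto_nhds_unique l1 l2

/-- Testing with the sine of index `k` gives eigen k · coef u k = coef g k. All coefficients are
thus determined, which is uniqueness. -/
lemma IsDirichletSolution.seriesLim (hd : 0 < d) {g u : E d → ℝ} (hu : IsDirichletSolution g u) :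
    SeriesLim 0 (fun k => coef g k / eigen k) u := by
  obtain ⟨h1, Gu, h2, h3⟩ := hu
  have e : coef u = fun k => coef g k / eigen k := by
    ext k
    have h4 := h3 _ _ (memH10_sine k).1 (memH10_sine k).2
    have hG2 := (h1.gradient isOpen_Omega h2).1
    rw [integral_finsetSum _ fun i _ => integrable_mul_of_memLp_two (hG2 i) (memLp_sine k _)] at h4
    simp only [h1.integral_gradient_mul_sine h2, ← Finset.sum_mul] at h4
    rw [eq_div_iff (one_pos.trans_le (one_le_eigen hd k)).ne', mul_comm]
    exact h4
  rw [← e]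
  exact seriesLim_coef h1.1

/-! ### A Hardy inequality for tangential derivatives -/

lemma sq_lintegral_le {α : Type*} {m : MeasurableSpace α} (μ : Measure α) {h : α → ℝ≥0∞}
    (hh : AEMeasurable h μ) : (∫⁻ x, h x ∂μ) ^ 2 ≤ μ univ * ∫⁻ x, h x ^ 2 ∂μ := by
  have h1 := ENNReal.lintegral_mul_le_Lp_mul_Lq μ (p := 2) (q := 2)
    (Real.holderConjugate_iff.2 ⟨by norm_num, by norm_num⟩)
    (aemeasurable_const (b := (1 : ℝ≥0∞))) hh
  have h2 := pow_le_pow_left₀ zero_le h1 2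
  simp only [Pi.mul_apply, one_mul, ENNReal.one_rpow, lintegral_const, mul_pow] at h2
  rw [← ENNReal.rpow_natCast, ← ENNReal.rpow_natCast, ← ENNReal.rpow_natCast,
    ← ENNReal.rpow_mul, ← ENNReal.rpow_mul] at h2
  simpa using h2

/-- The integrand of the Gagliardo–Slobodeckij seminorm. -/
noncomputable def gker (σ : ℝ) (f : E d → ℝ) (x y : E d) : ℝ≥0∞ :=
  ENNReal.ofReal ((f x - f y) ^ 2 / ‖x - y‖ ^ ((d : ℝ) + 2 * σ))

lemma aemeasurable_gker (σ : ℝ) {f : E d → ℝ} {μ : Measure (E d)} (hf : AEMeasurable f μ)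
    (x : E d) : AEMeasurable (gker σ f x) μ := by
  unfold gker
  refine (((aemeasurable_const.sub hf).pow_const 2).div ?_).ennreal_ofReal
  exact Measurable.aemeasurable (by fun_prop)

/-- At distance at most `R` the singular denominator is at most R^(d+2σ). On the diagonal both sides
vanish. -/
lemma enorm_sub_sq_le_gker {σ : ℝ} (hσ : 0 < σ) (f : E d → ℝ) {x y : E d} {R : ℝ}
    (hxy : ‖x - y‖ ≤ R) :
    ‖f x - f y‖ₑ ^ 2 ≤ ENNReal.ofReal (R ^ ((d : ℝ) + 2 * σ)) * gker σ f x y := by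
  have hP : 0 < (d : ℝ) + 2 * σ := by positivity
  unfold gker
  have hR : 0 ≤ R := (norm_nonneg _).trans hxy
  rw [Real.enorm_eq_ofReal_abs, ← ENNReal.ofReal_pow (abs_nonneg _), sq_abs,
    ← ENNReal.ofReal_mul (by positivity)]
  refine ENNReal.ofReal_le_ofReal ?_
  by_cases h : x = y
  · subst h; simp
  · have h0 : 0 < ‖x - y‖ := norm_pos_iff.2 (sub_ne_zero.2 h)
    rw [mul_div_assoc', le_div_iff₀ (Real.rpow_pos_of_pos h0 _), mul_comm]
    exact mul_le_mul_of_nonneg_right (Real.rpow_le_rpow h0.le hxy hP.le) (sq_nonneg _)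

/-! ### A kernel adapted to a face of the cube -/

/-- The one-dimensional profile that is `1` on `(-∞, 0]` and `0` on `[1, ∞)`. -/
noncomputable def ramp (t : ℝ) : ℝ := Real.smoothTransition (1 - t)

lemma contDiff_ramp : ContDiff ℝ ∞ ramp := by
  unfold ramp
  exact contDiff_smoothTransition.comp (by fun_prop)

lemma abs_ramp_le (t : ℝ) : |ramp t| ≤ 1 := by
  unfold ramp
  rw [abs_of_nonneg (Real.smoothTransition.nonneg _)]
  exact Real.smoothTransition.le_one _

lemma tsupport_ramp : tsupport ramp ⊆ Iic 1 := by
  refine closure_minimal (fun t ht => ?_) isClosed_Iic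
  by_contra! h
  exact ht (Real.smoothTransition.zero_of_nonpos (by linarith [not_le.1 (show ¬ t ≤ 1 from h)]))

lemma exists_deriv_ramp_bound : ∃ C : ℝ, 0 ≤ C ∧ ∀ t, |deriv ramp t| ≤ C := by
  obtain ⟨C, hC0, hC⟩ := exists_deriv_smoothTransition_bound
  refine ⟨C, hC0, fun t => ?_⟩
  have h1 : HasDerivAt (fun t : ℝ => 1 - t) (-1) t := by
    simpa using (hasDerivAt_id t).const_sub 1
  have h2 := ((contDiff_smoothTransition.differentiable (by simp)) (1 - t)).hasDerivAt.comp t h1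
  have h3 : deriv ramp t = _ := h2.deriv
  rw [h3, mul_neg_one, abs_neg]
  exact hC _

lemma tsupport_cutoff_two : tsupport (cutoff 2) ⊆ Icc (-1) 1 := by
  refine closure_minimal (fun t ht => ?_) isClosed_Icc
  by_contra h
  refine ht (cutoff_eq_zero ?_)
  have : 1 < |t| := by
    by_contra! h'
    exact h (abs_le.1 h')
  push_cast
  linarith

lemma integral_cutoff_two_pos : 0 < ∫ t, cutoff 2 t := by
  have hc : Continuous (cutoff 2) := (contDiff_cutoff 2).continuous
  refine hc.integral_pos_of_hasCompactSupport_nonneg_nonzero (x := 0) ?_ (fun t => ?_) ?_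
  · exact (isCompact_Icc (a := (-1 : ℝ)) (b := 1)).of_isClosed_subset (isClosed_tsupport _)
      tsupport_cutoff_two
  · exact mul_nonneg (Real.smoothTransition.nonneg _) (Real.smoothTransition.nonneg _)
  · rw [cutoff_eq_one (by norm_num)]; exact one_ne_zero

lemma integral_cutoff_comp {c r : ℝ} (hr : 0 < r) (h1 : -1 < c - r) (h2 : c + r < 1) :
    ∫ t in Ioo (-1 : ℝ) 1, cutoff 2 ((t - c) / r) = r * ∫ t, cutoff 2 t := by
  rw [setIntegral_eq_integral_of_forall_compl_eq_zero]
  · rw [integral_sub_right_eq_self (fun t => cutoff 2 (t / r)) c, Measure.integral_comp_div,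
      abs_of_pos hr, smul_eq_mul]
  · intro t ht
    by_contra hne
    have h3 := tsupport_cutoff_two (subset_tsupport _ hne)
    rw [mem_Icc, le_div_iff₀ hr, div_le_iff₀ hr] at h3
    exact ht ⟨by linarith [h3.1], by linarith [h3.2]⟩

/-- The factors of the kernel used in the Hardy inequality near the face `x_i = e`. -/
noncomputable def hardyFactor (i : Fin d) (e : ℝ) (x : E d) (l : Fin d) (t : ℝ) : ℝ :=
  if l = i then ramp ((1 - e * t) / (1 - e * x i))
  else cutoff 2 ((t - (1 - (1 - e * x i) / 2) * x l) / ((1 - e * x i) / 2))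

lemma contDiff_hardyFactor (i : Fin d) (e : ℝ) (x : E d) (l : Fin d) :
    ContDiff ℝ ∞ (hardyFactor i e x l) := by
  unfold hardyFactor
  split_ifs
  · exact contDiff_ramp.comp (by fun_prop)
  · exact (contDiff_cutoff 2).comp (by fun_prop)

lemma abs_hardyFactor_le (i : Fin d) (e : ℝ) (x : E d) (l : Fin d) (t : ℝ) :
    |hardyFactor i e x l t| ≤ 1 := by
  unfold hardyFactor
  split_ifs
  · exact abs_ramp_le _
  · exact abs_cutoff_le _ _

lemma deriv_comp_affine (f : ℝ → ℝ) (hf : ContDiff ℝ ∞ f) (a b t : ℝ) :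
    deriv (fun t => f (a * t + b)) t = a * deriv f (a * t + b) := by
  have h1 : HasDerivAt (fun t : ℝ => a * t + b) a t := by
    simpa using ((hasDerivAt_id t).const_mul a).add_const b
  have h2 := ((hf.differentiable (by simp)) (a * t + b)).hasDerivAt.comp t h1
  rw [mul_comm]
  exact h2.deriv

lemma exists_deriv_hardyFactor_bound : ∃ M : ℝ, 0 < M ∧ ∀ (d : ℕ) (i : Fin d) (e : ℝ) (x : E d)
    (l : Fin d) (t : ℝ), |e| = 1 → 0 < 1 - e * x i →
      |deriv (hardyFactor i e x l) t| ≤ M / (1 - e * x i) := by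
  obtain ⟨C1, h10, h1⟩ := exists_deriv_ramp_bound
  obtain ⟨C2, h20, h2⟩ := exists_deriv_cutoff_bound
  -- The bump contributes 2/y from its radius y/2 and 2 C2 from the bound for `cutoff 2`; the final
  -- 1 makes the constant positive. Here y = 1 - e x_i.
  refine ⟨C1 + 4 * C2 + 1, by positivity, fun d i e x l t he hy => ?_⟩
  unfold hardyFactor
  split_ifs with hl
  · have e1 : (fun t => ramp ((1 - e * t) / (1 - e * x i))) =
        fun t => ramp (-e / (1 - e * x i) * t + 1 / (1 - e * x i)) := by
      ext t; congr 1; field_simp; ring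
    simp only [e1]
    rw [deriv_comp_affine _ contDiff_ramp, abs_mul, abs_div, abs_neg, he, abs_of_pos hy,
      div_mul_eq_mul_div, one_mul]
    gcongr
    linarith [h1 (-e / (1 - e * x i) * t + 1 / (1 - e * x i))]
  · have e1 : (fun t => cutoff 2 ((t - (1 - (1 - e * x i) / 2) * x l) / ((1 - e * x i) / 2))) =
        fun t => cutoff 2 (2 / (1 - e * x i) * t +
          -((1 - (1 - e * x i) / 2) * x l) * (2 / (1 - e * x i))) := by
      ext t; congr 1; field_simp; ring
    simp only [e1]
    rw [deriv_comp_affine _ (contDiff_cutoff 2), abs_mul, abs_div, abs_of_pos hy,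
      abs_of_pos (by norm_num : (0 : ℝ) < 2), div_mul_eq_mul_div]
    gcongr
    have := h2 2 (2 / (1 - e * x i) * t + -((1 - (1 - e * x i) / 2) * x l) * (2 / (1 - e * x i)))
    push_cast at this
    linarith

lemma hardyFactor_tsupport {i : Fin d} {e : ℝ} {x : E d} (he : |e| = 1) (hx : x ∈ Omega d)
    (hy : 0 < 1 - e * x i) {l : Fin d} {t : ℝ} (ht : t ∈ tsupport (hardyFactor i e x l))
    (ht1 : t ∈ Ioo (-1 : ℝ) 1) : |x l - t| ≤ 1 - e * x i := by
  have hsub : tsupport (hardyFactor i e x l) ⊆ if l = i then {t | 1 - e * t ≤ 1 - e * x i} else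
      {t | |t - (1 - (1 - e * x i) / 2) * x l| ≤ (1 - e * x i) / 2} := by
    split_ifs with hl
    · refine closure_minimal (fun s hs => ?_) (isClosed_le (by fun_prop) (by fun_prop))
      simp only [hardyFactor, hl, if_true, Function.mem_support] at hs
      have := tsupport_ramp (subset_tsupport _ hs)
      rw [mem_Iic, div_le_one hy] at this
      exact this
    · refine closure_minimal (fun s hs => ?_) (isClosed_le (by fun_prop) (by fun_prop))
      simp only [hardyFactor, hl, if_false, Function.mem_support] at hs
      have := tsupport_cutoff_two (subset_tsupport _ hs)
      rw [mem_Icc, ← abs_le, abs_div, abs_of_pos (half_pos hy), div_le_one (half_pos hy)] at this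
      exact this
  have h := hsub ht
  split_ifs at h with hl
  · subst hl
    have h' : 1 - e * t ≤ 1 - e * x l := h
    have he2 : e * e = 1 := by rw [← abs_mul_abs_self, he]; norm_num
    have h1 : |x l - t| = |e * x l - e * t| := by rw [← mul_sub, abs_mul, he, one_mul]
    have h2 : e * t < 1 := (le_abs_self _).trans_lt (by rw [abs_mul, he, one_mul]; exact abs_lt.2 ht1)
    rw [h1, abs_le]
    constructor <;> linarith
  · have h1 : |t - (1 - (1 - e * x i) / 2) * x l| ≤ (1 - e * x i) / 2 := h
    have h2 : |x l| ≤ 1 := (abs_lt.2 (hx l)).le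
    have h3 : x l - t = -(t - (1 - (1 - e * x i) / 2) * x l) + (1 - e * x i) / 2 * x l := by ring
    rw [h3]
    refine (abs_add_le _ _).trans ?_
    rw [abs_neg, abs_mul, abs_of_pos (half_pos hy)]
    have := mul_le_of_le_one_right (half_pos hy).le h2
    linarith

lemma face_bounds {e : ℝ} (he : |e| = 1) {t : ℝ} (ht : t ∈ Ioo (-1 : ℝ) 1) :
    0 < 1 - e * t ∧ 1 - e * t < 2 := by
  have := abs_lt.1 (show |e * t| < 1 by rw [abs_mul, he, one_mul]; exact abs_lt.2 ht)
  constructor <;> linarith [this.1, this.2]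

/-- The centre of the bump is pulled inward to (1 - y/2) x_l, with y = 1 - e x_i, precisely so that
an interval of radius y/2 around it stays strictly inside (-1, 1). -/
lemma hardyFactor_endpoints {i : Fin d} {e : ℝ} (he : |e| = 1) {x : E d} (hx : x ∈ Omega d)
    {l : Fin d} (hl : l ≠ i) : hardyFactor i e x l 1 = 0 ∧ hardyFactor i e x l (-1) = 0 := by
  obtain ⟨hy, hy2⟩ := face_bounds he (hx i)
  have h2 := abs_lt.2 (hx l)
  unfold hardyFactor
  simp only [hl, if_false]
  have h3 : |(1 - (1 - e * x i) / 2) * x l| < 1 - (1 - e * x i) / 2 := by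
    rw [abs_mul, abs_of_pos (by linarith)]
    exact mul_lt_of_lt_one_right (by linarith) h2
  have h4 := abs_lt.1 h3
  constructor <;>
  · by_contra hne
    have := tsupport_cutoff_two (subset_tsupport _ hne)
    rw [mem_Icc, le_div_iff₀ (half_pos hy), div_le_iff₀ (half_pos hy)] at this
    linarith [this.1, this.2]

lemma integral_deriv_Ioo {f : ℝ → ℝ} (hf : ContDiff ℝ ∞ f) :
    ∫ t in Ioo (-1 : ℝ) 1, deriv f t = f 1 - f (-1) := by
  rw [← integral_Ioc_eq_integral_Ioo, ← intervalIntegral.integral_of_le (by norm_num)]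
  refine intervalIntegral.integral_deriv_eq_sub
    (fun t _ => (hf.differentiable (by simp)) t) ?_
  exact (hf.continuous_deriv (by simp)).intervalIntegrable _ _

lemma partialDeriv_tprod_deriv {f : Fin d → ℝ → ℝ} (hf : ∀ l, ContDiff ℝ ∞ (f l)) (j : Fin d) :
    partialDeriv j (tprod f) = tprod (Function.update f j (deriv (f j))) := by
  ext x
  exact partialDeriv_tprod (fun l => (hf l).differentiable (by simp))
    ((hf j).differentiable (by simp) _).hasDerivAt

lemma tprod_update (f : Fin d → ℝ → ℝ) (j : Fin d) (f' : ℝ → ℝ) (x : E d) :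
    tprod (Function.update f j f') x = f' (x j) * ∏ l ∈ Finset.univ.erase j, f l (x l) := by
  unfold tprod
  rw [← Finset.mul_prod_erase _ _ (Finset.mem_univ j)]
  congr 1
  · simp
  · refine Finset.prod_congr rfl fun i hi => ?_
    simp [(Finset.ne_of_mem_erase hi)]

/-- The kernel used in the Hardy inequality near the face `x_i = e`. -/
noncomputable def hardyKer (i : Fin d) (e : ℝ) (x : E d) : E d → ℝ := tprod (hardyFactor i e x)

lemma contDiff_hardyKer (i : Fin d) (e : ℝ) (x : E d) : ContDiff ℝ ∞ (hardyKer i e x) :=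
  contDiff_tprod (contDiff_hardyFactor i e x)

/-- The factor in direction `j` vanishes at both endpoints, so its derivative has integral zero. -/
lemma integral_partialDeriv_hardyKer_of_ne {i j : Fin d} (hij : j ≠ i) {e : ℝ} (he : |e| = 1)
    {x : E d} (hx : x ∈ Omega d) :
    ∫ z in Omega d, partialDeriv j (hardyKer i e x) z = 0 := by
  unfold hardyKer
  rw [partialDeriv_tprod_deriv (contDiff_hardyFactor i e x)]
  refine (setIntegral_box_tprod _ _ _).trans (Finset.prod_eq_zero (Finset.mem_univ j) ?_)
  rw [Function.update_self, integral_deriv_Ioo (contDiff_hardyFactor i e x j),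
    (hardyFactor_endpoints he hx hij).1, (hardyFactor_endpoints he hx hij).2, sub_zero]

/-- The factor in direction `i` is 1 on the face x_i = e and 0 on the opposite one, because the
distance 1 - e x_i is less than 2. Each of the d - 1 other factors integrates to a rescaled bump. -/
lemma integral_partialDeriv_hardyKer {i : Fin d} {e : ℝ} (he : e = 1 ∨ e = -1)
    {x : E d} (hx : x ∈ Omega d) :
    |∫ z in Omega d, partialDeriv i (hardyKer i e x) z| =
      ((1 - e * x i) / 2 * ∫ t, cutoff 2 t) ^ (d - 1) := by
  have he' : |e| = 1 := by rcases he with h | h <;> simp [h]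
  obtain ⟨hy, hy2⟩ := face_bounds he' (hx i)
  unfold hardyKer
  rw [partialDeriv_tprod_deriv (contDiff_hardyFactor i e x)]
  have h0 := setIntegral_box_tprod
    (Function.update (hardyFactor i e x) i (deriv (hardyFactor i e x i))) (-1) 1
  refine (congrArg abs h0).trans ?_
  rw [← Finset.mul_prod_erase _ _ (Finset.mem_univ i), Function.update_self,
    integral_deriv_Ioo (contDiff_hardyFactor i e x i), abs_mul]
  have h1 : |hardyFactor i e x i 1 - hardyFactor i e x i (-1)| = 1 := by
    have r0 : ramp 0 = 1 := Real.smoothTransition.one_of_one_le (by norm_num)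
    have r2 : ramp (2 / (1 - e * x i)) = 0 := by
      refine Real.smoothTransition.zero_of_nonpos ?_
      rw [sub_nonpos, le_div_iff₀ hy]; linarith
    unfold hardyFactor
    simp only [if_true]
    rcases he with rfl | rfl
    · rw [show (1 - 1 * (1 : ℝ)) / (1 - 1 * x i) = 0 by simp,
        show (1 - 1 * (-1 : ℝ)) / (1 - 1 * x i) = 2 / (1 - 1 * x i) by norm_num, r0, r2]
      norm_num
    · rw [show (1 - -1 * (-1 : ℝ)) / (1 - -1 * x i) = 0 by simp,
        show (1 - -1 * (1 : ℝ)) / (1 - -1 * x i) = 2 / (1 - -1 * x i) by norm_num, r0, r2]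
      norm_num
  rw [h1, one_mul]
  have h2 : ∀ l ∈ Finset.univ.erase i, ∫ t in Ioo (-1 : ℝ) 1,
      Function.update (hardyFactor i e x) i (deriv (hardyFactor i e x i)) l t =
      (1 - e * x i) / 2 * ∫ t, cutoff 2 t := by
    intro l hl
    have hl' := Finset.ne_of_mem_erase hl
    rw [Function.update_of_ne hl']
    unfold hardyFactor
    simp only [hl', if_false]
    have h4 := abs_lt.1 (show |(1 - (1 - e * x i) / 2) * x l| < 1 - (1 - e * x i) / 2 by
      rw [abs_mul, abs_of_pos (by linarith)]
      exact mul_lt_of_lt_one_right (by linarith) (abs_lt.2 (hx l)))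
    exact integral_cutoff_comp (half_pos hy) (by linarith) (by linarith)
  rw [Finset.prod_congr rfl h2, Finset.prod_const, Finset.card_erase_of_mem (Finset.mem_univ i),
    Finset.card_univ, Fintype.card_fin, abs_of_nonneg]
  exact pow_nonneg (mul_nonneg (half_pos hy).le integral_cutoff_two_pos.le) _

lemma abs_partialDeriv_hardyKer_le {M : ℝ} {i : Fin d} {e : ℝ} {x : E d}
    (hM : ∀ (l : Fin d) (t : ℝ),
      |deriv (hardyFactor i e x l) t| ≤ M / (1 - e * x i)) (j : Fin d) (z : E d) :
    |partialDeriv j (hardyKer i e x) z| ≤ M / (1 - e * x i) := by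
  unfold hardyKer
  rw [partialDeriv_tprod_deriv (contDiff_hardyFactor i e x), tprod_update, abs_mul,
    Finset.abs_prod]
  refine (mul_le_of_le_one_right (abs_nonneg _) ?_).trans (hM j _)
  exact Finset.prod_le_one (fun _ _ => abs_nonneg _) fun l _ => abs_hardyFactor_le i e x l _

lemma partialDeriv_hardyKer_eq_zero {i : Fin d} {e : ℝ} (he : |e| = 1) {x : E d}
    (hx : x ∈ Omega d) (j : Fin d) {z : E d} (hz : z ∈ Omega d)
    (hzx : √d * (1 - e * x i) < ‖x - z‖) : partialDeriv j (hardyKer i e x) z = 0 := by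
  obtain ⟨hy, hy2⟩ := face_bounds he (hx i)
  by_contra hne
  have hmem : ∀ l, z l ∈ tsupport (hardyFactor i e x l) := by
    intro l
    unfold hardyKer at hne
    rw [partialDeriv_tprod_deriv (contDiff_hardyFactor i e x), tprod_update] at hne
    by_cases hl : l = j
    · subst hl
      exact support_deriv_subset (left_ne_zero_of_mul hne)
    · have := Finset.prod_ne_zero_iff.1 (right_ne_zero_of_mul hne) l
        (Finset.mem_erase.2 ⟨hl, Finset.mem_univ l⟩)
      exact subset_tsupport _ this
  have h1 : ‖x - z‖ ≤ √d * (1 - e * x i) := by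
    rw [EuclideanSpace.norm_eq]
    refine (Real.sqrt_le_sqrt (Finset.sum_le_sum (g := fun _ => (1 - e * x i) ^ 2)
      fun l _ => ?_)).trans_eq ?_
    · have := hardyFactor_tsupport he hx hy (hmem l) (hz l)
      simp only [PiLp.sub_apply, Real.norm_eq_abs]
      gcongr
    · rw [Finset.sum_const, Finset.card_univ, Fintype.card_fin, nsmul_eq_mul,
        Real.sqrt_mul (by positivity), Real.sqrt_sq hy.le]
  exact absurd h1 (not_le.2 hzx)

/-- The two mixed derivatives of the kernel annihilate gradients of functions in `H^1_0(Ω)`. -/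
lemma MemH10.integral_cross {g : E d → ℝ} {G : Fin d → E d → ℝ}
    (hg : MemH10 (Omega d) g) (hG : HasWeakGradient (Omega d) g G) {f : Fin d → ℝ → ℝ}
    (hf : ∀ l, ContDiff ℝ ∞ (f l)) {i j : Fin d} (hij : j ≠ i) :
    ∫ z in Omega d, G j z * partialDeriv i (tprod f) z =
      ∫ z in Omega d, G i z * partialDeriv j (tprod f) z := by
  have hs := contDiff_tprod hf
  rw [hg.integral_mul_smooth hG (contDiff_partialDeriv hs i),
    hg.integral_mul_smooth hG (contDiff_partialDeriv hs j)]
  have hu : ∀ l m, ContDiff ℝ ∞ (Function.update f l (deriv (f l)) m) := by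
    intro l m
    by_cases h : m = l
    · subst h
      rw [Function.update_self]
      exact ((contDiff_infty_iff_deriv.1 (hf m)).2)
    · rw [Function.update_of_ne h]; exact hf m
  have e : partialDeriv j (partialDeriv i (tprod f)) = partialDeriv i (partialDeriv j (tprod f)) := by
    rw [partialDeriv_tprod_deriv hf, partialDeriv_tprod_deriv hf, partialDeriv_tprod_deriv (hu i),
      partialDeriv_tprod_deriv (hu j), Function.update_of_ne hij, Function.update_of_ne hij.symm,
      Function.update_comm hij]
  rw [e]

/-- Let y be the distance from x to the face x_i = e and Φ the kernel at scale y. Since ∫ ∂_j Φ = 0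
and ∫ G_j ∂_i Φ = ∫ G_i ∂_j Φ, the value G_j(x) ∫ ∂_i Φ is an integral of increments of G_j and G_i
over a ball of radius comparable to y. Cauchy–Schwarz then bounds it by the inner Gagliardo
integrals at x. -/
lemma MemH10.hardy_pointwise {g : E d → ℝ} {G : Fin d → E d → ℝ}
    (hg : MemH10 (Omega d) g) (hG : HasWeakGradient (Omega d) g G) {σ : ℝ} (hσ : 0 < σ)
    {i j : Fin d} (hij : j ≠ i) {e : ℝ} (he : e = 1 ∨ e = -1) :
    ∃ C : ℝ≥0∞, C ≠ ⊤ ∧ ∀ x ∈ Omega d,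
      ‖G j x‖ₑ ^ 2 * ENNReal.ofReal ((1 - e * x i) ^ (-(2 * σ))) ≤
        C * ((∫⁻ z in Omega d, gker σ (G j) x z) + ∫⁻ z in Omega d, gker σ (G i) x z) := by
  have he' : |e| = 1 := by rcases he with h | h <;> simp [h]
  obtain ⟨M, hM0, hM⟩ := exists_deriv_hardyFactor_bound
  set A := ∫ t, cutoff 2 t
  have hA : 0 < A := integral_cutoff_two_pos
  set V := (volume (Metric.ball (0 : E d) 1)).toReal
  have hV0 : 0 ≤ V := ENNReal.toReal_nonneg
  have hVe : volume (Metric.ball (0 : E d) 1) = ENNReal.ofReal V :=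
    (ENNReal.ofReal_toReal (measure_ball_lt_top).ne).symm
  set P := (d : ℝ) + 2 * σ with hP
  have hG2 := (hg.gradient isOpen_Omega hG).1
  have hd : 0 < d := i.pos
  -- M/y bounds the derivatives of the kernel, √d y is the radius of the ball containing their
  -- support in Ω, V is the volume of the unit ball, and (A y/2)^(d-1) is the size of ∫ ∂_i Φ. The
  -- bare 2 comes from (a+b)² ≤ 2(a²+b²).
  refine ⟨ENNReal.ofReal (M ^ 2 * (√d ^ d * V) * 2 * √d ^ P / ((A / 2) ^ (d - 1)) ^ 2),
    ENNReal.ofReal_ne_top, fun x hx => ?_⟩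
  obtain ⟨hy, hy2⟩ := face_bounds he' (hx i)
  set y := 1 - e * x i with hydef
  set R := √d * y with hR
  have hR0 : 0 ≤ R := by positivity
  have hMx : ∀ (l : Fin d) (t : ℝ), |deriv (hardyFactor i e x l) t| ≤ M / y :=
    fun l t => hM d i e x l t he' hy
  set Φi := partialDeriv i (hardyKer i e x) with hΦi
  set Φj := partialDeriv j (hardyKer i e x) with hΦj
  have hΦic : Continuous Φi := (contDiff_partialDeriv (contDiff_hardyKer i e x) i).continuous
  have hΦjc : Continuous Φj := (contDiff_partialDeriv (contDiff_hardyKer i e x) j).continuous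
  have mi := memLp_of_continuous isBounded_Omega hΦic 2
  have mj := memLp_of_continuous isBounded_Omega hΦjc 2
  have hfin := isFiniteMeasure_restrict (isBounded_Omega (d := d))
  have ii : IntegrableOn Φi (Omega d) := mi.integrable (by norm_num)
  have ij : IntegrableOn Φj (Omega d) := mj.integrable (by norm_num)
  have hcross : ∫ z in Omega d, G j z * Φi z = ∫ z in Omega d, G i z * Φj z :=
    hg.integral_cross hG (contDiff_hardyFactor i e x) hij
  have hrep : G j x * ∫ z in Omega d, Φi z =
      ∫ z in Omega d, ((G j x - G j z) * Φi z - (G i x - G i z) * Φj z) := by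
    have e1 : ∀ z, (G j x - G j z) * Φi z - (G i x - G i z) * Φj z =
      (G j x * Φi z - G j z * Φi z) - (G i x * Φj z - G i z * Φj z) := fun z => by ring
    simp only [e1]
    have k1 := integrable_mul_of_memLp_two (hG2 j) mi
    have k2 := integrable_mul_of_memLp_two (hG2 i) mj
    have k3 : Integrable (fun z => G j x * Φi z) (volume.restrict (Omega d)) := ii.const_mul _
    have k4 : Integrable (fun z => G i x * Φj z) (volume.restrict (Omega d)) := ij.const_mul _
    have k5 : Integrable (fun z => G j x * Φi z - G j z * Φi z) (volume.restrict (Omega d)) :=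
      k3.sub k1
    have k6 : Integrable (fun z => G i x * Φj z - G i z * Φj z) (volume.restrict (Omega d)) :=
      k4.sub k2
    rw [integral_sub k5 k6, integral_sub k3 k1, integral_sub k4 k2, hcross,
      integral_const_mul, integral_const_mul,
      show ∫ z in Omega d, Φj z = 0 from integral_partialDeriv_hardyKer_of_ne hij he' hx]
    ring
  set B := Metric.closedBall x R
  set h : E d → ℝ≥0∞ := fun z => ‖G j x - G j z‖ₑ + ‖G i x - G i z‖ₑ with hh
  have hhm : AEMeasurable h (volume.restrict (Omega d)) :=
    (aestronglyMeasurable_const.sub (hG2 j).1).enorm.add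
      (aestronglyMeasurable_const.sub (hG2 i).1).enorm
  have hB : MeasurableSet B := Metric.isClosed_closedBall.measurableSet
  have step1 : ‖G j x‖ₑ * ENNReal.ofReal ((y / 2 * A) ^ (d - 1)) ≤
      ENNReal.ofReal (M / y) * ∫⁻ z in B ∩ Omega d, h z := by
    have e1 : ‖G j x‖ₑ * ENNReal.ofReal ((y / 2 * A) ^ (d - 1)) =
        ‖G j x * ∫ z in Omega d, Φi z‖ₑ := by
      rw [enorm_mul, Real.enorm_eq_ofReal_abs (∫ z in Omega d, Φi z),
        integral_partialDeriv_hardyKer he hx]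
    rw [e1, hrep, ← Measure.restrict_restrict hB, ← lintegral_indicator hB,
      ← lintegral_const_mul' _ _ ENNReal.ofReal_ne_top]
    refine (enorm_integral_le_lintegral_enorm _).trans (lintegral_mono_ae ?_)
    filter_upwards [ae_restrict_mem measurableSet_Omega] with z hz
    by_cases hzB : z ∈ B
    · rw [indicator_of_mem hzB, hh, mul_add]
      refine (enorm_sub_le).trans (add_le_add ?_ ?_) <;>
      · rw [enorm_mul, mul_comm]
        gcongr
        rw [Real.enorm_eq_ofReal_abs]
        exact ENNReal.ofReal_le_ofReal (abs_partialDeriv_hardyKer_le hMx _ z)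
    · have hlt : R < ‖x - z‖ := by
        rw [norm_sub_rev, ← dist_eq_norm]; exact not_le.1 hzB
      rw [show Φi z = 0 from partialDeriv_hardyKer_eq_zero he' hx i hz hlt,
        show Φj z = 0 from partialDeriv_hardyKer_eq_zero he' hx j hz hlt]
      simp
  have step2 : (∫⁻ z in B ∩ Omega d, h z) ^ 2 ≤ ENNReal.ofReal (R ^ d * V * (2 * R ^ P)) *
      ((∫⁻ z in Omega d, gker σ (G j) x z) + ∫⁻ z in Omega d, gker σ (G i) x z) := by
    refine (sq_lintegral_le _ (hhm.mono_measure
      (Measure.restrict_mono inter_subset_right le_rfl))).trans ?_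
    rw [ENNReal.ofReal_mul (by positivity), mul_assoc]
    refine mul_le_mul' ?_ ?_
    · rw [Measure.restrict_apply_univ]
      refine (measure_mono inter_subset_left).trans ?_
      rw [Measure.addHaar_closedBall volume x hR0, hVe, ← ENNReal.ofReal_mul (by positivity)]
      simp
    · have l1 : ∫⁻ z in B ∩ Omega d, h z ^ 2 ≤ ∫⁻ z in B ∩ Omega d,
          ENNReal.ofReal (2 * R ^ P) * (gker σ (G j) x z + gker σ (G i) x z) := by
        refine setLIntegral_mono_ae' (hB.inter measurableSet_Omega) ?_
        filter_upwards with z hz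
        have hzR : ‖x - z‖ ≤ R := by
          rw [norm_sub_rev, ← dist_eq_norm]; exact hz.1
        have b1 := enorm_sub_sq_le_gker hσ (G j) hzR
        have b2 := enorm_sub_sq_le_gker hσ (G i) hzR
        have b3 : h z ^ 2 ≤ 2 * (‖G j x - G j z‖ₑ ^ 2 + ‖G i x - G i z‖ₑ ^ 2) := by
          have := ENNReal.rpow_add_le_mul_rpow_add_rpow ‖G j x - G j z‖ₑ ‖G i x - G i z‖ₑ
            (p := 2) (by norm_num)
          norm_num at this
          exact this
        refine b3.trans ?_
        rw [ENNReal.ofReal_mul (by norm_num), ENNReal.ofReal_ofNat, mul_assoc, mul_add (ENNReal.ofReal _)]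
        exact mul_le_mul' le_rfl (add_le_add b1 b2)
      refine l1.trans ?_
      rw [lintegral_const_mul' _ _ ENNReal.ofReal_ne_top]
      refine mul_le_mul' le_rfl ((lintegral_mono_set inter_subset_right).trans_eq ?_)
      exact lintegral_add_left' (aemeasurable_gker σ (hG2 j).1.aemeasurable x) _
  have step3 := pow_le_pow_left₀ zero_le step1 2
  rw [mul_pow ‖G j x‖ₑ, mul_pow (ENNReal.ofReal (M / y)), ← ENNReal.ofReal_pow (by positivity),
    ← ENNReal.ofReal_pow (by positivity)] at step3
  set I := (∫⁻ z in Omega d, gker σ (G j) x z) + ∫⁻ z in Omega d, gker σ (G i) x z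
  set a := ((y / 2 * A) ^ (d - 1)) ^ 2 with ha
  have ha0 : 0 < a := by positivity
  have hyσ : 0 < y ^ (-(2 * σ)) := Real.rpow_pos_of_pos hy _
  calc ‖G j x‖ₑ ^ 2 * ENNReal.ofReal (y ^ (-(2 * σ)))
      = ‖G j x‖ₑ ^ 2 * ENNReal.ofReal a * ENNReal.ofReal (y ^ (-(2 * σ)) / a) := by
        rw [mul_assoc, ← ENNReal.ofReal_mul ha0.le, mul_div_cancel₀ _ ha0.ne']
    _ ≤ (ENNReal.ofReal ((M / y) ^ 2) * (ENNReal.ofReal (R ^ d * V * (2 * R ^ P)) * I)) *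
        ENNReal.ofReal (y ^ (-(2 * σ)) / a) := by
        exact mul_le_mul' (step3.trans (mul_le_mul' le_rfl step2)) le_rfl
    _ = ENNReal.ofReal ((M / y) ^ 2 * (R ^ d * V * (2 * R ^ P)) * (y ^ (-(2 * σ)) / a)) * I := by
        have hq : 0 ≤ R ^ d * V * (2 * R ^ P) := by positivity
        rw [ENNReal.ofReal_mul (mul_nonneg (sq_nonneg _) hq), ENNReal.ofReal_mul (sq_nonneg _)]
        ring
    _ = _ := by
        -- The powers of y cancel: -2 + d + (d + 2σ) - 2σ - 2(d - 1) = 0.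
        congr 2
        have e1 : y ^ P = y ^ d * y ^ (2 * σ) := by
          rw [hP, Real.rpow_add hy, Real.rpow_natCast]
        have e2 : y ^ (-(2 * σ)) = (y ^ (2 * σ))⁻¹ := Real.rpow_neg hy.le _
        have e3 : R ^ P = √d ^ P * y ^ P := Real.mul_rpow (Real.sqrt_nonneg _) hy.le
        have e4 : y ^ d = y ^ (d - 1) * y := by
          rw [← pow_succ, Nat.sub_add_cancel hd]
        have hq : y ^ (2 * σ) ≠ 0 := (Real.rpow_pos_of_pos hy _).ne'
        rw [e3, e1, e2, ha, hR, mul_pow, e4, mul_pow, div_pow A, div_pow y]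
        field_simp

/-! ### The Gagliardo–Slobodeckij seminorm of reflected extensions -/

lemma gagliardoSq_congr {U : Set (E d)} {σ : ℝ} {v w : E d → ℝ}
    (h : v =ᵐ[volume.restrict U] w) : gagliardoSq U σ v = gagliardoSq U σ w := by
  unfold gagliardoSq
  refine lintegral_congr_ae ?_
  filter_upwards [h] with x hx
  refine lintegral_congr_ae ?_
  filter_upwards [h] with y hy
  rw [hx, hy]

lemma gagliardoSq_mono {U V : Set (E d)} (h : U ⊆ V) (σ : ℝ) (v : E d → ℝ) :
    gagliardoSq U σ v ≤ gagliardoSq V σ v :=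
  (lintegral_mono_set h).trans (lintegral_mono fun _ => lintegral_mono_set h)

lemma measurable_gker (σ : ℝ) {f : E d → ℝ} (hf : Measurable f) :
    Measurable (Function.uncurry (gker σ f)) := by
  unfold Function.uncurry gker
  fun_prop

/-- 1 - |x_i| is the distance to the nearer of the two faces x_i = ±1, so the pointwise bounds for e
= 1 and e = -1 together cover Ω. -/
lemma MemH10.hardy {g : E d → ℝ} {G : Fin d → E d → ℝ}
    (hg : MemH10 (Omega d) g) (hG : HasWeakGradient (Omega d) g G) {σ : ℝ} (hσ : 0 < σ)
    (hGσ : ∀ l, gagliardoSq (Omega d) σ (G l) < ⊤) {i j : Fin d} (hij : j ≠ i) :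
    ∫⁻ x in Omega d, ‖G j x‖ₑ ^ 2 * ENNReal.ofReal ((1 - |x i|) ^ (-(2 * σ))) < ⊤ := by
  have hG2 := (hg.gradient isOpen_Omega hG).1
  obtain ⟨C1, hC1, h1⟩ := hg.hardy_pointwise hG hσ hij (e := 1) (Or.inl rfl)
  obtain ⟨C2, hC2, h2⟩ := hg.hardy_pointwise hG hσ hij (e := -1) (Or.inr rfl)
  set K : Fin d → E d → ℝ≥0∞ := fun l x => ∫⁻ z in Omega d, gker σ (G l) x z with hK
  have hKm : ∀ l, AEMeasurable (K l) (volume.restrict (Omega d)) := by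
    intro l
    have hm := (hG2 l).1.stronglyMeasurable_mk.measurable
    refine ⟨fun x => ∫⁻ z in Omega d, gker σ ((hG2 l).1.mk (G l)) x z,
      (measurable_gker σ hm).lintegral_prod_right, ?_⟩
    filter_upwards [(hG2 l).1.ae_eq_mk] with x hx
    refine lintegral_congr_ae ?_
    filter_upwards [(hG2 l).1.ae_eq_mk] with z hz
    unfold gker
    rw [hx, hz]
  have hle : ∀ x ∈ Omega d, ‖G j x‖ₑ ^ 2 * ENNReal.ofReal ((1 - |x i|) ^ (-(2 * σ))) ≤
      (C1 + C2) * (K j x + K i x) := by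
    intro x hx
    rw [add_mul]
    rcases abs_choice (x i) with h | h
    · refine le_trans ?_ ((h1 x hx).trans (le_add_of_nonneg_right zero_le))
      rw [h, one_mul]
    · refine le_trans ?_ ((h2 x hx).trans (le_add_of_nonneg_left zero_le))
      rw [h, neg_one_mul]
  refine (setLIntegral_mono_ae' measurableSet_Omega (Eventually.of_forall hle)).trans_lt ?_
  rw [lintegral_const_mul' _ _ (by finiteness), lintegral_add_left' (hKm j)]
  exact ENNReal.mul_lt_top (by finiteness) (ENNReal.add_lt_top.2 ⟨hGσ j, hGσ i⟩)

/-! ### Pairs of points with different signs -/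

/-- The tail `∫_{‖h‖ ≥ δ} ‖h‖^{-d-2σ}`. -/
noncomputable def tail (d : ℕ) (σ δ : ℝ) : ℝ≥0∞ :=
  ∫⁻ h : E d, if δ ≤ ‖h‖ then ENNReal.ofReal (‖h‖ ^ (-((d : ℝ) + 2 * σ))) else 0

lemma measurable_tail (σ : ℝ) : Measurable (tail d σ) := by
  unfold tail
  refine Measurable.lintegral_prod_right' (f := fun p : ℝ × E d =>
    if p.1 ≤ ‖p.2‖ then ENNReal.ofReal (‖p.2‖ ^ (-((d : ℝ) + 2 * σ))) else 0) ?_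
  exact Measurable.ite (measurableSet_le (by fun_prop) (by fun_prop)) (by fun_prop)
    measurable_const

lemma lintegral_comp_smul (f : E d → ℝ≥0∞) {δ : ℝ} (hδ : 0 < δ) :
    ∫⁻ h : E d, f (δ⁻¹ • h) = ENNReal.ofReal (δ ^ d) * ∫⁻ h, f h := by
  have h0 : δ⁻¹ ≠ 0 := (inv_pos.2 hδ).ne'
  have h1 := Measure.map_addHaar_smul (volume : Measure (E d)) h0
  have h2 := lintegral_map_equiv (μ := volume) f
    (Homeomorph.smulOfNeZero (δ⁻¹ : ℝ) h0 : E d ≃ₜ E d).toMeasurableEquiv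
  have h3 : Measure.map (Homeomorph.smulOfNeZero (δ⁻¹ : ℝ) h0 : E d ≃ₜ E d).toMeasurableEquiv
      volume = Measure.map (δ⁻¹ • ·) (volume : Measure (E d)) := rfl
  rw [h3, h1, lintegral_smul_measure] at h2
  refine Eq.trans h2.symm ?_
  rw [smul_eq_mul, finrank_euclideanSpace_fin, inv_pow, inv_inv, abs_of_pos (pow_pos hδ d)]

/-- For ‖h‖ ≥ δ one has 2‖h‖ ≥ δ + ‖h‖, which replaces the truncated power by a multiple of (1 +
‖h/δ‖)^(-(d+2σ)). This is integrable as σ > 0, and scaling extracts δ^(-2σ). -/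
lemma tail_le {σ : ℝ} (hσ : 0 < σ) : ∃ C : ℝ≥0∞, C ≠ ⊤ ∧ ∀ δ : ℝ, 0 < δ →
    tail d σ δ ≤ C * ENNReal.ofReal (δ ^ (-(2 * σ))) := by
  set P := (d : ℝ) + 2 * σ with hP
  have hP0 : 0 < P := by positivity
  have hfin : ∫⁻ h : E d, ENNReal.ofReal ((1 + ‖h‖) ^ (-P)) < ⊤ :=
    finite_integral_one_add_norm (by rw [finrank_euclideanSpace_fin]; linarith)
  refine ⟨ENNReal.ofReal (2 ^ P) * ∫⁻ h : E d, ENNReal.ofReal ((1 + ‖h‖) ^ (-P)),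
    ENNReal.mul_ne_top ENNReal.ofReal_ne_top hfin.ne, fun δ hδ => ?_⟩
  have h1 : tail d σ δ ≤ ∫⁻ h : E d, ENNReal.ofReal (2 ^ P * δ ^ (-P)) *
      ENNReal.ofReal ((1 + ‖δ⁻¹ • h‖) ^ (-P)) := by
    refine lintegral_mono fun h => ?_
    simp only
    split_ifs with hh
    · rw [← ENNReal.ofReal_mul (by positivity)]
      refine ENNReal.ofReal_le_ofReal ?_
      have hh0 : 0 < ‖h‖ := hδ.trans_le hh
      rw [norm_smul, Real.norm_eq_abs, abs_of_pos (inv_pos.2 hδ), mul_assoc,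
        ← Real.mul_rpow hδ.le (by positivity), mul_add, mul_one, mul_inv_cancel_left₀ hδ.ne']
      have h2 : (2 * ‖h‖) ^ (-P) ≤ (δ + ‖h‖) ^ (-P) :=
        Real.rpow_le_rpow_of_nonpos (by positivity) (by linarith) (by linarith)
      rw [Real.mul_rpow (by norm_num) hh0.le, Real.rpow_neg (by norm_num)] at h2
      have h3 : (0 : ℝ) < 2 ^ P := Real.rpow_pos_of_pos (by norm_num) _
      calc ‖h‖ ^ (-P) = 2 ^ P * ((2 ^ P)⁻¹ * ‖h‖ ^ (-P)) := by
            rw [mul_inv_cancel_left₀ h3.ne']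
        _ ≤ _ := mul_le_mul_of_nonneg_left h2 h3.le
    · exact zero_le
  refine h1.trans_eq ?_
  rw [lintegral_const_mul' _ _ ENNReal.ofReal_ne_top,
    lintegral_comp_smul (fun h : E d => ENNReal.ofReal ((1 + ‖h‖) ^ (-P))) hδ,
    ENNReal.ofReal_mul (by positivity)]
  have e : ENNReal.ofReal (δ ^ (-P)) * ENNReal.ofReal (δ ^ d) =
      ENNReal.ofReal (δ ^ (-(2 * σ))) := by
    rw [← ENNReal.ofReal_mul (by positivity), ← Real.rpow_natCast, ← Real.rpow_add hδ]
    congr 2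
    rw [hP]; ring
  rw [← e]
  ring

/-- Contribution of the pairs of points at which the signs differ. -/
noncomputable def signKer (p : Fin d → ℕ) (σ : ℝ) (f : E d → ℝ) (x y : E d) : ℝ≥0∞ :=
  ‖f (fold x)‖ₑ ^ 2 * ∑ i with Even (p i), if 1 - |fold x i| ≤ ‖x - y‖ then
    ENNReal.ofReal (‖x - y‖ ^ (-((d : ℝ) + 2 * σ))) else 0

lemma measurable_signKer (p : Fin d → ℕ) (σ : ℝ) {f : E d → ℝ} (hf : Measurable f) :
    Measurable (Function.uncurry (signKer p σ f)) := by
  unfold Function.uncurry signKer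
  have hfold : Measurable (fun q : E d × E d => fold q.1) :=
    continuous_fold.measurable.comp measurable_fst
  refine ((hf.comp hfold).enorm.pow_const 2).mul (Finset.measurable_fun_sum _ fun i _ => ?_)
  refine Measurable.ite (measurableSet_le ?_ (by fun_prop)) (by fun_prop) measurable_const
  have : Measurable (fun q : E d × E d => fold q.1 i) := by
    have h2 : Measurable fun z : E d => z i := by fun_prop
    exact h2.comp hfold
  exact measurable_const.sub this.abs

/-- Where the signs agree, folding only shortens distances. Where they differ, some wall in an odd
direction lies between the points, so both are at least that far apart, and (a-b)² ≤ 2(a²+b²)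
suffices. -/
lemma gker_rext_le {σ : ℝ} (hσ : 0 < σ) (p : Fin d → ℕ) (f : E d → ℝ) (x y : E d) :
    gker σ (rext p f) x y ≤ gker σ f (fold x) (fold y) +
      2 * (signKer p σ f x y + signKer p σ f y x) := by
  have hP : 0 < (d : ℝ) + 2 * σ := by positivity
  by_cases hs : sgn p x = sgn p y
  · refine le_add_of_le_of_nonneg ?_ zero_le
    unfold gker rext
    refine ENNReal.ofReal_le_ofReal ?_
    rw [hs, ← mul_sub, mul_pow]
    by_cases h0 : fold x = fold y
    · rw [h0]; simp
    · have h1 : 0 < ‖fold x - fold y‖ := norm_pos_iff.2 (sub_ne_zero.2 h0)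
      gcongr
      · refine mul_le_of_le_one_left (sq_nonneg _) ?_
        rw [sq_le_one_iff_abs_le_one]
        exact abs_sgn_le p y
      · exact norm_fold_sub_le x y
  · refine le_add_of_nonneg_of_le zero_le ?_
    have key : ∀ x y : E d, sgn p x ≠ sgn p y → ‖f (fold x)‖ₑ ^ 2 *
        ENNReal.ofReal (‖x - y‖ ^ (-((d : ℝ) + 2 * σ))) ≤ signKer p σ f x y := by
      intro x y hne
      obtain ⟨i, hi, hle⟩ := exists_of_sgn_ne hne
      unfold signKer
      refine mul_le_mul' le_rfl ?_
      have := Finset.single_le_sum (s := Finset.univ.filter fun i => Even (p i))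
        (f := fun i => if 1 - |fold x i| ≤ ‖x - y‖ then
        ENNReal.ofReal (‖x - y‖ ^ (-((d : ℝ) + 2 * σ))) else 0) (fun _ _ => zero_le)
        (Finset.mem_filter.2 ⟨Finset.mem_univ i, hi⟩)
      simpa only [hle, if_true] using this
    have k1 := key x y hs
    have k2 := key y x (Ne.symm hs)
    refine le_trans ?_ (mul_le_mul' le_rfl (add_le_add k1 k2))
    rw [norm_sub_rev y x, ← add_mul, ← mul_assoc]
    have two : ∀ a : ℝ, (2 : ℝ≥0∞) * ENNReal.ofReal a = ENNReal.ofReal (2 * a) := fun a => by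
      rw [ENNReal.ofReal_mul (by norm_num), ENNReal.ofReal_ofNat]
    unfold gker
    rw [Real.enorm_eq_ofReal_abs, Real.enorm_eq_ofReal_abs, ← ENNReal.ofReal_pow (abs_nonneg _),
      ← ENNReal.ofReal_pow (abs_nonneg _), ← ENNReal.ofReal_add (by positivity) (by positivity),
      two, ← ENNReal.ofReal_mul (by positivity), sq_abs, sq_abs, Real.rpow_neg (norm_nonneg _),
      ← div_eq_mul_inv]
    refine ENNReal.ofReal_le_ofReal ?_
    gcongr
    unfold rext
    have a1 : (sgn p x * f (fold x)) ^ 2 ≤ f (fold x) ^ 2 := by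
      rw [mul_pow]
      exact mul_le_of_le_one_left (sq_nonneg _) ((sq_le_one_iff_abs_le_one _).2 (abs_sgn_le p x))
    have a2 : (sgn p y * f (fold y)) ^ 2 ≤ f (fold y) ^ 2 := by
      rw [mul_pow]
      exact mul_le_of_le_one_left (sq_nonneg _) ((sq_le_one_iff_abs_le_one _).2 (abs_sgn_le p y))
    nlinarith [sq_nonneg (sgn p x * f (fold x) + sgn p y * f (fold y))]

/-- Integrating in `y` first leaves the tail beyond the distance to the wall. This is the Hardy
weight, and folding then brings the integral in `x` back to Ω. -/
lemma lintegral_signKer_lt_top {p : Fin d → ℕ} {σ : ℝ} (hσ : 0 < σ) {f : E d → ℝ}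
    (hf : Measurable f)
    (hH : ∀ i, Even (p i) →
      ∫⁻ x in Omega d, ‖f x‖ₑ ^ 2 * ENNReal.ofReal ((1 - |x i|) ^ (-(2 * σ))) < ⊤)
    {W : Set (E d)} (hW : Bornology.IsBounded W) :
    ∫⁻ x in W, ∫⁻ y in W, signKer p σ f x y < ⊤ := by
  obtain ⟨C, hC, htail⟩ := tail_le (d := d) hσ
  obtain ⟨N, hN⟩ := lintegral_fold_le hW
  have h1 : ∀ x, ∫⁻ y in W, signKer p σ f x y ≤
      (fun a : E d => ∑ i with Even (p i), ‖f a‖ₑ ^ 2 * tail d σ (1 - |a i|)) (fold x) := by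
    intro x
    refine (setLIntegral_le_lintegral _ _).trans ?_
    unfold signKer
    have hm : ∀ i : Fin d, Measurable fun y : E d => if 1 - |fold x i| ≤ ‖x - y‖ then
        ENNReal.ofReal (‖x - y‖ ^ (-((d : ℝ) + 2 * σ))) else 0 := fun i =>
      Measurable.ite (measurableSet_le measurable_const (by fun_prop)) (by fun_prop)
        measurable_const
    rw [lintegral_const_mul _ (Finset.measurable_fun_sum _ fun i _ => hm i),
      lintegral_finsetSum _ fun i _ => hm i, Finset.mul_sum]
    refine Finset.sum_le_sum fun i _ => mul_le_mul' le_rfl (le_of_eq ?_)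
    exact lintegral_sub_left_eq_self (fun h : E d => if 1 - |fold x i| ≤ ‖h‖ then
        ENNReal.ofReal (‖h‖ ^ (-((d : ℝ) + 2 * σ))) else 0) x
  have hFm : ∀ i : Fin d, Measurable fun a : E d => ‖f a‖ₑ ^ 2 * tail d σ (1 - |a i|) := fun i =>
    (hf.enorm.pow_const 2).mul ((measurable_tail σ).comp (by fun_prop))
  refine (lintegral_mono h1).trans_lt ((hN _
    (Finset.measurable_fun_sum _ fun i _ => hFm i).aemeasurable).trans_lt ?_)
  refine ENNReal.mul_lt_top (by simp) ?_
  rw [lintegral_finsetSum _ fun i _ => hFm i]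
  refine ENNReal.sum_lt_top.2 fun i hi => ?_
  have h2 : ∫⁻ a in Omega d, ‖f a‖ₑ ^ 2 * tail d σ (1 - |a i|) ≤
      ∫⁻ a in Omega d, C * (‖f a‖ₑ ^ 2 * ENNReal.ofReal ((1 - |a i|) ^ (-(2 * σ)))) := by
    refine setLIntegral_mono_ae' measurableSet_Omega (Eventually.of_forall fun a ha => ?_)
    rw [mul_left_comm]
    exact mul_le_mul' le_rfl (htail _ (sub_pos.2 (abs_lt.2 (ha i))))
  refine h2.trans_lt ?_
  rw [lintegral_const_mul' _ _ hC]
  exact ENNReal.mul_lt_top hC.lt_top (hH i (Finset.mem_filter.1 hi).2)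

lemma lintegral_lintegral_add_mul_add (μ : Measure (E d)) [SFinite μ] {A B C : E d → E d → ℝ≥0∞}
    (hA : Measurable (Function.uncurry A)) (hB : Measurable (Function.uncurry B))
    (hC : Measurable (Function.uncurry C)) :
    ∫⁻ x, ∫⁻ y, (A x y + 2 * (B x y + C x y)) ∂μ ∂μ =
      ∫⁻ x, ∫⁻ y, A x y ∂μ ∂μ + 2 * (∫⁻ x, ∫⁻ y, B x y ∂μ ∂μ + ∫⁻ x, ∫⁻ y, C x y ∂μ ∂μ) := by
  have h1 : ∀ x, ∫⁻ y, (A x y + 2 * (B x y + C x y)) ∂μ =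
      ∫⁻ y, A x y ∂μ + 2 * (∫⁻ y, B x y ∂μ + ∫⁻ y, C x y ∂μ) := fun x => by
    have hAx : Measurable (A x) := hA.of_uncurry_left
    have hBx : Measurable (B x) := hB.of_uncurry_left
    have hCx : Measurable (C x) := hC.of_uncurry_left
    rw [lintegral_add_left hAx, lintegral_const_mul' _ _ (by norm_num), lintegral_add_left hBx]
  simp_rw [h1]
  have hAi : Measurable fun x => ∫⁻ y, A x y ∂μ := hA.lintegral_prod_right
  have hBi : Measurable fun x => ∫⁻ y, B x y ∂μ := hB.lintegral_prod_right
  rw [lintegral_add_left hAi, lintegral_const_mul' _ _ (by norm_num), lintegral_add_left hBi]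

lemma measurable_uncurry_fold {k : E d → E d → ℝ≥0∞} (hk : Measurable (Function.uncurry k)) :
    Measurable (Function.uncurry fun x y : E d => k (fold x) (fold y)) := by
  have hfold : Measurable (fold : E d → E d) := continuous_fold.measurable
  exact hk.comp ((hfold.comp measurable_fst).prodMk (hfold.comp measurable_snd))

lemma measurable_uncurry_swap {k : E d → E d → ℝ≥0∞} (hk : Measurable (Function.uncurry k)) :
    Measurable (Function.uncurry fun x y : E d => k y x) :=
  hk.comp measurable_swap

lemma lintegral_lintegral_fold_lt_top {k : E d → E d → ℝ≥0∞}
    (hk : Measurable (Function.uncurry k))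
    (hfin : ∫⁻ x in Omega d, ∫⁻ y in Omega d, k x y < ⊤) {W : Set (E d)}
    (hW : Bornology.IsBounded W) :
    ∫⁻ x in W, ∫⁻ y in W, k (fold x) (fold y) < ⊤ := by
  obtain ⟨N, hN⟩ := lintegral_fold_le hW
  have hkx : ∀ x, Measurable (k x) := fun x => hk.of_uncurry_left
  have hki : Measurable fun x => ∫⁻ y in Omega d, k x y := hk.lintegral_prod_right
  calc ∫⁻ x in W, ∫⁻ y in W, k (fold x) (fold y)
      ≤ ∫⁻ x in W, N * ∫⁻ y in Omega d, k (fold x) y :=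
        lintegral_mono fun x => hN _ (hkx _).aemeasurable
    _ = N * ∫⁻ x in W, ∫⁻ y in Omega d, k (fold x) y :=
        lintegral_const_mul' _ _ (by simp)
    _ ≤ N * (N * ∫⁻ x in Omega d, ∫⁻ y in Omega d, k x y) :=
        mul_le_mul' le_rfl (hN (fun x => ∫⁻ y in Omega d, k x y) hki.aemeasurable)
    _ < ⊤ := ENNReal.mul_lt_top (by simp) (ENNReal.mul_lt_top (by simp) hfin)

lemma gagliardoSq_rext_lt_top_of_measurable {p : Fin d → ℕ} {σ : ℝ} (hσ : 0 < σ) {f : E d → ℝ}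
    (hf : Measurable f) (hfσ : gagliardoSq (Omega d) σ f < ⊤)
    (hH : ∀ i, Even (p i) →
      ∫⁻ x in Omega d, ‖f x‖ₑ ^ 2 * ENNReal.ofReal ((1 - |x i|) ^ (-(2 * σ))) < ⊤)
    {W : Set (E d)} (hW : Bornology.IsBounded W) :
    gagliardoSq W σ (rext p f) < ⊤ := by
  have hK := measurable_gker σ hf
  have hS := measurable_signKer p σ hf
  have hK' := measurable_uncurry_fold hK
  have hS' := measurable_uncurry_swap hS
  have i1 : ∫⁻ x in W, ∫⁻ y in W, gker σ f (fold x) (fold y) < ⊤ :=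
    lintegral_lintegral_fold_lt_top hK hfσ hW
  have i2 := lintegral_signKer_lt_top hσ hf hH hW
  have i3 : ∫⁻ x in W, ∫⁻ y in W, signKer p σ f y x < ⊤ := by
    rw [lintegral_lintegral_swap hS'.aemeasurable]
    exact i2
  refine lt_of_le_of_lt (lintegral_mono fun x => lintegral_mono fun y =>
    gker_rext_le hσ p f x y) ?_
  rw [lintegral_lintegral_add_mul_add _ hK' hS hS']
  exact ENNReal.add_lt_top.2 ⟨i1, ENNReal.mul_lt_top (by norm_num)
    (ENNReal.add_lt_top.2 ⟨i2, i3⟩)⟩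

lemma ae_fold {P : E d → Prop} (hP : ∀ᵐ x ∂(volume.restrict (Omega d)), P x) {W : Set (E d)}
    (hW : Bornology.IsBounded W) : ∀ᵐ x ∂(volume.restrict W), P (fold x) := by
  obtain ⟨N, hN⟩ := map_fold_le hW
  have h1 : ∀ᵐ x ∂(Measure.map fold (volume.restrict W)), P x :=
    Measure.absolutelyContinuous_of_le hN (Measure.ae_smul_measure hP _)
  exact ae_of_ae_map continuous_fold.measurable.aemeasurable h1

lemma rext_congr {f f' : E d → ℝ} (h : f =ᵐ[volume.restrict (Omega d)] f') (p : Fin d → ℕ)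
    {W : Set (E d)} (hW : Bornology.IsBounded W) :
    rext p f =ᵐ[volume.restrict W] rext p f' := by
  filter_upwards [ae_fold h hW] with x hx
  unfold rext
  rw [hx]

/-- For `g` in `H^1_0(Ω)` with gradient of finite seminorm, the reflected extensions of the
derivatives have finite seminorm on bounded sets. -/
lemma MemH10.gagliardoSq_rext_lt_top {g : E d → ℝ} {G : Fin d → E d → ℝ}
    (hg : MemH10 (Omega d) g) (hG : HasWeakGradient (Omega d) g G) {σ : ℝ} (hσ : 0 < σ)
    (hGσ : ∀ l, gagliardoSq (Omega d) σ (G l) < ⊤) (j : Fin d) {W : Set (E d)}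
    (hW : Bornology.IsBounded W) :
    gagliardoSq W σ (rext (0 + Pi.single j 1) (G j)) < ⊤ := by
  have hm := ((hg.gradient isOpen_Omega hG).1 j).1
  have he := hm.ae_eq_mk
  rw [gagliardoSq_congr (rext_congr he _ hW)]
  refine gagliardoSq_rext_lt_top_of_measurable hσ hm.stronglyMeasurable_mk.measurable ?_ ?_ hW
  · rw [← gagliardoSq_congr he]; exact hGσ j
  · intro i hi
    -- The multi-index is 1 at `j`, so its even directions are exactly those tangent to
    -- `j`-derivatives: only faces with i ≠ j produce sign changes.
    have hij : j ≠ i := by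
      rintro rfl
      simp at hi
    refine lt_of_eq_of_lt (lintegral_congr_ae ?_) (hg.hardy hG hσ hGσ hij)
    filter_upwards [he] with x hx
    rw [hx]

/-! ### Comparison of translates of two series -/

lemma integral_sine_diff (k l p : Fin d → ℕ) (n : ℕ) (h : E d) :
    ∫ x in bigBox d n, (sine k p (x + h) - sine k p x) * (sine l p (x + h) - sine l p x) =
      if k = l then (2 + 4 * (n : ℝ)) ^ d * fpow k p ^ 2 *
        (2 - 2 * ∏ i, Real.cos (freq (k i) * h i)) else 0 := by
  have hc : ∀ (k : Fin d → ℕ) (h : E d), Continuous fun x => sine k p (x + h) := fun k h =>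
    (contDiff_sine k p).continuous.comp (by fun_prop)
  have hi : ∀ h h' : E d, IntegrableOn (fun x => sine k p (x + h) * sine l p (x + h'))
      (bigBox d n) := fun h h' =>
    (memLp_of_continuous (isBounded_bigBox n) (hc k h) 2).integrable_mul
      (memLp_of_continuous (isBounded_bigBox n) (hc l h') 2)
  have e : ∀ x : E d, (sine k p (x + h) - sine k p x) * (sine l p (x + h) - sine l p x) =
      (sine k p (x + h) * sine l p (x + h) - sine k p (x + h) * sine l p (x + 0)) -
      (sine k p (x + 0) * sine l p (x + h) - sine k p (x + 0) * sine l p (x + 0)) := fun x => by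
    rw [add_zero]; ring
  simp only [e]
  have hi2 : ∀ h₁ h₂ : E d, IntegrableOn (fun x => sine k p (x + h₁) * sine l p (x + h) -
      sine k p (x + h₁) * sine l p (x + h₂)) (bigBox d n) := fun h₁ h₂ => (hi _ _).sub (hi _ _)
  rw [integral_sub (hi2 _ _) (hi2 _ _),
    integral_sub (hi _ _) (hi _ _), integral_sub (hi _ _) (hi _ _)]
  simp only [integral_sine_shift]
  split_ifs with hkl
  · simp [Real.cos_neg]
    ring
  · simp

/-- Increments of different sines remain orthogonal over whole periods. The order `p` enters only
through `fpow`, and the translation only through a factor common to all orders. -/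
lemma integral_sq_psum_diff (a : (Fin d → ℕ) → ℝ) (p : Fin d → ℕ) (F : Finset (Fin d → ℕ))
    (n : ℕ) (h : E d) :
    ∫ x in bigBox d n, (psum a p F (x + h) - psum a p F x) ^ 2 =
      ∑ k ∈ F, (a k * fpow k p) ^ 2 * ((2 + 4 * (n : ℝ)) ^ d *
        (2 - 2 * ∏ i, Real.cos (freq (k i) * h i))) := by
  have hc : ∀ k : Fin d → ℕ, Continuous fun x => sine k p (x + h) - sine k p x := fun k =>
    ((contDiff_sine k p).continuous.comp (by fun_prop)).sub (contDiff_sine k p).continuous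
  have hi : ∀ k l : Fin d → ℕ, IntegrableOn (fun x => a k * a l *
      ((sine k p (x + h) - sine k p x) * (sine l p (x + h) - sine l p x))) (bigBox d n) :=
    fun k l => ((memLp_of_continuous (isBounded_bigBox n) (hc k) 2).integrable_mul
      (memLp_of_continuous (isBounded_bigBox n) (hc l) 2)).const_mul _
  have e : ∀ x : E d, (psum a p F (x + h) - psum a p F x) ^ 2 = ∑ k ∈ F, ∑ l ∈ F, a k * a l *
      ((sine k p (x + h) - sine k p x) * (sine l p (x + h) - sine l p x)) := fun x => by
    unfold psum
    rw [← Finset.sum_sub_distrib, sq, Finset.sum_mul_sum]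
    refine Finset.sum_congr rfl fun k _ => Finset.sum_congr rfl fun l _ => ?_
    ring
  simp only [e]
  rw [integral_finsetSum _ fun k _ => integrable_finsetSum _ fun l _ => hi k l]
  refine Finset.sum_congr rfl fun k hk => ?_
  rw [integral_finsetSum _ fun l _ => hi k l]
  simp only [integral_const_mul, integral_sine_diff]
  simp only [mul_ite, mul_zero, Finset.sum_ite_eq, hk, if_true]
  ring

lemma eLpNorm_two_le_of_integral_sq_le {μ : Measure (E d)} {f g : E d → ℝ} (hf : MemLp f 2 μ)
    (hg : MemLp g 2 μ) (h : ∫ x, f x ^ 2 ∂μ ≤ ∫ x, g x ^ 2 ∂μ) :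
    eLpNorm f 2 μ ≤ eLpNorm g 2 μ := by
  rw [hf.eLpNorm_eq_integral_rpow_norm (by norm_num) (by norm_num),
    hg.eLpNorm_eq_integral_rpow_norm (by norm_num) (by norm_num)]
  refine ENNReal.ofReal_le_ofReal (Real.rpow_le_rpow (by positivity) ?_ (by norm_num))
  simpa using h

/-- The common factor 2 - 2∏cos is nonnegative, so the comparison is termwise. -/
lemma eLpNorm_psum_diff_le {a b : (Fin d → ℕ) → ℝ} {p q : Fin d → ℕ}
    (hab : ∀ k, (a k * fpow k p) ^ 2 ≤ (b k * fpow k q) ^ 2) (F : Finset (Fin d → ℕ))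
    (n : ℕ) (h : E d) :
    eLpNorm (fun x => psum a p F (x + h) - psum a p F x) 2 (volume.restrict (bigBox d n)) ≤
      eLpNorm (fun x => psum b q F (x + h) - psum b q F x) 2
        (volume.restrict (bigBox d n)) := by
  have hc : ∀ (a : (Fin d → ℕ) → ℝ) (p : Fin d → ℕ),
      MemLp (fun x => psum a p F (x + h) - psum a p F x) 2 (volume.restrict (bigBox d n)) :=
    fun a p => memLp_of_continuous (isBounded_bigBox n)
      (((contDiff_psum a p F).continuous.comp (by fun_prop)).sub
        (contDiff_psum a p F).continuous) 2
  refine eLpNorm_two_le_of_integral_sq_le (hc a p) (hc b q) ?_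
  rw [integral_sq_psum_diff, integral_sq_psum_diff]
  refine Finset.sum_le_sum fun k _ => mul_le_mul_of_nonneg_right (hab k) ?_
  have h1 : |∏ i, Real.cos (freq (k i) * h i)| ≤ 1 := by
    rw [Finset.abs_prod]
    exact Finset.prod_le_one (fun _ _ => abs_nonneg _) fun _ _ => Real.abs_cos_le_one _
  have h2 := (abs_le.1 h1).2
  have h3 : (0 : ℝ) ≤ (2 + 4 * (n : ℝ)) ^ d := by positivity
  exact mul_nonneg h3 (by linarith)

lemma measurePreserving_add_restrict (h : E d) (W : Set (E d)) :
    MeasurePreserving (fun x => x + h) (volume.restrict W)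
      (volume.restrict ((fun x => x + -h) ⁻¹' W)) := by
  have e : (fun x => x + h) ⁻¹' ((fun x => x + -h) ⁻¹' W) = W := by
    ext x; simp
  have := (measurePreserving_add_right (volume : Measure (E d)) h).restrict_preimage_emb
    (MeasurableEquiv.addRight h).measurableEmbedding ((fun x => x + -h) ⁻¹' W)
  rwa [e] at this

lemma isBounded_preimage_add (h : E d) {W : Set (E d)} (hW : Bornology.IsBounded W) :
    Bornology.IsBounded ((fun x => x + h) ⁻¹' W) := by
  obtain ⟨R, hR⟩ := hW.exists_norm_le
  refine isBounded_iff_forall_norm_le.2 ⟨R + ‖h‖, fun x hx => ?_⟩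
  calc ‖x‖ = ‖(x + h) - h‖ := by rw [add_sub_cancel_right]
    _ ≤ ‖x + h‖ + ‖h‖ := norm_sub_le _ _
    _ ≤ R + ‖h‖ := by gcongr; exact hR _ hx

lemma MemL2Loc.translate {u : E d → ℝ} (hu : MemL2Loc u) (h : E d) :
    MemL2Loc fun x => u (x + h) := fun W hW =>
  (hu _ (isBounded_preimage_add (-h) hW)).comp_measurePreserving
    (measurePreserving_add_restrict h W)

lemma SeriesLim.tendsto_rext_diff {p : Fin d → ℕ} {a : (Fin d → ℕ) → ℝ} {f : E d → ℝ}
    (hf : SeriesLim p a f) (h : E d) {W : Set (E d)} (hW : Bornology.IsBounded W) :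
    TendstoL2 atTop (volume.restrict W) (fun F x => psum a p F (x + h) - psum a p F x)
      (fun x => rext p f (x + h) - rext p f x) := by
  have hb := isBounded_preimage_add (-h) hW
  have h1 := hf.tendsto_rext hb
  have h2 := hf.tendsto_rext hW
  have hm : ∀ (W : Set (E d)), Bornology.IsBounded W → ∀ F, AEStronglyMeasurable
      (fun x => psum a p F x - rext p f x) (volume.restrict W) := fun W hW F =>
    ((contDiff_psum a p F).continuous.aestronglyMeasurable).sub (MemLp.rext hf.memLp p W hW).1
  have h3 := Tendsto.add h1 h2
  rw [add_zero] at h3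
  refine tendsto_of_tendsto_of_tendsto_of_le_of_le tendsto_const_nhds h3 (fun _ => zero_le)
    fun F => ?_
  have mp := measurePreserving_add_restrict h W
  have e1 := eLpNorm_comp_measurePreserving (p := 2) (hm _ hb F) mp
  rw [← e1]
  refine le_trans (le_of_eq ?_) (eLpNorm_sub_le ((hm _ hb F).comp_measurePreserving mp)
    (hm _ hW F) (by norm_num))
  congr 1
  ext x
  simp only [Pi.sub_apply, Function.comp]
  ring

lemma TendstoL2.eLpNorm_le {ι α : Type*} {m : MeasurableSpace α} {l : Filter ι} [l.NeBot]
    {μ : Measure α} {f f' : ι → α → ℝ} {g g' : α → ℝ} (h : TendstoL2 l μ f g)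
    (h' : TendstoL2 l μ f' g') (hf : ∀ n, AEStronglyMeasurable (f n) μ)
    (hf' : ∀ n, AEStronglyMeasurable (f' n) μ) (hg : AEStronglyMeasurable g μ)
    (hg' : AEStronglyMeasurable g' μ) (hle : ∀ n, eLpNorm (f n) 2 μ ≤ eLpNorm (f' n) 2 μ) :
    eLpNorm g 2 μ ≤ eLpNorm g' 2 μ := by
  have h1 : Tendsto (fun n => eLpNorm (fun x => f n x - g x) 2 μ +
      (eLpNorm (fun x => f' n x - g' x) 2 μ + eLpNorm g' 2 μ)) l
      (𝓝 (0 + (0 + eLpNorm g' 2 μ))) := Tendsto.add h (Tendsto.add h' tendsto_const_nhds)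
  rw [zero_add, zero_add] at h1
  refine ge_of_tendsto' h1 fun n => ?_
  have e1 : g = f n - (fun x => f n x - g x) := by ext x; simp
  have e2 : f' n = (fun x => f' n x - g' x) + g' := by ext x; simp
  calc eLpNorm g 2 μ ≤ eLpNorm (f n) 2 μ + eLpNorm (fun x => f n x - g x) 2 μ := by
        conv_lhs => rw [e1]
        exact eLpNorm_sub_le (hf n) ((hf n).sub hg) (by norm_num)
    _ ≤ eLpNorm (fun x => f n x - g x) 2 μ + eLpNorm (f' n) 2 μ := by
        rw [add_comm]; gcongr; exact hle n
    _ ≤ _ := by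
        gcongr
        conv_lhs => rw [e2]
        exact eLpNorm_add_le ((hf' n).sub hg') hg' (by norm_num)

lemma SeriesLim.eLpNorm_rext_diff_le {a b : (Fin d → ℕ) → ℝ} {p q : Fin d → ℕ} {f g : E d → ℝ}
    (hf : SeriesLim p a f) (hg : SeriesLim q b g)
    (hab : ∀ k, (a k * fpow k p) ^ 2 ≤ (b k * fpow k q) ^ 2) (n : ℕ) (h : E d) :
    eLpNorm (fun x => rext p f (x + h) - rext p f x) 2 (volume.restrict (bigBox d n)) ≤
      eLpNorm (fun x => rext q g (x + h) - rext q g x) 2 (volume.restrict (bigBox d n)) := by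
  have hb := isBounded_bigBox (d := d) n
  have hc : ∀ (a : (Fin d → ℕ) → ℝ) (p : Fin d → ℕ) (F : Finset (Fin d → ℕ)),
      AEStronglyMeasurable (fun x => psum a p F (x + h) - psum a p F x)
        (volume.restrict (bigBox d n)) := fun a p F =>
    (((contDiff_psum a p F).continuous.comp (by fun_prop)).sub
      (contDiff_psum a p F).continuous).aestronglyMeasurable
  have hr : ∀ (p : Fin d → ℕ) {f : E d → ℝ}, MemLp f 2 (volume.restrict (Omega d)) →
      AEStronglyMeasurable (fun x => rext p f (x + h) - rext p f x)
        (volume.restrict (bigBox d n)) := fun p f hf =>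
    (((MemLp.rext hf p).translate h _ hb).sub (MemLp.rext hf p _ hb)).1
  exact TendstoL2.eLpNorm_le (hf.tendsto_rext_diff h hb) (hg.tendsto_rext_diff h hb)
    (hc a p) (hc b q) (hr p hf.memLp) (hr q hg.memLp) fun F => eLpNorm_psum_diff_le hab F n h

lemma gker_add (σ : ℝ) (f : E d → ℝ) (x h : E d) : gker σ f x (x + h) =
    ENNReal.ofReal ((‖h‖ ^ ((d : ℝ) + 2 * σ))⁻¹) * ‖f (x + h) - f x‖ₑ ^ 2 := by
  unfold gker
  rw [Real.enorm_eq_ofReal_abs, ← ENNReal.ofReal_pow (abs_nonneg _), sq_abs,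
    ← ENNReal.ofReal_mul (by positivity), sub_add_cancel_left, norm_neg, div_eq_inv_mul,
    ← neg_sub (f x), neg_sq]

lemma lintegral_enorm_sq_le {α : Type*} {m : MeasurableSpace α} {μ : Measure α} {f g : α → ℝ}
    (h : eLpNorm f 2 μ ≤ eLpNorm g 2 μ) : ∫⁻ x, ‖f x‖ₑ ^ 2 ∂μ ≤ ∫⁻ x, ‖g x‖ₑ ^ 2 ∂μ := by
  rw [eLpNorm_eq_lintegral_rpow_enorm_toReal (by norm_num) (by norm_num),
    eLpNorm_eq_lintegral_rpow_enorm_toReal (by norm_num) (by norm_num),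
    ENNReal.rpow_le_rpow_iff (by norm_num)] at h
  simpa using h

lemma measurable_uncurry_add {k : E d → E d → ℝ≥0∞} (hk : Measurable (Function.uncurry k)) :
    Measurable (Function.uncurry fun x h : E d => k x (x + h)) :=
  hk.comp (measurable_fst.prodMk (measurable_fst.add measurable_snd))

/-- Substituting y = x + h and exchanging integrals turns the seminorm into an integral over `h` of
‖h‖^(-d-2σ) times squared L² increments, to which the hypothesis applies for each `h`. Differences
of points of the box have norm at most 2R, and the translates reached then lie in the ball of radius
3R. -/
lemma gagliardoSq_lt_top_of_translates {σ : ℝ} {f g : E d → ℝ} (hf : Measurable f)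
    (hg : Measurable g) (hfg : ∀ (n : ℕ) (h : E d),
      eLpNorm (fun x => f (x + h) - f x) 2 (volume.restrict (bigBox d n)) ≤
        eLpNorm (fun x => g (x + h) - g x) 2 (volume.restrict (bigBox d n)))
    (hfin : ∀ W : Set (E d), Bornology.IsBounded W → gagliardoSq W σ g < ⊤)
    {W : Set (E d)} (hW : Bornology.IsBounded W) : gagliardoSq W σ f < ⊤ := by
  obtain ⟨n, hn⟩ := exists_subset_bigBox hW
  refine (gagliardoSq_mono hn σ f).trans_lt ?_
  obtain ⟨R, hR⟩ := (isBounded_bigBox (d := d) n).exists_norm_le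
  set S : Set (E d) := Metric.closedBall 0 (2 * R) with hS
  have hSm : MeasurableSet S := measurableSet_closedBall
  set V : Set (E d) := Metric.closedBall 0 (3 * R) with hV
  have hVm : MeasurableSet V := measurableSet_closedBall
  have hBm : MeasurableSet (bigBox d n) := measurableSet_bigBox n
  have hBV : bigBox d n ⊆ V := fun x hx => by
    have := hR x hx
    have h0 := norm_nonneg x
    rw [hV, mem_closedBall_zero_iff]; linarith
  have hsub : ∀ k : E d → E d → ℝ≥0∞, (∀ x, Measurable (k x)) → ∀ (x : E d) (A : Set (E d)),
      MeasurableSet A →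
      ∫⁻ y in A, k x y = ∫⁻ h, A.indicator (k x) (x + h) := fun k hk x A hA => by
    rw [← lintegral_indicator hA]
    exact (lintegral_add_left_eq_self (fun y => A.indicator (k x) y) x).symm
  have hk : ∀ {f : E d → ℝ}, Measurable f → ∀ x, Measurable (gker σ f x) := fun hf x =>
    (measurable_gker σ hf).of_uncurry_left
  have s1 : ∀ x ∈ bigBox d n, ∫⁻ y in bigBox d n, gker σ f x y ≤
      ∫⁻ h in S, gker σ f x (x + h) := fun x hx => by
    rw [hsub _ (hk hf) x _ hBm, ← lintegral_indicator hSm]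
    refine lintegral_mono fun h => ?_
    by_cases hh : x + h ∈ bigBox d n
    · have : h ∈ S := by
        rw [hS, mem_closedBall_zero_iff]
        calc ‖h‖ = ‖(x + h) - x‖ := by rw [add_sub_cancel_left]
          _ ≤ ‖x + h‖ + ‖x‖ := norm_sub_le _ _
          _ ≤ R + R := add_le_add (hR _ hh) (hR _ hx)
          _ = 2 * R := by ring
      rw [indicator_of_mem hh, indicator_of_mem this]
    · rw [indicator_of_notMem hh]
      exact zero_le
  have s2 : ∀ x ∈ bigBox d n, ∫⁻ h in S, gker σ g x (x + h) ≤ ∫⁻ y in V, gker σ g x y :=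
    fun x hx => by
    rw [hsub _ (hk hg) x _ hVm, ← lintegral_indicator hSm]
    refine lintegral_mono fun h => ?_
    by_cases hh : h ∈ S
    · have : x + h ∈ V := by
        rw [hS, mem_closedBall_zero_iff] at hh
        rw [hV, mem_closedBall_zero_iff]
        have := norm_add_le x h
        have := hR x hx
        linarith
      rw [indicator_of_mem hh, indicator_of_mem this]
    · rw [indicator_of_notMem hh]
      exact zero_le
  have hm : ∀ {f : E d → ℝ}, Measurable f →
      Measurable (Function.uncurry fun x h : E d => gker σ f x (x + h)) := fun hf =>
    measurable_uncurry_add (measurable_gker σ hf)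
  have s3 : ∀ h : E d, ∫⁻ x in bigBox d n, gker σ f x (x + h) ≤
      ∫⁻ x in bigBox d n, gker σ g x (x + h) := fun h => by
    simp only [gker_add]
    rw [lintegral_const_mul' _ _ ENNReal.ofReal_ne_top,
      lintegral_const_mul' _ _ ENNReal.ofReal_ne_top]
    exact mul_le_mul' le_rfl (lintegral_enorm_sq_le (hfg n h))
  calc gagliardoSq (bigBox d n) σ f
      ≤ ∫⁻ x in bigBox d n, ∫⁻ h in S, gker σ f x (x + h) :=
        setLIntegral_mono_ae' hBm (Eventually.of_forall s1)
    _ = ∫⁻ h in S, ∫⁻ x in bigBox d n, gker σ f x (x + h) :=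
        lintegral_lintegral_swap (hm hf).aemeasurable
    _ ≤ ∫⁻ h in S, ∫⁻ x in bigBox d n, gker σ g x (x + h) := lintegral_mono fun h => s3 h
    _ = ∫⁻ x in bigBox d n, ∫⁻ h in S, gker σ g x (x + h) :=
        (lintegral_lintegral_swap (hm hg).aemeasurable).symm
    _ ≤ ∫⁻ x in bigBox d n, ∫⁻ y in V, gker σ g x y :=
        setLIntegral_mono_ae' hBm (Eventually.of_forall s2)
    _ ≤ ∫⁻ x in V, ∫⁻ y in V, gker σ g x y := lintegral_mono_set hBV
    _ < ⊤ := hfin V Metric.isBounded_closedBall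

lemma measurable_rext (p : Fin d → ℕ) {f : E d → ℝ} (hf : Measurable f) :
    Measurable (rext p f) :=
  (measurable_sgn p).mul (hf.comp continuous_fold.measurable)

/-- Fractional regularity passes to series with smaller coefficients. -/
lemma SeriesLim.gagliardoSq_rext_lt_top {a b : (Fin d → ℕ) → ℝ} {p q : Fin d → ℕ}
    {f g : E d → ℝ} (hf : SeriesLim p a f) (hg : SeriesLim q b g)
    (hab : ∀ k, (a k * fpow k p) ^ 2 ≤ (b k * fpow k q) ^ 2) {σ : ℝ}
    (hfin : ∀ W : Set (E d), Bornology.IsBounded W → gagliardoSq W σ (rext q g) < ⊤)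
    {W : Set (E d)} (hW : Bornology.IsBounded W) : gagliardoSq W σ (rext p f) < ⊤ := by
  have ef := hf.memLp.1.ae_eq_mk
  have eg := hg.memLp.1.ae_eq_mk
  rw [gagliardoSq_congr (rext_congr ef p hW)]
  refine gagliardoSq_lt_top_of_translates
    (measurable_rext p hf.memLp.1.stronglyMeasurable_mk.measurable)
    (measurable_rext q hg.memLp.1.stronglyMeasurable_mk.measurable)
    ((hf.congr ef).eLpNorm_rext_diff_le (hg.congr eg) hab) (fun W hW => ?_) hW
  rw [← gagliardoSq_congr (rext_congr eg q hW)]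
  exact hfin W hW

/-! ### Translations and periodic functions -/

lemma partialDeriv_translate (φ : E d → ℝ) (c : E d) (i : Fin d) (x : E d) :
    partialDeriv i (fun y => φ (y + c)) x = partialDeriv i φ (x + c) := by
  unfold partialDeriv
  rw [fderiv_comp_add_right]

lemma IsTest.translate {U : Set (E d)} {φ : E d → ℝ} (h : IsTest U φ) (c : E d) :
    IsTest univ (fun x => φ (x + c)) where
  smooth := h.smooth.comp (by fun_prop)
  compact := h.compact.comp_homeomorph (Homeomorph.addRight c)
  support := subset_univ _

lemma LocallyIntegrable.translate {u : E d → ℝ} (hu : LocallyIntegrable u) (c : E d) :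
    LocallyIntegrable fun x => u (x + c) := by
  rw [locallyIntegrable_iff] at hu ⊢
  intro K hK
  have h1 := hu _ (hK.image (Homeomorph.addRight c).continuous)
  have h2 := (measurePreserving_add_right (volume : Measure (E d)) c).integrableOn_image
    (Homeomorph.addRight c).measurableEmbedding (f := u) (s := K)
  exact h2.1 h1

lemma HasWeakPartial.translate {i : Fin d} {u v : E d → ℝ} (h : HasWeakPartial univ i u v)
    (c : E d) : HasWeakPartial univ i (fun x => u (x + c)) (fun x => v (x + c)) where
  locInt := locallyIntegrableOn_univ.2
    (LocallyIntegrable.translate (locallyIntegrableOn_univ.1 h.locInt) c)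
  locInt_deriv := locallyIntegrableOn_univ.2
    (LocallyIntegrable.translate (locallyIntegrableOn_univ.1 h.locInt_deriv) c)
  integral_eq φ hφ := by
    have h1 := h.integral_eq _ (hφ.translate (-c))
    simp only [setIntegral_univ, partialDeriv_translate] at h1 ⊢
    have e : ∀ w ψ : E d → ℝ, ∫ x, w (x + c) * ψ x = ∫ x, w x * ψ (x + -c) := fun w ψ => by
      rw [← integral_add_right_eq_self (fun x => w x * ψ (x + -c)) c]
      simp
    rw [e, e, h1]

/-- A lattice translate of `v` is a weak derivative of the translate of `u`, that is, of `u` itself;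
uniqueness applies. -/
lemma HasWeakPartial.isPeriodic {i : Fin d} {u v : E d → ℝ} (h : HasWeakPartial univ i u v)
    (hu : IsPeriodic u) : IsPeriodic v := by
  intro k
  have hk : (fun x => u (x + WithLp.toLp 2 fun i => 4 * (k i : ℝ))) =ᵐ[volume.restrict univ] u :=
    ae_restrict_of_ae (hu k)
  have h2 := ((h.translate _).congr isOpen_univ hk (ae_eq_refl _)).unique isOpen_univ h
  rwa [Measure.restrict_univ] at h2

/-- The half-open cell of the lattice. -/
def cell (d : ℕ) : Set (E d) := {x | ∀ i, x i ∈ Ico (-1 : ℝ) 3}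

lemma measurableSet_cell : MeasurableSet (cell d) := by
  have : cell d = ⋂ i, (fun x : E d => x i) ⁻¹' Ico (-1 : ℝ) 3 := by ext x; simp [cell]
  rw [this]
  exact MeasurableSet.iInter fun i => measurableSet_Ico.preimage (by fun_prop)

lemma cell_ae_eq_Theta : cell d =ᵐ[volume] Theta d := by
  have h : ∀ᵐ x : E d, ∀ i, x i ≠ -1 := ae_all_iff.2 fun i => ae_apply_ne i (-1)
  filter_upwards [h] with x hx
  refine propext ⟨fun h' i => ⟨lt_of_le_of_ne (h' i).1 (hx i).symm, (h' i).2⟩,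
    fun h' i => ⟨(h' i).1.le, (h' i).2⟩⟩

/-- The lattice vector with coordinates `0` or `4`. -/
noncomputable def corner (κ : Fin d → Fin 2) : E d :=
  WithLp.toLp 2 fun i => 4 * (((κ i : ℕ) : ℤ) : ℝ)

lemma corner_apply (κ : Fin d → Fin 2) (i : Fin d) : corner κ i = 4 * ((κ i : ℕ) : ℝ) := by
  simp [corner]

/-- The cube `(-1, 7)^d`, the interior of the union of `2^d` cells. -/
def doubleBox (d : ℕ) : Set (E d) := {x | ∀ i, x i ∈ Ioo (-1 : ℝ) 7}

/-- The half-open cells translated by the corners are disjoint and cover (-1, 7)^d exactly, so the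
integral unfolds onto one cell. -/
lemma integral_eq_sum_cell {f : E d → ℝ} (hf : Integrable f) (h0 : ∀ x ∉ doubleBox d, f x = 0) :
    ∫ x, f x = ∑ κ : Fin d → Fin 2, ∫ x in cell d, f (x + corner κ) := by
  set C : (Fin d → Fin 2) → Set (E d) := fun κ => (fun x => x + -corner κ) ⁻¹' cell d with hC
  have hmem : ∀ κ x, x ∈ C κ ↔ ∀ i, -1 ≤ x i - 4 * ((κ i : ℕ) : ℝ) ∧
      x i - 4 * ((κ i : ℕ) : ℝ) < 3 := fun κ x => by
    simp [hC, cell, corner_apply, sub_eq_add_neg]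
  have hCm : ∀ κ, MeasurableSet (C κ) := fun κ => measurableSet_cell.preimage (by fun_prop)
  have hdis : Pairwise (Function.onFun Disjoint C) := by
    intro κ κ' hne
    refine Set.disjoint_left.2 fun x hx hx' => hne ?_
    rw [hmem] at hx hx'
    ext i
    have h1 := hx i
    have h2 := hx' i
    have h3 : ((κ i : ℕ) : ℝ) < (κ' i : ℕ) + 1 := by linarith
    have h4 : ((κ' i : ℕ) : ℝ) < (κ i : ℕ) + 1 := by linarith
    norm_cast at h3 h4
    omega
  have hcov : ∀ x ∉ ⋃ κ, C κ, f x = 0 := by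
    intro x hx
    refine h0 x fun hb => hx (mem_iUnion.2 ⟨fun i => if x i < 3 then 0 else 1, ?_⟩)
    rw [hmem]
    intro i
    have := hb i
    split_ifs with h
    · simp only [Fin.val_zero, Nat.cast_zero]; constructor <;> linarith [this.1]
    · simp only [Fin.val_one, Nat.cast_one]; constructor <;> linarith [this.2]
  rw [← setIntegral_eq_integral_of_forall_compl_eq_zero hcov,
    integral_iUnion_fintype hCm hdis fun κ => hf.integrableOn]
  refine Finset.sum_congr rfl fun κ _ => ?_
  rw [← (measurePreserving_add_right (volume : Measure (E d)) (corner κ)).setIntegral_preimage_emb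
    (Homeomorph.addRight (corner κ)).measurableEmbedding f (C κ)]
  congr 2
  ext x
  simp [hC]

/-- The sum of the translates of a function over the corners. -/
noncomputable def cornerSum (φ : E d → ℝ) (x : E d) : ℝ :=
  ∑ κ : Fin d → Fin 2, φ (x + corner κ)

lemma integral_mul_eq_cornerSum {u φ : E d → ℝ} (hu : LocallyIntegrable u) (hper : IsPeriodic u)
    (hφ : IsTest (doubleBox d) φ) :
    ∫ x, u x * φ x = ∫ x in Theta d, u x * cornerSum φ x := by
  rw [integral_eq_sum_cell (hφ.integrable_mul (hu.locallyIntegrableOn _))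
    fun x hx => by rw [hφ.zero_of_notMem hx, mul_zero], ← setIntegral_congr_set cell_ae_eq_Theta]
  have h1 : ∀ κ, ∫ x in cell d, u (x + corner κ) * φ (x + corner κ) =
      ∫ x in cell d, u x * φ (x + corner κ) := fun κ => by
    refine integral_congr_ae (ae_restrict_of_ae ?_)
    filter_upwards [hper fun i => ((κ i : ℕ) : ℤ)] with x hx
    have : u (x + corner κ) = u x := hx
    rw [this]
  simp only [h1, cornerSum, Finset.mul_sum]
  rw [integral_finsetSum]
  intro κ _
  exact ((hφ.translate _).integrable_mul (hu.locallyIntegrableOn _)).integrableOn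

lemma partialDeriv_cornerSum {φ : E d → ℝ} (hφ : ContDiff ℝ ∞ φ) (i : Fin d) (x : E d) :
    partialDeriv i (cornerSum φ) x = cornerSum (partialDeriv i φ) x := by
  have h1 : ∀ κ : Fin d → Fin 2, DifferentiableAt ℝ (fun y => φ (y + corner κ)) x := fun κ =>
    (hφ.comp (by fun_prop)).differentiable (by simp) x
  have e : cornerSum φ = fun y => ∑ κ : Fin d → Fin 2, φ (y + corner κ) := rfl
  have h2 := fderiv_fun_sum (u := Finset.univ) fun κ _ => h1 κ
  have h3 : ∀ κ : Fin d → Fin 2, partialDeriv i φ (x + corner κ) =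
      fderiv ℝ (fun y => φ (y + corner κ)) x (EuclideanSpace.single i 1) := fun κ =>
    (partialDeriv_translate φ (corner κ) i x).symm
  simp only [cornerSum, h3]
  unfold partialDeriv
  rw [e, h2]
  simp

/-- The profile whose translates by `4` sum to `1`. -/
noncomputable def profile (t : ℝ) : ℝ :=
  Real.smoothTransition t - Real.smoothTransition (t - 4)

lemma contDiff_profile : ContDiff ℝ ∞ profile :=
  contDiff_smoothTransition.sub (contDiff_smoothTransition.comp (by fun_prop))

lemma profile_eq_zero {t : ℝ} (h : t ∉ Icc (0 : ℝ) 5) : profile t = 0 := by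
  unfold profile
  by_cases h1 : 0 ≤ t
  · have h2 : 5 < t := by
      by_contra h3; exact h ⟨h1, not_lt.1 h3⟩
    rw [Real.smoothTransition.one_of_one_le (by linarith),
      Real.smoothTransition.one_of_one_le (by linarith), sub_self]
  · rw [Real.smoothTransition.zero_of_nonpos (by linarith),
      Real.smoothTransition.zero_of_nonpos (by linarith), sub_self]

/-- The sum telescopes: the middle terms cancel, and on (-1, 3) the outer ones are already 1 and 0.
-/
lemma profile_add_profile {t : ℝ} (h : t ∈ Ioo (-1 : ℝ) 3) : profile t + profile (t + 4) = 1 := by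
  unfold profile
  rw [Real.smoothTransition.zero_of_nonpos (x := t - 4) (by linarith [h.2]),
    Real.smoothTransition.one_of_one_le (x := t + 4) (by linarith [h.1]), add_sub_cancel_right]
  ring

/-- A test function whose translates by the lattice sum to `1`. -/
noncomputable def window (d : ℕ) : E d → ℝ := tprod fun _ => profile

lemma isTest_window : IsTest (doubleBox d) (window d) := by
  have hsub : tsupport (window d) ⊆ {x | ∀ i, x i ∈ Icc (0 : ℝ) 5} := by
    refine closure_minimal (fun x hx i => ?_) ?_
    · by_contra h
      exact hx (Finset.prod_eq_zero (Finset.mem_univ i) (profile_eq_zero h))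
    · have : {x : E d | ∀ i, x i ∈ Icc (0 : ℝ) 5} =
          ⋂ i, (fun x : E d => x i) ⁻¹' Icc (0 : ℝ) 5 := by ext x; simp
      rw [this]
      exact isClosed_iInter fun i => isClosed_Icc.preimage (by fun_prop)
  have hsub2 : tsupport (window d) ⊆ doubleBox d := fun x hx i =>
    ⟨by linarith [(hsub hx i).1], by linarith [(hsub hx i).2]⟩
  refine ⟨contDiff_tprod fun _ => contDiff_profile, ?_, hsub2⟩
  exact Metric.isCompact_of_isClosed_isBounded (isClosed_tsupport _)
    ((isBounded_box (-1) 7).subset hsub2)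

/-- The sum over corners of a product is the product over coordinates of two-term sums, each equal
to 1. -/
lemma cornerSum_window {x : E d} (hx : x ∈ Theta d) : cornerSum (window d) x = 1 := by
  have h := Fintype.prod_sum (fun (i : Fin d) (j : Fin 2) => profile (x i + 4 * ((j : ℕ) : ℝ)))
  have h2 : ∀ κ : Fin d → Fin 2, window d (x + corner κ) =
      ∏ i, profile (x i + 4 * ((κ i : ℕ) : ℝ)) := fun κ => by
    simp [window, tprod, corner_apply]
  simp only [cornerSum, h2]
  rw [← h]
  refine Finset.prod_eq_one fun i _ => ?_
  rw [Fin.sum_univ_two]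
  simpa using profile_add_profile (hx i)

/-- Integration by parts against smooth periodic functions. -/
lemma HasWeakPartial.setIntegral_Theta {i : Fin d} {u v ψ : E d → ℝ}
    (h : HasWeakPartial univ i u v) (hu : IsPeriodic u) (hψ : ContDiff ℝ ∞ ψ)
    (hper : ∀ (k : Fin d → ℤ) (x : E d),
      ψ (x + WithLp.toLp 2 (fun i => 4 * (k i : ℝ))) = ψ x) :
    ∫ x in Theta d, v x * ψ x = -∫ x in Theta d, u x * partialDeriv i ψ x := by
  -- A periodic `ψ` is not a test function. Multiplied by the window it becomes one, and its
  -- translates still sum to `ψ` on Θ, so the definition of the weak derivative yields the periodic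
  -- formula.
  set φ : E d → ℝ := fun x => ψ x * window d x with hφ
  have ht : IsTest (doubleBox d) φ := isTest_window.mul_smooth hψ
  have h1 := h.integral_eq φ (ht.mono (subset_univ _))
  simp only [setIntegral_univ] at h1
  rw [integral_mul_eq_cornerSum (locallyIntegrableOn_univ.1 h.locInt) hu (ht.partialDeriv i),
    integral_mul_eq_cornerSum (locallyIntegrableOn_univ.1 h.locInt_deriv) (h.isPeriodic hu) ht]
    at h1
  have hS : ∀ x ∈ Theta d, cornerSum φ x = ψ x := fun x hx => by
    have e : ∀ κ : Fin d → Fin 2, φ (x + corner κ) = ψ x * window d (x + corner κ) := fun κ => by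
      have : ψ (x + corner κ) = ψ x := hper (fun i => ((κ i : ℕ) : ℤ)) x
      simp only [hφ, this]
    have e2 := cornerSum_window hx
    unfold cornerSum at e2 ⊢
    simp only [e]
    rw [← Finset.mul_sum, e2, mul_one]
  have hS' : ∀ x ∈ Theta d, cornerSum (partialDeriv i φ) x = partialDeriv i ψ x := fun x hx => by
    rw [← partialDeriv_cornerSum ht.smooth]
    unfold partialDeriv
    have : cornerSum φ =ᶠ[𝓝 x] ψ := by
      filter_upwards [isOpen_Theta.mem_nhds hx] with y hy using hS y hy
    rw [this.fderiv_eq]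
  have e1 : ∫ x in Theta d, u x * cornerSum (partialDeriv i φ) x =
      ∫ x in Theta d, u x * partialDeriv i ψ x :=
    setIntegral_congr_fun measurableSet_Theta fun x hx => by rw [hS' x hx]
  have e2 : ∫ x in Theta d, v x * cornerSum φ x = ∫ x in Theta d, v x * ψ x :=
    setIntegral_congr_fun measurableSet_Theta fun x hx => by rw [hS x hx]
  rw [e1, e2] at h1
  rw [h1, neg_neg]

/-! ### Functions with vanishing gradient -/

lemma HasWeakPartial.integral_comp_sub_eq_zero {i : Fin d} {u φ : E d → ℝ}
    (h : HasWeakPartial univ i u 0) (hφ : IsTest univ φ) (x : E d) :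
    ∫ t, u t * partialDeriv i φ (x - t) = 0 := by
  have ht : IsTest univ fun t => φ (x - t) :=
    ⟨hφ.smooth.comp (by fun_prop), hφ.compact.comp_homeomorph (Homeomorph.subLeft x),
      subset_univ _⟩
  have h1 := h.integral_eq _ ht
  have e : ∀ t, partialDeriv i (fun t => φ (x - t)) t = -partialDeriv i φ (x - t) := fun t => by
    unfold partialDeriv
    have h2 := ((hφ.smooth.differentiable (by simp)) (x - t)).hasFDerivAt.comp t
      ((hasFDerivAt_id t).const_sub x)
    have h3 : fderiv ℝ (fun t => φ (x - t)) t = _ := h2.fderiv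
    rw [h3]
    simp
  simp only [setIntegral_univ, e, mul_neg, integral_neg, Pi.zero_apply, zero_mul,
    integral_zero, neg_zero, neg_eq_zero] at h1
  exact h1

open ContinuousLinearMap in
-- Derivatives of the mollification fall on `φ`, where they become the weak derivative of `u` tested
-- against a reflected translate, which is zero.
lemma convolution_const_of_hasWeakGradient_zero {u φ : E d → ℝ}
    (h : HasWeakGradient univ u fun _ => 0) (hu : LocallyIntegrable u) (hφ : IsTest univ φ)
    (x y : E d) : convolution u φ (lsmul ℝ ℝ) volume x = convolution u φ (lsmul ℝ ℝ) volume y := by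
  have hd := hφ.compact.hasFDerivAt_convolution_right (lsmul ℝ ℝ) hu (hφ.smooth.of_le (by simp))
  refine is_const_of_fderiv_eq_zero (𝕜 := ℝ) (fun x => (hd x).differentiableAt) (fun x => ?_) x y
  rw [(hd x).fderiv]
  have hb : ∀ i : Fin d, convolution u (fderiv ℝ φ) (precompR (E d) (lsmul ℝ ℝ)) volume x
      (EuclideanSpace.single i 1) = 0 := fun i => by
    rw [convolution_precompR_apply _ hu (hφ.compact.fderiv ℝ)
      (hφ.smooth.continuous_fderiv (by simp)), convolution_def]
    exact (h i).integral_comp_sub_eq_zero hφ x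
  refine ContinuousLinearMap.coe_injective
    ((EuclideanSpace.basisFun (Fin d) ℝ).toBasis.ext fun i => ?_)
  simpa using hb i

open ContinuousLinearMap in
-- Mollifications are constant and converge to `u` almost everywhere along shrinking bumps.
lemma ae_const_of_hasWeakGradient_zero {u : E d → ℝ} (h : HasWeakGradient univ u fun _ => 0)
    (hu : LocallyIntegrable u) : ∃ c, ∀ᵐ x, u x = c := by
  let φ : ℕ → ContDiffBump (0 : E d) := fun n =>
    ⟨1 / ((n : ℝ) + 1), 2 / ((n : ℝ) + 1), by positivity, by gcongr; norm_num⟩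
  have hr : Tendsto (fun n => (φ n).rOut) atTop (𝓝 0) :=
    tendsto_const_div_atTop_nhds_zero_nat 2 |>.comp (tendsto_add_atTop_nat 1) |>.congr
      fun n => by simp [φ]
  have hK : ∀ᶠ n in atTop, (φ n).rOut ≤ 2 * (φ n).rIn := Eventually.of_forall fun n => by
    simp only [φ]; rw [mul_one_div]
  have hlim := ContDiffBump.ae_convolution_tendsto_right_of_locallyIntegrable (μ := volume) hr hK hu
  have ht : ∀ n, IsTest univ ((φ n).normed volume) := fun n =>
    ⟨(φ n).contDiff_normed, (φ n).hasCompactSupport_normed, subset_univ _⟩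
  have hconst : ∀ n x y, convolution ((φ n).normed volume) u (lsmul ℝ ℝ) volume x =
      convolution ((φ n).normed volume) u (lsmul ℝ ℝ) volume y := by
    intro n x y
    have := convolution_const_of_hasWeakGradient_zero h hu (ht n) x y
    rw [← convolution_flip] at this
    have e : (lsmul ℝ ℝ : ℝ →L[ℝ] ℝ →L[ℝ] ℝ).flip = lsmul ℝ ℝ := by
      ext; simp
    rwa [e] at this
  obtain ⟨x0, hx0⟩ := hlim.exists
  refine ⟨u x0, ?_⟩
  filter_upwards [hlim] with x hx
  exact tendsto_nhds_unique hx (hx0.congr fun n => hconst n x0 x)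

/-! ### The periodic problem -/

lemma exists_isOpen_superset {W : Set (E d)} (hW : Bornology.IsBounded W) :
    ∃ V, IsOpen V ∧ Bornology.IsBounded V ∧ W ⊆ V := by
  obtain ⟨R, hR⟩ := hW.subset_ball 0
  exact ⟨_, Metric.isOpen_ball, Metric.isBounded_ball, hR⟩

lemma MemHLoc.memL2Loc {v : E d → ℝ} (h : MemHLoc 1 v) : MemL2Loc v := by
  intro W hW
  obtain ⟨V, hV, hVb, hWV⟩ := exists_isOpen_superset hW
  have h1 := h V hV hVb
  unfold MemH at h1
  rw [Nat.floor_one] at h1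
  exact h1.1.mono_measure (Measure.restrict_mono hWV le_rfl)

lemma MemHLoc.memL2Loc_gradient {v : E d → ℝ} {G : Fin d → E d → ℝ} (h : MemHLoc 1 v)
    (hG : HasWeakGradient univ v G) (i : Fin d) : MemL2Loc (G i) := by
  intro W hW
  obtain ⟨V, hV, hVb, hWV⟩ := exists_isOpen_superset hW
  have h1 := h V hV hVb
  unfold MemH at h1
  rw [Nat.floor_one] at h1
  obtain ⟨w, hw, hw2⟩ := h1.2 i
  exact (hw2.1.ae_eq (hw.unique hV ((hG i).mono (subset_univ _)))).mono_measure
    (Measure.restrict_mono hWV le_rfl)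

lemma memHLoc_one {v : E d → ℝ} {G : Fin d → E d → ℝ} (hv : MemL2Loc v)
    (hG : HasWeakGradient univ v G) (hG2 : ∀ i, MemL2Loc (G i)) : MemHLoc 1 v := by
  intro W _ hW
  unfold MemH
  rw [Nat.floor_one]
  exact ⟨hv W hW, fun i => ⟨G i, (hG i).mono (subset_univ _), hG2 i W hW, fun h => by simp at h⟩⟩

lemma isPeriodic_rext (p : Fin d → ℕ) (f : E d → ℝ) : IsPeriodic (rext p f) := fun k =>
  Eventually.of_forall fun x => rext_periodic p f x k

lemma psum_periodic (a : (Fin d → ℕ) → ℝ) (p : Fin d → ℕ) (F : Finset (Fin d → ℕ))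
    (k : Fin d → ℤ) (x : E d) :
    psum a p F (x + WithLp.toLp 2 (fun i => 4 * (k i : ℝ))) = psum a p F x := by
  rw [psum_eq_rext, rext_periodic]

lemma sum_setIntegral_Theta_psum {v : E d → ℝ} {Gv : Fin d → E d → ℝ} (hv : MemL2Loc v)
    (hper : IsPeriodic v) (hGv : HasWeakGradient univ v Gv) (a : (Fin d → ℕ) → ℝ)
    (F : Finset (Fin d → ℕ)) :
    ∑ i, ∫ x in Theta d, psum a (0 + Pi.single i 1) F x * Gv i x =
      ∫ x in Theta d, psum (fun k => a k * eigen k) 0 F x * v x := by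
  have h1 : ∀ i, ∫ x in Theta d, psum a (0 + Pi.single i 1) F x * Gv i x =
      -∫ x in Theta d, psum a (0 + Pi.single i 1 + Pi.single i 1) F x * v x := by
    intro i
    have := (hGv i).setIntegral_Theta hper (contDiff_psum a (0 + Pi.single i 1) F)
      (psum_periodic _ _ _)
    rw [partialDeriv_psum] at this
    simpa only [mul_comm] using this
  simp only [h1]
  have h2 : ∀ i, IntegrableOn (fun x => psum a (0 + Pi.single i 1 + Pi.single i 1) F x * v x)
      (Theta d) := fun i =>
    (memLp_of_continuous isBounded_Theta (contDiff_psum a _ F).continuous 2).integrable_mul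
      (hv _ isBounded_Theta)
  rw [Finset.sum_neg_distrib, ← integral_finsetSum _ fun i _ => h2 i, ← integral_neg]
  refine integral_congr_ae (Eventually.of_forall fun x => ?_)
  simp only
  rw [← Finset.sum_mul, sum_psum_add_two]
  ring

lemma setIntegral_Theta_gradient_mul (hd : 0 < d) {g : E d → ℝ} {G : Fin d → E d → ℝ}
    (hg : MemLp g 2 (volume.restrict (Omega d)))
    (hG : ∀ i, SeriesLim (0 + Pi.single i 1) (fun k => coef g k / eigen k) (G i))
    {v : E d → ℝ} {Gv : Fin d → E d → ℝ} (hv : MemHPer 1 v) (hGv : HasWeakGradient univ v Gv) :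
    ∫ x in Theta d, ∑ i, rext (0 + Pi.single i 1) (G i) x * Gv i x =
      ∫ x in Theta d, rext 0 g x * v x := by
  have hb := isBounded_Theta (d := d)
  have hv2 := hv.1.memL2Loc
  have hGv2 := fun i => hv.1.memL2Loc_gradient hGv i _ hb
  have hc : ∀ a p F, MemLp (psum a p F) 2 (volume.restrict (Theta d)) := fun a p F =>
    memLp_of_continuous hb (contDiff_psum a p F).continuous 2
  have l1 := tendsto_finsetSum (Finset.univ : Finset (Fin d)) fun i _ =>
    ((hG i).tendsto_rext hb).integral_mul (fun F => hc _ _ F) (MemLp.rext (hG i).memLp _ _ hb)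
      (hGv2 i)
  have l2 := ((seriesLim_coef hg).tendsto_rext hb).integral_mul (fun F => hc _ _ F)
    (MemLp.rext hg _ _ hb) (hv2 _ hb)
  simp only [sum_setIntegral_Theta_psum hv2 hv.2 hGv, eigen_mul_cancel hd] at l1
  rw [integral_finsetSum _ fun i _ =>
    integrable_mul_of_memLp_two (MemLp.rext (hG i).memLp _ _ hb) (hGv2 i)]
  exact tendsto_nhds_unique l1 l2

lemma fpow_zero (k : Fin d → ℕ) : fpow k 0 = 1 := by simp [fpow]

lemma summable_coef_sq {f : E d → ℝ} (hf : MemLp f 2 (volume.restrict (Omega d))) :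
    Summable fun k => coef f k ^ 2 := by
  simpa only [coef, fpow_zero, div_one] using summable_integral_mul_sine hf 0

lemma summable_of_pow_eigen (hd : 0 < d) {c : (Fin d → ℕ) → ℝ} {N : ℕ}
    (h : Summable fun k => c k ^ 2 * eigen k ^ N) {q : Fin d → ℕ} (hq : ∑ i, q i ≤ N) :
    Summable fun k => (c k * fpow k q) ^ 2 := by
  refine h.of_nonneg_of_le (fun k => sq_nonneg _) fun k => ?_
  rw [mul_pow]
  exact mul_le_mul_of_nonneg_left
    ((fpow_sq_le k q).trans (pow_le_pow_right₀ (one_le_eigen hd k) hq)) (sq_nonneg _)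

lemma eigen_pos (hd : 0 < d) (k : Fin d → ℕ) : 0 < eigen k := one_pos.trans_le (one_le_eigen hd k)

lemma exists_seriesLim_gradient (hd : 0 < d) {g : E d → ℝ}
    (hg : MemLp g 2 (volume.restrict (Omega d))) :
    ∃ G : Fin d → E d → ℝ,
      ∀ i, SeriesLim (0 + Pi.single i 1) (fun k => coef g k / eigen k) (G i) := by
  refine Classical.axiomOfChoice fun i : Fin d => exists_seriesLim ?_
  refine summable_of_pow_eigen hd (N := 2) ?_ ?_
  · refine (summable_coef_sq hg).congr fun k => ?_
    rw [div_pow, div_mul_cancel₀ _ (pow_pos (eigen_pos hd k) 2).ne']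
  · simp [Finset.sum_pi_single']

/-- The mean is found by testing the periodic equation with v = 1, whose gradient vanishes. -/
lemma setIntegral_Theta_rext (hd : 0 < d) {g : E d → ℝ}
    (hg : MemLp g 2 (volume.restrict (Omega d))) : ∫ x in Theta d, rext 0 g x = 0 := by
  obtain ⟨G, hG⟩ := exists_seriesLim_gradient hd hg
  have h1 : HasWeakGradient univ (fun _ : E d => (1 : ℝ)) fun _ _ => 0 := fun i => by
    have := hasWeakPartial_of_contDiff (contDiff_const (c := (1 : ℝ))) (univ : Set (E d)) i
    have e : partialDeriv i (fun _ : E d => (1 : ℝ)) = fun _ => 0 := by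
      ext x; simp [partialDeriv]
    rwa [e] at this
  have h2 : MemHPer 1 fun _ : E d => (1 : ℝ) :=
    ⟨memHLoc_one (memL2Loc_of_continuous continuous_const) h1
      fun _ => memL2Loc_of_continuous continuous_const, fun _ => Eventually.of_forall fun _ => rfl⟩
  have h3 := setIntegral_Theta_gradient_mul hd hg hG h2 h1
  simpa using h3.symm

lemma isPeriodicSolution_rext (hd : 0 < d) {g u : E d → ℝ}
    (hg : MemLp g 2 (volume.restrict (Omega d)))
    (hu : SeriesLim 0 (fun k => coef g k / eigen k) u) :
    IsPeriodicSolution (rext 0 g) (rext 0 u) := by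
  obtain ⟨G, hG⟩ := exists_seriesLim_gradient hd hg
  have h1 : HasWeakGradient univ (rext 0 u) fun i => rext (0 + Pi.single i 1) (G i) :=
    fun i => hu.hasWeakPartial (hG i)
  exact ⟨⟨memHLoc_one (MemLp.rext hu.memLp 0) h1 fun i => MemLp.rext (hG i).memLp _,
    isPeriodic_rext 0 u⟩, setIntegral_Theta_rext hd hu.memLp, _, h1,
    fun v Gv hv hGv => setIntegral_Theta_gradient_mul hd hg hG hv hGv⟩

lemma IsPeriodic.ae_eq_zero {v : E d → ℝ} (h : IsPeriodic v)
    (h0 : ∀ᵐ x ∂(volume.restrict (Theta d)), v x = 0) : ∀ᵐ x, v x = 0 := by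
  rw [← Measure.restrict_congr_set cell_ae_eq_Theta, ae_restrict_iff' measurableSet_cell] at h0
  have h1 : ∀ᵐ x : E d, ∀ k : Fin d → ℤ,
      x + WithLp.toLp 2 (fun i => 4 * (k i : ℝ)) ∈ cell d →
        v (x + WithLp.toLp 2 (fun i => 4 * (k i : ℝ))) = 0 := ae_all_iff.2 fun k =>
    (measurePreserving_add_right (volume : Measure (E d)) _).quasiMeasurePreserving.ae h0
  filter_upwards [h1, ae_all_iff.2 h] with x hx hx'
  have h2 := hx (fun i => -⌊(x i + 1) / 4⌋) fun i => by
    have f1 := Int.floor_le ((x i + 1) / 4)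
    have f2 := Int.lt_floor_add_one ((x i + 1) / 4)
    simp only [PiLp.add_apply, Int.cast_neg]
    constructor <;> linarith
  rwa [hx'] at h2

/-- Energy argument: testing with the difference shows that its gradient vanishes on Θ, hence
everywhere by periodicity. The difference is then constant, and zero by the mean condition. -/
lemma IsPeriodicSolution.ae_eq {h u u' : E d → ℝ} (hu : IsPeriodicSolution h u)
    (hu' : IsPeriodicSolution h u') : ∀ᵐ x, u x = u' x := by
  obtain ⟨⟨hl, hp⟩, hm, G, hG, hw⟩ := hu
  obtain ⟨⟨hl', hp'⟩, hm', G', hG', hw'⟩ := hu'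
  have hb := isBounded_Theta (d := d)
  set w : E d → ℝ := fun x => u x - u' x with hwdef
  set Gw : Fin d → E d → ℝ := fun i x => G i x - G' i x with hGwdef
  have hGw : HasWeakGradient univ w Gw := fun i => (hG i).sub (hG' i)
  have hG2 := fun i => hl.memL2Loc_gradient hG i
  have hG2' := fun i => hl'.memL2Loc_gradient hG' i
  have hw2 : MemL2Loc w := fun W hW => (hl.memL2Loc W hW).sub (hl'.memL2Loc W hW)
  have hGw2 : ∀ i, MemL2Loc (Gw i) := fun i W hW => (hG2 i W hW).sub (hG2' i W hW)
  have hwp : IsPeriodic w := fun k => by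
    filter_upwards [hp k, hp' k] with x h1 h2
    simp only [hwdef, h1, h2]
  have hwm : MemHPer 1 w := ⟨memHLoc_one hw2 hGw hGw2, hwp⟩
  have e1 := (hw w Gw hwm hGw).trans (hw' w Gw hwm hGw).symm
  have i1 : ∀ i, IntegrableOn (fun x => G i x * Gw i x) (Theta d) := fun i =>
    integrable_mul_of_memLp_two (hG2 i _ hb) (hGw2 i _ hb)
  have i2 : ∀ i, IntegrableOn (fun x => G' i x * Gw i x) (Theta d) := fun i =>
    integrable_mul_of_memLp_two (hG2' i _ hb) (hGw2 i _ hb)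
  have i3 : IntegrableOn (fun x => ∑ i, Gw i x ^ 2) (Theta d) :=
    integrable_finsetSum _ fun i _ => (hGw2 i _ hb).integrable_sq
  have e2 : ∫ x in Theta d, ∑ i, Gw i x ^ 2 = 0 := by
    rw [← sub_eq_zero, ← integral_sub (integrable_finsetSum _ fun i _ => i1 i)
      (integrable_finsetSum _ fun i _ => i2 i)] at e1
    rw [← e1]
    refine integral_congr_ae (Eventually.of_forall fun x => ?_)
    simp only
    rw [← Finset.sum_sub_distrib]
    refine Finset.sum_congr rfl fun i _ => ?_
    simp only [hGwdef]
    ring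
  have e3 := (integral_eq_zero_iff_of_nonneg (fun x => Finset.sum_nonneg fun i _ => sq_nonneg _)
    i3).1 e2
  have hz : ∀ i, ∀ᵐ x, Gw i x = 0 := fun i => ((hGw i).isPeriodic hwp).ae_eq_zero (by
    filter_upwards [e3] with x hx
    have := (Finset.sum_eq_zero_iff_of_nonneg fun i _ => sq_nonneg (Gw i x)).1 hx i
      (Finset.mem_univ i)
    exact pow_eq_zero_iff (two_ne_zero) |>.1 this)
  have hGw0 : HasWeakGradient univ w fun _ => 0 := fun i =>
    (hGw i).congr isOpen_univ (ae_eq_refl _) (ae_restrict_of_ae (hz i))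
  obtain ⟨c, hc⟩ := ae_const_of_hasWeakGradient_zero hGw0 hw2.locallyIntegrable
  have := isFiniteMeasure_restrict hb
  have m1 : ∫ x in Theta d, w x = 0 := by
    rw [integral_sub ((hl.memL2Loc _ hb).integrable (by norm_num))
      ((hl'.memL2Loc _ hb).integrable (by norm_num)), hm, hm', sub_zero]
  rw [integral_congr_ae (ae_restrict_of_ae hc), setIntegral_const, smul_eq_mul] at m1
  have hpos : volume.real (Theta d) ≠ 0 := by
    have hne : (Theta d).Nonempty := ⟨0, fun i => by constructor <;> norm_num⟩
    exact (ENNReal.toReal_pos (isOpen_Theta.measure_pos volume hne).ne'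
      hb.measure_lt_top.ne).ne'
  have hc0 : c = 0 := (mul_eq_zero.1 m1).resolve_left hpos
  filter_upwards [hc] with x hx
  rw [hc0] at hx
  exact sub_eq_zero.1 hx

/-! ### Regularity -/

lemma MemHAux.congr {U : Set (E d)} (hU : IsOpen U) {σ : ℝ} {n : ℕ} {u v : E d → ℝ}
    (h : MemHAux U σ n u) (huv : u =ᵐ[volume.restrict U] v) : MemHAux U σ n v := by
  cases n with
  | zero => exact ⟨h.1.ae_eq huv, fun hσ => gagliardoSq_congr huv ▸ h.2 hσ⟩
  | succ n =>
    refine ⟨h.1.ae_eq huv, fun i => ?_⟩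
    obtain ⟨w, hw, hw2⟩ := h.2 i
    exact ⟨w, hw.congr hU huv (ae_eq_refl _), hw2⟩

/-- Sobolev regularity of the sum of a trigonometric series. -/
lemma SeriesLim.memHAux_rext {a : (Fin d → ℕ) → ℝ} {σ : ℝ} {W : Set (E d)}
    (hW : Bornology.IsBounded W) {n : ℕ} : ∀ {p : Fin d → ℕ} {f : E d → ℝ}, SeriesLim p a f →
    (∀ q : Fin d → ℕ, ∑ i, q i ≤ n → Summable fun k => (a k * fpow k (p + q)) ^ 2) →
    (0 < σ → ∀ (q : Fin d → ℕ) (f' : E d → ℝ), ∑ i, q i = n → SeriesLim (p + q) a f' →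
      gagliardoSq W σ (rext (p + q) f') < ⊤) → MemHAux W σ n (rext p f) := by
  induction n with
  | zero =>
    intro p f hf _ hσ
    refine ⟨MemLp.rext hf.memLp p W hW, fun h => ?_⟩
    have := hσ h 0 f (by simp) (by rwa [add_zero])
    rwa [add_zero] at this
  | succ n ih =>
    intro p f hf hs hσ
    refine ⟨MemLp.rext hf.memLp p W hW, fun i => ?_⟩
    have hsum : ∀ q : Fin d → ℕ, ∑ j, (Pi.single i 1 + q : Fin d → ℕ) j = 1 + ∑ j, q j := fun q => by
      simp [Finset.sum_add_distrib]
    obtain ⟨f', hf'⟩ := exists_seriesLim (hs (Pi.single i 1) (by simp))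
    refine ⟨_, (hf.hasWeakPartial hf').mono (subset_univ _), ih hf' (fun q hq => ?_)
      fun h q f'' hq hf'' => ?_⟩
    · rw [add_assoc]
      exact hs _ (by rw [hsum]; omega)
    · rw [add_assoc] at hf'' ⊢
      exact hσ h _ f'' (by rw [hsum]; omega) hf''

/-- The endpoint s = 2 has no fractional part, but its integer part jumps to 2, so it needs a
separate argument. For s = 1 the seminorm condition in the first case is void. -/
lemma MemH.cases {s : ℝ} (hs : s ∈ Icc (1 : ℝ) 2) {U : Set (E d)} {g : E d → ℝ}
    (hg : MemH s U g) : (⌊s⌋₊ = 1 ∧ ⌊2 + s⌋₊ = 3 ∧ MemHAux U (s - 1) 1 g) ∨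
      (s = 2 ∧ MemHAux U 0 2 g) := by
  unfold MemH at hg
  rcases hs.2.lt_or_eq with h | rfl
  · have h1 : ⌊s⌋₊ = 1 := (Nat.floor_eq_iff (by linarith [hs.1])).2
      ⟨by exact_mod_cast hs.1, by norm_num; exact h⟩
    have h2 : ⌊2 + s⌋₊ = 3 := (Nat.floor_eq_iff (by linarith [hs.1])).2
      ⟨by push_cast; linarith [hs.1], by push_cast; linarith⟩
    rw [h1] at hg
    exact Or.inl ⟨h1, h2, by simpa using hg⟩
  · have h1 : ⌊(2 : ℝ)⌋₊ = 2 := Nat.floor_ofNat 2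
    rw [h1] at hg
    exact Or.inr ⟨rfl, by simpa using hg⟩

lemma MemH10.summable_sq_mul_eigen {g : E d → ℝ} {G : Fin d → E d → ℝ}
    (hg : MemH10 (Omega d) g) (hG : HasWeakGradient (Omega d) g G) :
    Summable fun k => coef g k ^ 2 * eigen k := by
  refine (summable_sum (s := Finset.univ) fun j _ => hg.summable hG j).congr fun k => ?_
  simp only [fpow_single, mul_pow]
  rw [← Finset.mul_sum]
  rfl

/-- For s < 2 one reflects the given first derivatives and uses the Hardy bound; for s = 2 the
summability of (c_k eigen k)² gives all second derivatives at once. -/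
lemma memHLoc_rext (hd : 0 < d) {s : ℝ} (hs : s ∈ Icc (1 : ℝ) 2) {g : E d → ℝ}
    (hgs : MemH s (Omega d) g) (hg : MemH10 (Omega d) g) : MemHLoc s (rext 0 g) := by
  intro W _ hW
  have hc := seriesLim_coef hg.1
  unfold MemH
  rcases hgs.cases hs with ⟨hs1, -, -, hG⟩ | ⟨rfl, -, hG⟩
  · choose G hG hG2 using hG
    rw [hs1, Nat.cast_one]
    exact ⟨MemLp.rext hg.1 0 W hW, fun i => ⟨_, (hc.hasWeakPartial
      (hg.seriesLim_gradient hG i)).mono (subset_univ _), MemLp.rext (hG2 i).1 _ W hW,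
      fun hσ => hg.gagliardoSq_rext_lt_top hG hσ (fun l => (hG2 l).2 hσ) i hW⟩⟩
  · choose G hG hG2 using hG
    choose H hH hH2 using fun j => (hG2 j).2 j
    have hsum := hg.summable_eigen hG hH fun j => (hH2 j).1
    rw [Nat.floor_ofNat]
    refine hc.memHAux_rext hW (fun q hq => ?_) fun h => by simp at h
    rw [zero_add]
    refine summable_of_pow_eigen hd (N := 2) ?_ hq
    simpa only [mul_pow] using hsum

lemma memHLoc_rext_of_seriesLim (hd : 0 < d) {s : ℝ} (hs : s ∈ Icc (1 : ℝ) 2) {g u : E d → ℝ}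
    (hgs : MemH s (Omega d) g) (hg : MemH10 (Omega d) g)
    (hu : SeriesLim 0 (fun k => coef g k / eigen k) u) : MemHLoc (2 + s) (rext 0 u) := by
  intro W _ hW
  unfold MemH
  have he : ∀ k : Fin d → ℕ, eigen k ≠ 0 := fun k => (eigen_pos hd k).ne'
  rcases hgs.cases hs with ⟨-, hs3, -, hG⟩ | ⟨rfl, -, hG⟩
  · choose G hG hG2 using hG
    rw [hs3]
    refine hu.memHAux_rext hW (fun q hq => ?_) fun hσ q f' hq hf' => ?_
    · rw [zero_add]
      -- (c/λ)² λ³ = c² λ, which is summable because g has a square integrable gradient.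
      refine summable_of_pow_eigen hd (N := 3) ((hg.summable_sq_mul_eigen hG).congr fun k => ?_) hq
      have := he k
      field_simp
    · have hσ' : 0 < s - 1 := by push_cast at hσ; linarith
      have eσ : 2 + s - ((3 : ℕ) : ℝ) = s - 1 := by push_cast; ring
      rw [eσ]
      obtain ⟨l, hl⟩ : ∃ l, q l ≠ 0 := by
        by_contra! h0
        simp [h0] at hq
      -- One of the three derivatives is split off so as to compare with ∂_l g; the other two are
      -- absorbed by the division by `eigen k`, since fpow k r ≤ eigen k when r has order 2.
      obtain ⟨r, rfl⟩ : ∃ r : Fin d → ℕ, q = r + Pi.single l 1 :=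
        ⟨q - Pi.single l 1, by
          ext j
          by_cases hj : j = l
          · subst hj; simp; omega
          · simp [hj]⟩
      have hr : ∑ i, r i = 2 := by
        simpa [Finset.sum_add_distrib] using hq
      refine hf'.gagliardoSq_rext_lt_top (hg.seriesLim_gradient hG l) (fun k => ?_)
        (fun V hV => hg.gagliardoSq_rext_lt_top hG hσ' (fun j => (hG2 j).2 hσ') l hV) hW
      rw [zero_add, fpow_add_single, fpow_single, ← mul_assoc, mul_pow, mul_pow _ (freq _)]
      refine mul_le_mul_of_nonneg_right ?_ (sq_nonneg _)
      have h1 := fpow_sq_le k r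
      rw [hr] at h1
      rw [mul_pow, div_pow, div_mul_eq_mul_div, div_le_iff₀ (pow_pos (eigen_pos hd k) 2)]
      exact mul_le_mul_of_nonneg_left h1 (sq_nonneg _)
  · choose G hG hG2 using hG
    choose H hH hH2 using fun j => (hG2 j).2 j
    have hsum := hg.summable_eigen hG hH fun j => (hH2 j).1
    have h4 : ⌊(2 : ℝ) + 2⌋₊ = 4 := by norm_num
    rw [h4]
    refine hu.memHAux_rext hW (fun q hq => ?_) fun h => by norm_num at h
    rw [zero_add]
    -- (c/λ)² λ⁴ = (c λ)², the summability provided by the Laplacian of g.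
    refine summable_of_pow_eigen hd (N := 4) (hsum.congr fun k => ?_) hq
    have := he k
    field_simp

end OddReflection

open MeasureTheory OddReflection

theorem mainTheorem9 (d : ℕ) (hd : d = 1 ∨ d = 2 ∨ d = 3) (s : ℝ) (hs : s ∈ Set.Icc (1 : ℝ) 2)
    (g : OddReflection.E d → ℝ)
    (hgs : OddReflection.MemH s (OddReflection.Omega d) g)
    (hg0 : OddReflection.MemH10 (OddReflection.Omega d) g)
    (hgc : ContinuousOn g (closure (OddReflection.Omega d))) :
    ∃ gper : OddReflection.E d → ℝ,
      -- `gper` is a periodic extension of `g` of class `H^s`, by odd reflection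
      OddReflection.MemHPer s gper ∧
      (∀ x ∈ OddReflection.Omega d, gper x = g x) ∧
      (∀ j : Fin d, ∀ᵐ x : OddReflection.E d, gper (OddReflection.reflect j x) = -gper x) ∧
      -- the Dirichlet problem on `Ω` is uniquely solvable
      (∃ u, OddReflection.IsDirichletSolution g u) ∧
      (∀ u u', OddReflection.IsDirichletSolution g u → OddReflection.IsDirichletSolution g u' →
        ∀ᵐ x ∂(MeasureTheory.volume.restrict (OddReflection.Omega d)), u x = u' x) ∧
      -- the periodic problem is uniquely solvable
      (∃ uper, OddReflection.IsPeriodicSolution gper uper) ∧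
      (∀ uper uper', OddReflection.IsPeriodicSolution gper uper →
        OddReflection.IsPeriodicSolution gper uper' →
        ∀ᵐ x : OddReflection.E d, uper x = uper' x) ∧
      -- the two solutions coincide on `Ω` and are of class `H^(2+s)`
      (∀ u uper, OddReflection.IsDirichletSolution g u →
        OddReflection.IsPeriodicSolution gper uper →
        (∀ᵐ x ∂(MeasureTheory.volume.restrict (OddReflection.Omega d)), u x = uper x) ∧
        OddReflection.MemHPer (2 + s) uper ∧
        OddReflection.MemH (2 + s) (OddReflection.Omega d) u) := by
  have hd0 : 0 < d := by omega
  obtain ⟨u0, hu0⟩ := exists_seriesLim (p := 0)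
    (a := fun k => coef g k / eigen k) (by
      refine summable_of_pow_eigen hd0 (N := 2) ?_ (by simp)
      refine (summable_coef_sq hg0.1).congr fun k => ?_
      rw [div_pow, div_mul_cancel₀ _ (pow_pos (eigen_pos hd0 k) 2).ne'])
  obtain ⟨G, hG⟩ := exists_seriesLim_gradient hd0 hg0.1
  refine ⟨rext 0 g, ⟨memHLoc_rext hd0 hs hgs hg0, isPeriodic_rext 0 g⟩,
    fun x hx => rext_eq_self hx 0 g, fun j => Filter.Eventually.of_forall fun x =>
      rext_zero_reflect g x j, ⟨u0, isDirichletSolution_of_seriesLim hd0 hg0.1 hu0 hG⟩,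
    fun u u' hu hu' => (hu.seriesLim hd0).unique (hu'.seriesLim hd0),
    ⟨rext 0 u0, isPeriodicSolution_rext hd0 hg0.1 hu0⟩, fun u u' hu hu' => hu.ae_eq hu',
    fun u v hu hv => ?_⟩
  have hus := hu.seriesLim hd0
  -- The reflection of any Dirichlet solution solves the periodic problem, so uniqueness there
  -- identifies it with the given periodic solution; agreement on Ω and regularity both follow.
  have huv := (isPeriodicSolution_rext hd0 hg0.1 hus).ae_eq hv
  have hreg := memHLoc_rext_of_seriesLim hd0 hs hgs hg0 hus
  have hΩ : rext 0 u =ᵐ[volume.restrict (Omega d)] u := by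
    filter_upwards [ae_restrict_mem measurableSet_Omega] with x hx using rext_eq_self hx 0 u
  refine ⟨?_, ⟨fun W hWo hW => (hreg W hWo hW).congr hWo (ae_restrict_of_ae huv), hv.1.2⟩,
    (hreg _ isOpen_Omega isBounded_Omega).congr isOpen_Omega hΩ⟩
  filter_upwards [ae_restrict_of_ae huv, hΩ] with x h1 h2
  rw [← h2, h1]
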